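/- **Setting.** Let $1<N_0\le N$, $F=\{1,\dots,N_0\}\subset\{1,\dots,N\}$, and let $\mathcal R$ be an equivalence relation on $\{1,\dots,N\}\times F$ such that (a) $(i,x)\mathcal R(i,y)$ implies $x=y$; (b) the class of $(i,i)$ is a singleton for $i\in F$; (c) any two $i,i'\in\{1,\dots,N\}$ are joined by a sequence $i=i_1,\dots,i_p=i'$ such that for every $k<p$ there are $j,j'$ with $(i_k,j)\mathcal R(i_{k+1},j')$. A finite group $\Gamma$ acts on $\{1,\dots,N\}$, preserving $F$ and $\mathcal R$. Let $\alpha_i,\beta_i>0$ ($1\le i\le N$) be $\Gamma$-invariant with $\alpha_i\beta_i$ independent of $i$. Let $Af(x)=-\sum_{y\ne x}a_{x,y}(f(y)-f(x))$ on $\mathbb R^F$, where $a_{x,y}=a_{y,x}\ge 0$ is $\Gamma$-invariant and the graph $\{a_{x,y}>0\}$ on $F$ is connected, and let $b$ be a $\Gamma$-invariant measure on $F$ with $b(x)>0$ for all $x$; $I_b$ is the diagonal matrix with entries $b(x)$. Let $F_n=(\{1,\dots,N\}^n\times F)/\mathcal R_n$, where $(j_{-n},\dots,j_{-1},x)\,\mathcal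 R_n\,(j'_{-n},\dots,j'_{-1},x')$ iff the two are equal or there is $k_0\le n$ with $j_{-k}=j'_{-k}$ for $k>k_0$, $j_{-k}=x$ and $j'_{-k}=x'$ for $k<k_0$, and $(j_{-k_0},x)\mathcal R(j'_{-k_0},x')$. Its boundary is $\partial F_n=\{(x,\dots,x):x\in F\}\cong F$. For a blow-up sequence $\omega\in\{1,\dots,N\}^{\{1,2,\dots\}}$ put $$A_n=\sum_{i_1,\dots,i_n}\alpha_{\omega_1}\cdots\alpha_{\omega_n}\alpha_{i_1}^{-1}\cdots\alpha_{i_n}^{-1}A_{i_1\dots i_n},\qquad b_n=\sum_{i_1,\dots,i_n}\beta_{\omega_1}^{-1}\cdots\beta_{\omega_n}^{-1}\beta_{i_1}\cdots\beta_{i_n}\,b_{i_1\dots i_n},$$ where $A_{i_1\dots i_n}$, $b_{i_1\dots i_n}$ are the copies of $A$, $b$ on the cell $\{(i_1,\dots,i_n,x):x\in F\}$. Let $H_n^+$ be the operator on $\mathbb R^{F_n}$ with $\langle A_nf,g\rangle=-\int (H_n^+f)\,g\,db_n$ for all $f,g$, let $H_n^-$ be its restriction to functions vanishing on $\partial F_n$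 (Dirichlet condition), and let $\nu_n^\pm$ be the counting measures, with multiplicity, of the (non-positive) eigenvalues of $H_n^\pm$. Let $\nu_n^{ND}=\sum_\lambda\dim\{f: f|_{\partial F_n}=0,\ \langle A_nf,g\rangle=-\lambda\int fg\,db_n\ \forall g\in\mathbb R^{F_n}\}\,\delta_\lambda$. The density of states is the common weak limit $\mu$ of $N^{-n}\nu_n^+$ and $N^{-n}\nu_n^-$; the density of Neumann–Dirichlet eigenvalues is the weak limit $\mu^{ND}$ of $N^{-n}\nu_n^{ND}$. For a finite set $V$ let $\mathcal A_V$ be the subalgebra of the complex Grassmann algebra with generators $\bar\eta_x,\eta_x$ ($x\in V$) spanned by the monomials with as many $\bar\eta$'s as $\eta$'s, with the scalar product for which the monomials are orthonormal; for a matrix $Q$, $\bar\eta Q\eta=\sum Q_{x,y}\bar\eta_x\eta_y$; $i_Y$ is the adjoint of multiplication by $Y$. Write $\mathcal A=\mathcal A_F$ and define $R:\mathcal A\to\mathcal A$, homogeneous polynomial of degree $N$, by $$R(X)=i_{\prod_{x\in F_1\setminus\partial F_1}\bar\eta_x\eta_x}\big(s_1(\tau_{\alpha_1/\alpha_1}X)\cdots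 s_N(\tau_{\alpha_1/\alpha_N}X)\big),$$ where $s_i:\mathcal A\to\mathcal A_{F_1}$ is the morphism $\bar\eta_x\mapsto\bar\eta_{(i,x)}$, $\eta_x\mapsto\eta_{(i,x)}$, $\tau_t$ multiplies a monomial with $k$ variables $\bar\eta$ and $k$ variables $\eta$ by $t^k$, and $\partial F_1$ is identified with $F$. Let $G(x)=\lim_n N^{-n}\ln\|R^n(x)\|$, let $\pi:\mathcal A\setminus\{0\}\to\mathbb P(\mathcal A)$ be the projection, and let $\mathbb L^G\subset\mathbb P(\mathcal A)$ be the closure of the set of points $\pi(\exp\bar\eta Q\eta)$, $Q$ a $\Gamma$-invariant complex symmetric $F\times F$ matrix. For $x\in\mathbb L^G$ let $\rho_n(x)$ be the order of vanishing at $x$ of $R^n\circ s$ on $\mathbb L^G$, $s$ a local holomorphic section of $\pi$ over $\mathbb L^G$ near $x$, and $\rho_\infty(x)=\lim_n N^{-n}\rho_n(x)$. For $\lambda\in\mathbb C$ let $\phi(\lambda)=\exp\big(\bar\eta(A+\lambda I_b)\eta\big)$. **Theorem 3.1.** The limit $G(x)\in[-\infty,\infty)$ exists for all $x\in\mathcal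 A$, and the limit $\rho_\infty(x)$ exists for all $x\in\mathbb L^G$. There are finite measures $\mu$ and $\mu^{ND}$ on $\mathbb R$ such that, for every blow-up $\omega$, both $N^{-n}\nu_n^+$ and $N^{-n}\nu_n^-$ converge weakly to $\mu$, and $N^{-n}\nu_n^{ND}$ converges weakly to $\mu^{ND}$. Regarded as measures on $\mathbb C$ they are given by: i) $\displaystyle \mu=\frac1{2\pi}\Delta(G\circ\phi)$, where $G\circ\phi$ is finite almost everywhere and locally integrable and $\Delta$ is the distributional Laplacian on $\mathbb C$; ii) $\displaystyle \mu^{ND}=\sum_{\lambda\in\mathbb C}\rho_\infty(\pi(\phi(\lambda)))\,\delta_\lambda$. -/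

import Mathlib

open Filter Topology MeasureTheory
open scoped NNReal ENNReal

noncomputable section

/-! ## The balanced part of the Grassmann algebra -/

/-- The Grassmann algebra `⋀ (Ē ⊕ E)` with `Ē = E = ℂ^V`. -/
abbrev Grassmann (V : Type) : Type := ExteriorAlgebra ℂ ((V → ℂ) × (V → ℂ))

/-- The subalgebra `𝒜 = ⨁ₖ Ē^{∧k} ∧ E^{∧k}` spanned by the monomials containing as many
variables `η̄` as variables `η`.  It is generated by the products `u ∧ v`, `u ∈ Ē`, `v ∈ E`. -/
def balanced (V : Type) : Subalgebra ℂ (Grassmann V) :=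
  Algebra.adjoin ℂ {X | ∃ u v : V → ℂ,
    X = ExteriorAlgebra.ι ℂ ((u, 0) : (V → ℂ) × (V → ℂ)) *
      ExteriorAlgebra.ι ℂ ((0, v) : (V → ℂ) × (V → ℂ))}

/-- `𝒜` as a type. -/
abbrev Bal (V : Type) : Type := ↥(balanced V)

section Grassmann

variable {V W : Type}

/-- The element `u ∧ v` of `𝒜`, for `u ∈ Ē`, `v ∈ E`. -/
def wedgePair (u v : V → ℂ) : Bal V :=
  ⟨ExteriorAlgebra.ι ℂ ((u, 0) : (V → ℂ) × (V → ℂ)) *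
      ExteriorAlgebra.ι ℂ ((0, v) : (V → ℂ) × (V → ℂ)),
    Algebra.subset_adjoin ⟨u, v, rfl⟩⟩

open Classical in
/-- The monomial `η̄_x η_y`. -/
def etaPair (x y : V) : Bal V := wedgePair (Pi.single x 1) (Pi.single y 1)

/-- The algebra morphism `𝒜_V → 𝒜_W` induced by linear maps `Ē_V → Ē_W` and `E_V → E_W`. -/
def balMap (f g : (V → ℂ) →ₗ[ℂ] (W → ℂ)) : Bal V →ₐ[ℂ] Bal W :=
  ((ExteriorAlgebra.map (LinearMap.prodMap f g)).comp (balanced V).val).codRestrict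
    (balanced W) (by
      have h : (balanced V).map (ExteriorAlgebra.map (LinearMap.prodMap f g)) ≤ balanced W := by
        rw [balanced, AlgHom.map_adjoin]
        refine Algebra.adjoin_le ?_
        rintro _ ⟨_, ⟨u, v, rfl⟩, rfl⟩
        refine Algebra.subset_adjoin ⟨f u, g v, ?_⟩
        simp
      intro X
      exact h ⟨X.1, X.2, rfl⟩)

variable [Fintype V]

open Classical in
/-- The basis of monomials of the Grassmann algebra.  The order in which the variables of a
monomial are multiplied is fixed by an arbitrary linear order on the set of all variables; another
choice only changes the sign of some basis vectors, hence not the scalar product below. -/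
def monomialBasis (V : Type) [Fintype V] :
    Module.Basis (Finset (V ⊕ V)) ℂ (Grassmann V) :=
  letI : LinearOrder (V ⊕ V) := linearOrderOfSTO WellOrderingRel
  ((Pi.basisFun ℂ V).prod (Pi.basisFun ℂ V)).ExteriorAlgebra

/-- Coordinates of an element of `𝒜` in the basis of monomials. -/
def balCoord (V : Type) [Fintype V] : Bal V →ₗ[ℂ] EuclideanSpace ℂ (Finset (V ⊕ V)) :=
  (WithLp.linearEquiv 2 ℂ (Finset (V ⊕ V) → ℂ)).symm.toLinearMap ∘ₗ
    (monomialBasis V).equivFun.toLinearMap ∘ₗ (balanced V).val.toLinearMap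

lemma balCoord_injective (V : Type) [Fintype V] : Function.Injective (balCoord V) := by
  intro X Y h
  apply Subtype.ext
  exact (monomialBasis V).equivFun.injective
    ((WithLp.linearEquiv 2 ℂ (Finset (V ⊕ V) → ℂ)).symm.injective h)

/-- The norm of the scalar product on `𝒜` for which the monomials are orthonormal. -/
instance : NormedAddCommGroup (Bal V) :=
  NormedAddCommGroup.induced (Bal V) (EuclideanSpace ℂ (Finset (V ⊕ V))) (balCoord V)
    (balCoord_injective V)

/-- The scalar product on `𝒜` for which the monomials are orthonormal. -/
instance : InnerProductSpace ℂ (Bal V) :=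
  { NormedSpace.induced ℂ (Bal V) (EuclideanSpace ℂ (Finset (V ⊕ V))) (balCoord V) with
    inner := fun X Y => inner ℂ (balCoord V X) (balCoord V Y)
    norm_sq_eq_re_inner := fun X => norm_sq_eq_re_inner (𝕜 := ℂ) (balCoord V X)
    conj_inner_symm := fun X Y => inner_conj_symm (balCoord V X) (balCoord V Y)
    add_left := fun X Y Z => by rw [map_add]; exact inner_add_left _ _ _
    smul_left := fun X Y r => by rw [map_smul]; exact inner_smul_left _ _ _ }

instance : FiniteDimensional ℂ (Bal V) :=
  FiniteDimensional.of_injective (balCoord V) (balCoord_injective V)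

/-- The interior product `i_Y`, characterized by `⟨i_Y X, Z⟩ = ⟨X, Y Z⟩`. -/
def interiorProd (Y : Bal V) : Bal V →ₗ[ℂ] Bal V :=
  LinearMap.adjoint (LinearMap.mulLeft ℂ Y)

/-- `η̄ Q η = ∑ Q_{x,y} η̄_x η_y`. -/
def quadForm (Q : Matrix V V ℂ) : Bal V := ∑ x, ∑ y, Q x y • etaPair x y

/-- `exp (η̄ Q η)`; the powers of exponent larger than `|V|` vanish. -/
def grassExp (Q : Matrix V V ℂ) : Bal V :=
  ∑ k ∈ Finset.range (Fintype.card V + 1), ((k.factorial : ℂ)⁻¹) • quadForm Q ^ k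

lemma grassExp_ne_zero (Q : Matrix V V ℂ) : grassExp Q ≠ 0 := by
  intro h
  have h1 : ((ExteriorAlgebra.algebraMapInv (R := ℂ) (M := (V → ℂ) × (V → ℂ))).comp
      (balanced V).val) (grassExp Q) = 1 := by
    have hq : ((ExteriorAlgebra.algebraMapInv (R := ℂ) (M := (V → ℂ) × (V → ℂ))).comp
        (balanced V).val) (quadForm Q) = 0 := by
      simp [quadForm, etaPair, wedgePair, ExteriorAlgebra.algebraMapInv]
    rw [grassExp, map_sum, Finset.sum_range_succ']
    simp only [map_smul, map_pow, hq]
    simp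
  rw [h, map_zero] at h1
  exact zero_ne_one h1

open Classical in
/-- The linear map `ℂ^V → ℂ^W` sending the basis vector of `v` to the basis vector of `c v`. -/
def pushVec (c : V → W) : (V → ℂ) →ₗ[ℂ] (W → ℂ) :=
  (Pi.basisFun ℂ V).constr ℂ fun v => Pi.single (c v) 1

/-- The morphism `𝒜_V → 𝒜_W` with `η̄_x ↦ η̄_{c x}`, `η_x ↦ η_{c x}`. -/
def relabel (c : V → W) : Bal V →ₐ[ℂ] Bal W := balMap (pushVec c) (pushVec c)

/-- The map `τ_t` multiplying by `t ^ k` a monomial with `k` variables `η̄` and `k` variables `η`;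
it is induced by `η̄ ↦ t η̄`, `η ↦ η`. -/
def scaleDeg (t : ℂ) : Bal V →ₐ[ℂ] Bal V := balMap (t • LinearMap.id) LinearMap.id

/-- For an injective `c : V → W`, the morphism `𝒜_W → 𝒜_V` with `η̄_{c x} ↦ η̄_x`,
`η_{c x} ↦ η_x` that kills the variables of the points outside of `c(V)`.  On the subalgebra of
`𝒜_W` generated by the variables of `c(V)` it is the inverse of `relabel c`. -/
def restrictVars (c : V → W) : Bal W →ₐ[ℂ] Bal V :=
  balMap (LinearMap.funLeft ℂ ℂ c) (LinearMap.funLeft ℂ ℂ c)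

end Grassmann

/-! ## Holomorphic functions on subsets of a projective space -/

section ProjectiveSpace

variable {E W : Type} [NormedAddCommGroup E] [NormedSpace ℂ E]
  [NormedAddCommGroup W] [NormedSpace ℂ W]

/-- The quotient topology on the projective space. -/
instance projTopology : TopologicalSpace (Projectivization ℂ E) :=
  TopologicalSpace.coinduced
    (fun v : {v : E // v ≠ 0} => Projectivization.mk ℂ v.1 v.2) inferInstance

open Classical in
/-- The pull-back of `f` by the projection `π : E ∖ {0} → ℙ(E)` (extended by `0` at the origin). -/
def projPull (f : Projectivization ℂ E → W) (v : E) : W :=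
  if h : v ≠ 0 then f (Projectivization.mk ℂ v h) else 0

/-- `f` is holomorphic in a neighbourhood of the point `x` of the projective space. -/
def HolAt (f : Projectivization ℂ E → W) (x : Projectivization ℂ E) : Prop :=
  AnalyticAt ℂ (projPull f) x.rep

/-- `f` is holomorphic on `X` near `x`: it agrees on `X`, near `x`, with a function holomorphic
on an open subset of the projective space. -/
def HolOnAt (X : Set (Projectivization ℂ E)) (f : Projectivization ℂ E → W)
    (x : Projectivization ℂ E) : Prop :=
  ∃ F : Projectivization ℂ E → W, HolAt F x ∧ F =ᶠ[𝓝[X] x] f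

/-- The function `f` on `X` vanishes at `x` to order at least `p`: on `X`, near `x`, it is the
restriction of a holomorphic function vanishing to order at least `p` at `x`, i.e. whose germ is in
the `p`-th power of the maximal ideal.  (The projection `π` is a submersion, so that the order
can be read on the pull-back to `E ∖ {0}`.) -/
def VanishesToOrder (X : Set (Projectivization ℂ E)) (f : Projectivization ℂ E → W)
    (x : Projectivization ℂ E) (p : ℕ) : Prop :=
  ∃ F : Projectivization ℂ E → W, HolAt F x ∧ F =ᶠ[𝓝[X] x] f ∧
    projPull F =O[𝓝 x.rep] fun v => ‖v - x.rep‖ ^ p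

/-- The order of vanishing at `x` of the function `f` on `X`. -/
def vanishingOrder (X : Set (Projectivization ℂ E)) (f : Projectivization ℂ E → W)
    (x : Projectivization ℂ E) : ℕ∞ :=
  ⨆ (p : ℕ) (_ : VanishesToOrder X f x p), (p : ℕ∞)

/-- `s` is, near `x`, a holomorphic section over `X` of the projection `π`. -/
def IsLocalSection (X : Set (Projectivization ℂ E)) (s : Projectivization ℂ E → E)
    (x : Projectivization ℂ E) : Prop :=
  HolOnAt X s x ∧ ∀ᶠ y in 𝓝[X] x, ∃ h : s y ≠ 0, Projectivization.mk ℂ (s y) h = y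

end ProjectiveSpace

/-! ## The lattices and their operators -/

/-- The standing data: `N` cells, the basic cell `F = {1, …, N₀} ⊆ {1, …, N}`, the gluing relation
on `{1, …, N} × F`, the finite symmetry group, the scalings `α`, `β` with
`(α_i β_i)⁻¹` independent of `i`,
the conductances `a_{x,y}` of the difference operator on `F` and the measure `b` on `F`. -/
structure LatticeData (N N₀ : ℕ) (Γ : Type*) [Group Γ] where
  one_lt : 1 < N₀
  le : N₀ ≤ N
  /-- the gluing relation -/
  glue : Setoid (Fin N × Fin N₀)
  glue_inj : ∀ i x y, glue.r (i, x) (i, y) → x = y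
  glue_corner : ∀ x p, glue.r (Fin.castLE le x, x) p → p = (Fin.castLE le x, x)
  glue_conn : ∀ i i' : Fin N,
    Relation.ReflTransGen (fun k k' => ∃ j j', glue.r (k, j) (k', j')) i i'
  /-- the action of the symmetry group on `{1, …, N}` -/
  act : Γ →* Equiv.Perm (Fin N)
  act_lt : ∀ g (x : Fin N₀), (act g (Fin.castLE le x)).val < N₀
  glue_inv : ∀ g i x j y, glue.r (i, x) (j, y) →
    glue.r (act g i, ⟨_, act_lt g x⟩) (act g j, ⟨_, act_lt g y⟩)
  /-- the scaling in energy -/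
  alpha : Fin N → ℝ
  /-- the scaling in measure -/
  beta : Fin N → ℝ
  alpha_pos : ∀ i, 0 < alpha i
  beta_pos : ∀ i, 0 < beta i
  alpha_inv : ∀ g i, alpha (act g i) = alpha i
  beta_inv : ∀ g i, beta (act g i) = beta i
  /-- `γ_i = (α_i β_i)⁻¹` does not depend on `i` -/
  gamma_const : ∀ i j, (alpha i * beta i)⁻¹ = (alpha j * beta j)⁻¹
  /-- the conductances (only the values for `x ≠ y` are used) -/
  cond : Fin N₀ → Fin N₀ → ℝ
  cond_nonneg : ∀ x y, x ≠ y → 0 ≤ cond x y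
  cond_symm : ∀ x y, cond x y = cond y x
  cond_irred : ∀ x y, Relation.ReflTransGen (fun u v => u ≠ v ∧ 0 < cond u v) x y
  cond_inv : ∀ g x y, x ≠ y → cond ⟨_, act_lt g x⟩ ⟨_, act_lt g y⟩ = cond x y
  /-- the masses of the points of `F` -/
  mass : Fin N₀ → ℝ
  mass_pos : ∀ x, 0 < mass x
  mass_inv : ∀ g x, mass ⟨_, act_lt g x⟩ = mass x

namespace LatticeData

variable {N N₀ : ℕ} {Γ : Type*} [Group Γ] (D : LatticeData N N₀ Γ)

/-- The inclusion `F ⊆ {1, …, N}`. -/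
def inc (x : Fin N₀) : Fin N := Fin.castLE D.le x

/-- The action of the symmetry group on `F`. -/
def actF (g : Γ) (x : Fin N₀) : Fin N₀ := ⟨_, D.act_lt g x⟩

/-- The equivalence relation `ℛ_n` on `{1, …, N}^n × F`.  The entry `j k` of a sequence is
`j_{-(k+1)}`.  (Equality has to be added only for `n = 0`.) -/
def gluing (n : ℕ) : Setoid ((Fin n → Fin N) × Fin N₀) where
  r p q := p = q ∨ ∃ k₀ : Fin n, (∀ k, k₀ < k → p.1 k = q.1 k) ∧
    (∀ k, k < k₀ → p.1 k = D.inc p.2 ∧ q.1 k = D.inc q.2) ∧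
    D.glue.r (p.1 k₀, p.2) (q.1 k₀, q.2)
  iseqv := by
    have key : ∀ p q s : (Fin n → Fin N) × Fin N₀, ∀ k₁ k₂ : Fin n, k₁ < k₂ →
        ((∀ k, k₁ < k → p.1 k = q.1 k) ∧
          (∀ k, k < k₁ → p.1 k = D.inc p.2 ∧ q.1 k = D.inc q.2) ∧
          D.glue.r (p.1 k₁, p.2) (q.1 k₁, q.2)) →
        (∀ k, k < k₂ → q.1 k = D.inc q.2 ∧ s.1 k = D.inc s.2) → p = q := by
      rintro p q s k₁ k₂ hlt ⟨h1, h2, h3⟩ h4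
      have h5 : q.1 k₁ = D.inc q.2 := (h4 k₁ hlt).1
      rw [h5] at h3
      have h6 := D.glue_corner q.2 _ (D.glue.iseqv.symm h3)
      have h7 : p.2 = q.2 := (Prod.mk.inj h6).2
      have h8 : p.1 k₁ = D.inc q.2 := (Prod.mk.inj h6).1
      refine Prod.ext (funext fun k => ?_) h7
      rcases lt_trichotomy k k₁ with hk | hk | hk
      · rw [(h2 k hk).1, (h2 k hk).2, h7]
      · rw [hk, h8, h5]
      · exact h1 k hk
    have symm' : ∀ {p q : (Fin n → Fin N) × Fin N₀},
        (p = q ∨ ∃ k₀ : Fin n, (∀ k, k₀ < k → p.1 k = q.1 k) ∧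
          (∀ k, k < k₀ → p.1 k = D.inc p.2 ∧ q.1 k = D.inc q.2) ∧
          D.glue.r (p.1 k₀, p.2) (q.1 k₀, q.2)) →
        (q = p ∨ ∃ k₀ : Fin n, (∀ k, k₀ < k → q.1 k = p.1 k) ∧
          (∀ k, k < k₀ → q.1 k = D.inc q.2 ∧ p.1 k = D.inc p.2) ∧
          D.glue.r (q.1 k₀, q.2) (p.1 k₀, p.2)) := by
      rintro p q (h | ⟨k₀, h1, h2, h3⟩)
      · exact Or.inl h.symm
      · exact Or.inr ⟨k₀, fun k hk => (h1 k hk).symm, fun k hk => (h2 k hk).symm,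
          D.glue.iseqv.symm h3⟩
    refine ⟨fun p => Or.inl rfl, symm', ?_⟩
    rintro p q s (rfl | ⟨k₁, h1⟩) hqs
    · exact hqs
    rcases hqs with rfl | ⟨k₂, h2⟩
    · exact Or.inr ⟨k₁, h1⟩
    rcases lt_trichotomy k₁ k₂ with hk | hk | hk
    · have := key p q s k₁ k₂ hk h1 h2.2.1
      subst this
      exact Or.inr ⟨k₂, h2⟩
    · subst hk
      exact Or.inr ⟨k₁, fun k hk => (h1.1 k hk).trans (h2.1 k hk),
        fun k hk => ⟨(h1.2.1 k hk).1, (h2.2.1 k hk).2⟩, D.glue.iseqv.trans h1.2.2 h2.2.2⟩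
    · have := key s q p k₂ k₁ hk
        ⟨fun k hk => (h2.1 k hk).symm, fun k hk => (h2.2.1 k hk).symm,
          D.glue.iseqv.symm h2.2.2⟩ (fun k hk => (h1.2.1 k hk).symm)
      subst this
      exact Or.inr ⟨k₁, h1⟩

/-- The set `F_n = ({1, …, N}^n × F) / ℛ_n`. -/
def Vert (n : ℕ) : Type := Quotient (D.gluing n)

instance (n : ℕ) : Finite (D.Vert n) := inferInstanceAs (Finite (Quotient (D.gluing n)))

instance (n : ℕ) : Fintype (D.Vert n) := Fintype.ofFinite _

/-- The identification of `F` with the `0`-cell `F_{n,i₁,…,i_n}` of `F_n`. -/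
def cell {n : ℕ} (i : Fin n → Fin N) (x : Fin N₀) : D.Vert n := Quotient.mk (D.gluing n) (i, x)

/-- The identification of `F` with the boundary of `F_n`, `x ↦ (x, …, x)`. -/
def bdryPt (n : ℕ) (x : Fin N₀) : D.Vert n := D.cell (fun _ => D.inc x) x

/-- The boundary `∂F_n`. -/
def bdry (n : ℕ) : Set (D.Vert n) := Set.range (D.bdryPt n)

/-- The matrix of `A f (x) = - ∑_{y ≠ x} a_{x,y} (f y - f x)`. -/
def opA : Matrix (Fin N₀) (Fin N₀) ℝ :=
  Matrix.of fun x y => if x = y then ∑ z ∈ Finset.univ.erase x, D.cond x z else -D.cond x y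

open Classical in
/-- The copy on the cell `c(F)` of an `F × F` matrix, extended by `0`. -/
def copyMat {V : Type} (c : Fin N₀ → V) (Q : Matrix (Fin N₀) (Fin N₀) ℝ) : Matrix V V ℝ :=
  Matrix.of fun x y => ∑ u, ∑ v, if c u = x ∧ c v = y then Q u v else 0

/-- The matrix of the operator `A_n`, for the blow-up `(ω 0, ω 1, …)`. -/
def opAn (ω : ℕ → Fin N) (n : ℕ) : Matrix (D.Vert n) (D.Vert n) ℝ :=
  ∑ i : Fin n → Fin N, ((∏ k : Fin n, D.alpha (ω k)) * ∏ k, (D.alpha (i k))⁻¹) •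
    copyMat (D.cell i) D.opA

open Classical in
/-- The masses of the points of `F_n` for the measure `b_n`. -/
def massN (ω : ℕ → Fin N) (n : ℕ) (x : D.Vert n) : ℝ :=
  ∑ i : Fin n → Fin N, ((∏ k : Fin n, (D.beta (ω k))⁻¹) * ∏ k, D.beta (i k)) *
    ∑ u, if D.cell i u = x then D.mass u else 0

/-- The matrix of `H_n⁺`, determined by `⟨A_n f, g⟩ = - ∫ (H_n⁺ f) g db_n`. -/
def hPlus (ω : ℕ → Fin N) (n : ℕ) : Matrix (D.Vert n) (D.Vert n) ℝ :=
  Matrix.of fun x y => -(D.massN ω n x)⁻¹ * D.opAn ω n x y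

/-- The matrix of `H_n⁻`, the operator on the functions on `F_n ∖ ∂F_n` obtained by restriction
of `H_n⁺` (Dirichlet condition). -/
def hMinus (ω : ℕ → Fin N) (n : ℕ) :
    Matrix {x : D.Vert n // x ∉ D.bdry n} {x : D.Vert n // x ∉ D.bdry n} ℝ :=
  (D.hPlus ω n).submatrix Subtype.val Subtype.val

/-- The Dirac mass at `t`. -/
def diracAt (t : ℝ) : FiniteMeasure ℝ := ⟨Measure.dirac t, inferInstance⟩

open Classical in
/-- The counting measure of the eigenvalues, with multiplicity, of `H_n⁺`. -/
def nuPlus (ω : ℕ → Fin N) (n : ℕ) : FiniteMeasure ℝ :=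
  ((D.hPlus ω n).charpoly.roots.map diracAt).sum

open Classical in
/-- The counting measure of the eigenvalues, with multiplicity, of `H_n⁻`. -/
def nuMinus (ω : ℕ → Fin N) (n : ℕ) : FiniteMeasure ℝ :=
  ((D.hMinus ω n).charpoly.roots.map diracAt).sum

/-- The space of Neumann–Dirichlet eigenfunctions for the value `t`: functions vanishing on `∂F_n`
such that `⟨A_n f, g⟩ = - t ∫ f g db_n` for all functions `g` on `F_n`. -/
def ndSpace (ω : ℕ → Fin N) (n : ℕ) (t : ℝ) : Submodule ℝ (D.Vert n → ℝ) where
  carrier := {f | (∀ x ∈ D.bdry n, f x = 0) ∧ ∀ g : D.Vert n → ℝ,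
    ∑ x, (D.opAn ω n).mulVec f x * g x = -t * ∑ x, f x * g x * D.massN ω n x}
  zero_mem' := ⟨fun _ _ => rfl, fun g => by simp⟩
  add_mem' := by
    rintro f f' ⟨h1, h2⟩ ⟨h1', h2'⟩
    refine ⟨fun x hx => by simp [h1 x hx, h1' x hx], fun g => ?_⟩
    simp only [Matrix.mulVec_add, Pi.add_apply, add_mul, Finset.sum_add_distrib, mul_add, h2, h2']
  smul_mem' := by
    rintro c f ⟨h1, h2⟩
    refine ⟨fun x hx => by simp [h1 x hx], fun g => ?_⟩
    simp only [Matrix.mulVec_smul, Pi.smul_apply, smul_eq_mul, mul_assoc, ← Finset.mul_sum]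
    have := h2 g
    simp only [mul_assoc] at this
    rw [this]
    ring

open Classical in
/-- The counting measure of the Neumann–Dirichlet eigenvalues, with multiplicity.  These are
eigenvalues of `H_n⁺`, so that it is enough to sum over the spectrum of `H_n⁺`. -/
def nuND (ω : ℕ → Fin N) (n : ℕ) : FiniteMeasure ℝ :=
  ∑ t ∈ (D.hPlus ω n).charpoly.roots.toFinset,
    ((Module.finrank ℝ (D.ndSpace ω n t) : ℕ) : ℝ≥0) • diracAt t

/-- `μ` is the density of states: the weak limit of `N⁻ⁿ ν_n^±`, for both boundary conditions. -/
def IsDensityOfStates (ω : ℕ → Fin N) (μ : FiniteMeasure ℝ) : Prop :=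
  Tendsto (fun n => ((N : ℝ≥0) ^ n)⁻¹ • D.nuPlus ω n) atTop (𝓝 μ) ∧
    Tendsto (fun n => ((N : ℝ≥0) ^ n)⁻¹ • D.nuMinus ω n) atTop (𝓝 μ)

/-- `μ` is the density of Neumann–Dirichlet eigenvalues: the weak limit of `N⁻ⁿ ν_n^{ND}`. -/
def IsDensityOfND (ω : ℕ → Fin N) (μ : FiniteMeasure ℝ) : Prop :=
  Tendsto (fun n => ((N : ℝ≥0) ^ n)⁻¹ • D.nuND ω n) atTop (𝓝 μ)

/-! ## The renormalization map -/

/-- The first cell. -/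
def firstCell : Fin N := D.inc ⟨0, lt_trans Nat.zero_lt_one D.one_lt⟩

/-- The map `X ↦ s₁(τ_{α₁/α₁} X) ⋯ s_N(τ_{α₁/α_N} X)` from `𝒜_F` to `𝒜_{F_1}`. -/
def glueMap (X : Bal (Fin N₀)) : Bal (D.Vert 1) :=
  (List.ofFn fun i : Fin N => relabel (D.cell (n := 1) fun _ => i)
    (scaleDeg (((D.alpha D.firstCell * (D.alpha i)⁻¹ : ℝ)) : ℂ) X)).prod

open Classical in
/-- The monomial `∏_{x ∈ F_1 ∖ ∂F_1} η̄_x η_x`; the factors commute. -/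
def interiorMonomial : Bal (D.Vert 1) :=
  ((Finset.univ.filter fun x => x ∉ D.bdry 1).toList.map fun x => etaPair x x).prod

/-- The renormalization map `R : 𝒜 → 𝒜`: glue the `N` copies, take the interior product by
`∏_{x ∈ F_1 ∖ ∂F_1} η̄_x η_x`, and identify `∂F_1` with `F`. -/
def renorm (X : Bal (Fin N₀)) : Bal (Fin N₀) :=
  restrictVars (D.bdryPt 1) (interiorProd D.interiorMonomial (D.glueMap X))

/-- `N⁻ⁿ ln ‖Rⁿ(x)‖`, with `ln 0 = -∞`. -/
def greenSeq (n : ℕ) (x : Bal (Fin N₀)) : EReal :=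
  ((((N : ℝ) ^ n)⁻¹ : ℝ) : EReal) * ENNReal.log ‖D.renorm^[n] x‖ₑ

/-- The Green function `G(x) = lim N⁻ⁿ ln ‖Rⁿ(x)‖`. -/
def green (x : Bal (Fin N₀)) : EReal := limUnder atTop fun n => D.greenSeq n x

/-- The space of complex symmetric matrices invariant under the symmetry group. -/
def symG : Set (Matrix (Fin N₀) (Fin N₀) ℂ) :=
  {Q | Q.IsSymm ∧ ∀ g x y, Q (D.actF g x) (D.actF g y) = Q x y}

/-- The closure in `ℙ(𝒜)` of the set of points `π(exp(η̄Qη))`, for `Q` symmetric and invariant. -/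
def lagG : Set (Projectivization ℂ (Bal (Fin N₀))) :=
  closure {p | ∃ Q ∈ D.symG, p = Projectivization.mk ℂ (grassExp Q) (grassExp_ne_zero Q)}

/-- The order of vanishing `ρ_n(x)` of `Rⁿ` restricted to `𝕃^G`: the order at `x` of `Rⁿ ∘ s`, for
`s` a holomorphic section of `π` over a neighbourhood of `x` in `𝕃^G` (it does not depend on
`s`, since two sections differ by a holomorphic factor without zeros and `R` is homogeneous). -/
def rho (n : ℕ) (x : Projectivization ℂ (Bal (Fin N₀))) : ℕ∞ :=
  ⨆ (s : Projectivization ℂ (Bal (Fin N₀)) → Bal (Fin N₀)) (_ : IsLocalSection D.lagG s x),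
    vanishingOrder D.lagG (fun y => D.renorm^[n] (s y)) x

/-- `N⁻ⁿ ρ_n(x)`. -/
def rhoSeq (n : ℕ) (x : Projectivization ℂ (Bal (Fin N₀))) : ℝ≥0∞ :=
  (D.rho n x : ℝ≥0∞) / (N : ℝ≥0∞) ^ n

/-- `ρ_∞(x) = lim N⁻ⁿ ρ_n(x)`. -/
def rhoInf (x : Projectivization ℂ (Bal (Fin N₀))) : ℝ≥0∞ := limUnder atTop fun n => D.rhoSeq n x

/-- The matrix `A + z I_b`. -/
def pencil (z : ℂ) : Matrix (Fin N₀) (Fin N₀) ℂ :=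
  D.opA.map (fun r : ℝ => (r : ℂ)) + z • Matrix.diagonal fun x => (D.mass x : ℂ)

/-- `φ(z) = exp(η̄ (A + z I_b) η)`. -/
def phi (z : ℂ) : Bal (Fin N₀) := grassExp (D.pencil z)

/-- The point `π(φ(z))`. -/
def projPhi (z : ℂ) : Projectivization ℂ (Bal (Fin N₀)) :=
  Projectivization.mk ℂ (D.phi z) (grassExp_ne_zero _)

end LatticeData

/-- `m = (2π)⁻¹ Δ u` in the sense of distributions on `ℂ`, for a function `u` with values in
`[-∞, ∞]` which is almost everywhere finite and locally integrable. -/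
def IsLaplacianOver2Pi (u : ℂ → EReal) (m : Measure ℂ) : Prop :=
  (∀ᵐ z : ℂ, u z ≠ ⊥ ∧ u z ≠ ⊤) ∧ LocallyIntegrable (fun z => (u z).toReal) ∧
    ∀ ψ : ℂ → ℝ, ContDiff ℝ (⊤ : ℕ∞) ψ → HasCompactSupport ψ →
      ∫ z, ψ z ∂m = (2 * Real.pi)⁻¹ * ∫ z : ℂ, (u z).toReal * Laplacian.laplacian ψ z

end

/-!
The proof rests on Gaussian integration. For a matrix `Q` for which all the Schur complements exist,
`R^n (exp η̄Qη)` is `kappa n Q • exp η̄Sη`, where `S` is the Schur complement on `∂F_n` of the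
matrix `glueMat n Q` glued on `F_n` from weighted copies of `Q`, and `kappa n Q` is, up to a positive
constant, the determinant of its interior block (`exists_iterate_renorm_grassExp`). For
`Q = A + z I_b` the glued matrix is the pencil of the operators `A_n`, `b_n`, normalized so that the
blow-up disappears (`glueMat_pencil`, `opAn_eq`, `massN_eq`). The condition `Coer`, that the form of
`θ Q` has a positive real part, is stable under gluing and Schur complements; it holds for `A + z I_b`
off the real axis, and provides exponential bounds for the Schur complements.

*Existence of the limits.* Since `R` is homogeneous of degree `N`, `N⁻ⁿ ln ‖Rⁿ‖` is decreasing up to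
a summable error and `N⁻ⁿ ρ_n` is increasing.

*Density of states.* Off the real axis the exponential bounds show that the Green function at
`φ(z)` is finite and is the limit of `N⁻ⁿ ln |det|`, for the Dirichlet as well as for the Neumann
determinant (`exists_tendsto_log_det`). These determinants are, up to constants, the products of the
`z - λ` over the eigenvalues `λ`. As `(2π)⁻¹ ln |z|` is a fundamental solution of the Laplace
equation, the convergence of these logarithmic potentials, which are dominated by `|ln |Im z||` near
the real axis, gives that of the eigenvalue measures against test functions of the plane, and then
their weak convergence (`tendsto_sum_of_tendsto_log`, `tendsto_of_tendsto_integral_test`).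

*Neumann–Dirichlet eigenvalues.* For each `t`, the dimension `d_n` of the Neumann–Dirichlet
eigenspace and the order of vanishing `ρ_n` at `π(φ(t))` are compared with the multiplicity `m_n` of
`t` as a Dirichlet eigenvalue. Normal derivatives at the `N₀` boundary points give
`d_n ≤ m_n ≤ d_n + N₀`. The coefficient of `1` of `R^n` along the curve `φ` is `kappa n`, with a zero
of order `m_n` at `t`, hence `ρ_n ≤ m_n` (`rho_projPhi_le`). Conversely the determinant of a
perturbation of size `s` is `O(s ^ m_n)` and `exp η̄Sη` is `O(s ^ (-N₀))` in coercive directions,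
which form an open set; as the Taylor polynomials of a holomorphic function are determined on an open
set of directions, `m_n - N₀ ≤ ρ_n` (`isBigO_of_isBigO_lines`, `le_rho`). So `N⁻ⁿ d_n` tends to
`ρ_∞(π(φ(t)))`, and it increases to this limit because eigenfunctions on the cells can be glued
(`mul_finrank_ndKer_le`); the weak convergence follows by dominated convergence.
-/

noncomputable section

/-! ### Contractions in an exterior algebra -/

section ExteriorBasis

open ExteriorAlgebra Set.powersetCard

variable {I M : Type*} [LinearOrder I] [AddCommGroup M] [Module ℂ M]
  (b : Module.Basis I ℂ M)

lemma exteriorBasis_singleton (i : I) : b.ExteriorAlgebra ({i} : Finset I) = ι ℂ (b i) := by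
  have h2 : ({i} : Finset I).card = 1 := Finset.card_singleton i
  rw [basis_apply_ofCard b h2]
  rw [ιMulti_family, ιMulti_apply]
  simp only [List.ofFn_succ, List.ofFn_zero, List.prod_cons, List.prod_nil, mul_one,
    Function.comp_apply]
  congr 2
  have h3 := (mem_range_ofFinEmbEquiv_symm_iff_mem (ofCard h2) _).1 (Set.mem_range_self 0)
  exact Finset.mem_singleton.1 h3

/-- Multiplication by a variable sends a monomial to a monomial, up to sign. -/
lemma ι_mul_exteriorBasis {i : I} {T : Finset I} (h : i ∉ T) :
    ∃ σ : ℤˣ, ι ℂ (b i) * b.ExteriorAlgebra T = σ • b.ExteriorAlgebra (insert i T) := by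
  have hd : Disjoint (ofCard (Finset.card_singleton i)).val
    (ofCard (rfl : T.card = T.card)).val := by
    simpa using h
  have h3 := basis_mul_of_disjoint b (ofCard (Finset.card_singleton i))
    (ofCard (rfl : T.card = T.card)) hd
  refine ⟨Equiv.Perm.sign (permOfDisjoint hd), ?_⟩
  rw [← exteriorBasis_singleton]
  refine h3.trans ?_
  congr 2
  ext j
  simp [disjUnion]

lemma ι_mul_exteriorBasis_of_mem {i : I} {T : Finset I} (h : i ∈ T) :
    ι ℂ (b i) * b.ExteriorAlgebra T = 0 := by
  rw [← exteriorBasis_singleton]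
  exact basis_mul_of_not_disjoint b (ofCard (Finset.card_singleton i))
    (ofCard (rfl : T.card = T.card)) (by simpa using h)

/-- The contraction of an element of the exterior algebra by a linear form. -/
def contr (d : Module.Dual ℂ M) : ExteriorAlgebra ℂ M →ₗ[ℂ] ExteriorAlgebra ℂ M :=
  CliffordAlgebra.contractLeft (Q := (0 : QuadraticForm ℂ M)) d

lemma contr_ι_mul (d : Module.Dual ℂ M) (a : M) (X : ExteriorAlgebra ℂ M) :
    contr d (ι ℂ a * X) = d a • X - ι ℂ a * contr d X :=
  CliffordAlgebra.contractLeft_ι_mul (Q := (0 : QuadraticForm ℂ M)) d a X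

lemma contr_one (d : Module.Dual ℂ M) : contr d (1 : ExteriorAlgebra ℂ M) = 0 :=
  CliffordAlgebra.contractLeft_one _ d

lemma contr_exteriorBasis_of_notMem {i : I} {T : Finset I} (h : i ∉ T) :
    contr (b.coord i) (b.ExteriorAlgebra T) = 0 := by
  induction T using Finset.induction_on with
  | empty =>
    have h1 : b.ExteriorAlgebra (∅ : Finset I) = 1 := by
      rw [basis_apply_ofCard b (Finset.card_empty), ιMulti_family, ιMulti_apply]
      simp
    rw [h1, contr_one]
  | insert j T hj ih =>
    obtain ⟨σ, hσ⟩ := ι_mul_exteriorBasis b hj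
    have hij : j ≠ i := by rintro rfl; simp at h
    have h2 : contr (b.coord i) (ι ℂ (b j) * b.ExteriorAlgebra T) = 0 := by
      rw [contr_ι_mul, ih (fun hh => h (Finset.mem_insert_of_mem hh))]
      simp [hij]
    rw [hσ, Units.smul_def, map_zsmul] at h2
    rcases Int.units_eq_one_or σ with rfl | rfl <;> simpa using h2

lemma repr_ι_mul_exteriorBasis (i : I) (S T : Finset I) :
    b.ExteriorAlgebra.repr (ι ℂ (b i) * b.ExteriorAlgebra S) T =
      b.ExteriorAlgebra.repr (contr (b.coord i) (b.ExteriorAlgebra T)) S ∧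
    (starRingEnd ℂ) (b.ExteriorAlgebra.repr (ι ℂ (b i) * b.ExteriorAlgebra S) T) =
      b.ExteriorAlgebra.repr (ι ℂ (b i) * b.ExteriorAlgebra S) T := by
  classical
  have hmem : i ∈ T → ∃ σ : ℤˣ, ι ℂ (b i) * b.ExteriorAlgebra (T.erase i) = σ • b.ExteriorAlgebra T ∧
      contr (b.coord i) (b.ExteriorAlgebra T) = σ • b.ExteriorAlgebra (T.erase i) := by
    intro hT
    obtain ⟨σ, hσ⟩ := ι_mul_exteriorBasis b (Finset.notMem_erase i T)
    rw [Finset.insert_erase hT] at hσ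
    refine ⟨σ, hσ, ?_⟩
    have h1 : b.ExteriorAlgebra T = σ • (ι ℂ (b i) * b.ExteriorAlgebra (T.erase i)) := by
      rw [hσ, smul_smul, Int.units_mul_self, one_smul]
    rw [h1, Units.smul_def, map_zsmul, contr_ι_mul,
      contr_exteriorBasis_of_notMem b (Finset.notMem_erase i T)]
    simp [Units.smul_def]
  by_cases hS : i ∈ S
  · rw [ι_mul_exteriorBasis_of_mem b hS]
    by_cases hT : i ∈ T
    · obtain ⟨σ, -, h2⟩ := hmem hT
      have hne : T.erase i ≠ S := by rintro rfl; simp at hS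
      rw [h2, Units.smul_def, map_zsmul]
      simp [hne]
    · rw [contr_exteriorBasis_of_notMem b hT]; simp
  · by_cases hT : i ∈ T
    · obtain ⟨σ, h1, h2⟩ := hmem hT
      by_cases hST : S = T.erase i
      · subst hST
        rw [h1, h2]
        rcases Int.units_eq_one_or σ with rfl | rfl <;> simp
      · obtain ⟨τ, hτ⟩ := ι_mul_exteriorBasis b hS
        have hne : insert i S ≠ T := by
          rintro rfl; exact hST (Finset.erase_insert hS).symm
        rw [hτ, h2, Units.smul_def, map_zsmul, Units.smul_def, map_zsmul]
        simp [hne, Ne.symm hST]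
    · obtain ⟨τ, hτ⟩ := ι_mul_exteriorBasis b hS
      have hne : insert i S ≠ T := by rintro rfl; simp at hT
      rw [hτ, contr_exteriorBasis_of_notMem b hT, Units.smul_def, map_zsmul]
      simp [hne]

/-- Contraction by a coordinate form is adjoint to multiplication by the corresponding variable,
for the scalar product in which the monomials are orthonormal. -/
lemma sum_conj_repr_ι_mul [Fintype I] (i : I) (X Z : ExteriorAlgebra ℂ M) :
    ∑ T, (starRingEnd ℂ) (b.ExteriorAlgebra.repr (ι ℂ (b i) * X) T) * b.ExteriorAlgebra.repr Z T =
      ∑ S, (starRingEnd ℂ) (b.ExteriorAlgebra.repr X S) *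
        b.ExteriorAlgebra.repr (contr (b.coord i) Z) S := by
  classical
  set B := b.ExteriorAlgebra with hB
  have h1 : ∀ T, B.repr (ι ℂ (b i) * X) T =
      ∑ S, B.repr X S * B.repr (ι ℂ (b i) * B S) T := by
    intro T
    conv_lhs => rw [← B.sum_repr X, Finset.mul_sum, map_sum]
    simp
  have h2 : ∀ S, B.repr (contr (b.coord i) Z) S =
      ∑ T, B.repr Z T * B.repr (contr (b.coord i) (B T)) S := by
    intro S
    conv_lhs => rw [← B.sum_repr Z, map_sum, map_sum]
    simp
  simp_rw [h1, h2, map_sum, map_mul, Finset.sum_mul, Finset.mul_sum]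
  rw [Finset.sum_comm]
  refine Finset.sum_congr rfl fun S _ => Finset.sum_congr rfl fun T _ => ?_
  rw [(repr_ι_mul_exteriorBasis b i S T).2, (repr_ι_mul_exteriorBasis b i S T).1]
  ring

end ExteriorBasis

/-! ### Exponentials of quadratic forms in the Grassmann algebra -/

section GrassmannExp

variable {V W : Type}

open ExteriorAlgebra

lemma ι_mul_ι_swap {M : Type*} [AddCommGroup M] [Module ℂ M] (a b : M) :
    ι ℂ a * ι ℂ b = -(ι ℂ b * ι ℂ a) :=
  eq_neg_of_add_eq_zero_left (ι_add_mul_swap a b)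

lemma ι_pair_mul_ι {M : Type*} [AddCommGroup M] [Module ℂ M] (a b c : M) :
    ι ℂ a * ι ℂ b * ι ℂ c = ι ℂ c * (ι ℂ a * ι ℂ b) := by
  rw [mul_assoc, ι_mul_ι_swap b c, mul_neg, ← mul_assoc, ι_mul_ι_swap a c, neg_mul, neg_neg,
    mul_assoc]

lemma bal_commute (X Y : Bal V) : Commute X Y := by
  have h := Algebra.isMulCommutative_adjoin ℂ (s := {X : Grassmann V | ∃ u v : V → ℂ,
    X = ι ℂ ((u, 0) : (V → ℂ) × (V → ℂ)) * ι ℂ ((0, v) : (V → ℂ) × (V → ℂ))}) (by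
      rintro _ ⟨u, v, rfl⟩ _ ⟨u', v', rfl⟩
      rw [← mul_assoc, ι_pair_mul_ι, mul_assoc, ι_pair_mul_ι, ← mul_assoc])
  exact h.is_comm.comm X Y

lemma wedgePair_sq (u v v' : V → ℂ) : wedgePair u v * wedgePair u v' = 0 := by
  apply Subtype.ext
  change ι ℂ ((u, 0) : (V → ℂ) × (V → ℂ)) * ι ℂ ((0, v) : (V → ℂ) × (V → ℂ)) *
    (ι ℂ ((u, 0) : (V → ℂ) × (V → ℂ)) * ι ℂ ((0, v') : (V → ℂ) × (V → ℂ))) = 0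
  rw [← mul_assoc, ι_pair_mul_ι, ← mul_assoc, ι_sq_zero, zero_mul, zero_mul]

/-- `(u, v) ↦ u ∧ v` as a bilinear map. -/
def wedgePairL : (V → ℂ) →ₗ[ℂ] (V → ℂ) →ₗ[ℂ] Bal V :=
  LinearMap.mk₂ ℂ wedgePair
    (fun u u' v => Subtype.ext (by
      change ι ℂ ((u + u', 0) : (V → ℂ) × (V → ℂ)) * _ = ι ℂ ((u, 0) : (V → ℂ) × (V → ℂ)) * _ +
        ι ℂ ((u', 0) : (V → ℂ) × (V → ℂ)) * _
      rw [← add_mul, ← map_add]; simp))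
    (fun c u v => Subtype.ext (by
      change ι ℂ ((c • u, 0) : (V → ℂ) × (V → ℂ)) * _ = c • (ι ℂ ((u, 0) : (V → ℂ) × (V → ℂ)) * _)
      rw [← smul_mul_assoc, ← map_smul]; simp))
    (fun u v v' => Subtype.ext (by
      change _ * ι ℂ ((0, v + v') : (V → ℂ) × (V → ℂ)) = _ * ι ℂ ((0, v) : (V → ℂ) × (V → ℂ)) +
        _ * ι ℂ ((0, v') : (V → ℂ) × (V → ℂ))
      rw [← mul_add, ← map_add]; simp))
    (fun c u v => Subtype.ext (by
      change _ * ι ℂ ((0, c • v) : (V → ℂ) × (V → ℂ)) = c • (_ * ι ℂ ((0, v) : (V → ℂ) × (V → ℂ)))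
      rw [← mul_smul_comm, ← map_smul]; simp))

lemma wedgePairL_apply (u v : V → ℂ) : wedgePairL u v = wedgePair u v := rfl

lemma balMap_wedgePair (f g : (V → ℂ) →ₗ[ℂ] (W → ℂ)) (u v : V → ℂ) :
    balMap f g (wedgePair u v) = wedgePair (f u) (g v) := by
  apply Subtype.ext
  change ExteriorAlgebra.map (LinearMap.prodMap f g) (ι ℂ ((u, 0) : (V → ℂ) × (V → ℂ)) *
    ι ℂ ((0, v) : (V → ℂ) × (V → ℂ))) = _
  simp [wedgePair]

variable [Fintype V] [Fintype W]

lemma quadForm_add (Q Q' : Matrix V V ℂ) : quadForm (Q + Q') = quadForm Q + quadForm Q' := by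
  simp [quadForm, add_smul, Finset.sum_add_distrib]

lemma quadForm_smul (c : ℂ) (Q : Matrix V V ℂ) : quadForm (c • Q) = c • quadForm Q := by
  simp [quadForm, mul_smul, Finset.smul_sum]

/-- `Q ↦ η̄ Q η` as a linear map. -/
def quadFormL : Matrix V V ℂ →ₗ[ℂ] Bal V where
  toFun := quadForm
  map_add' := quadForm_add
  map_smul' := quadForm_smul

lemma quadFormL_apply (Q : Matrix V V ℂ) : quadFormL Q = quadForm Q := rfl

lemma quadForm_vecMulVec (u v : V → ℂ) : quadForm (Matrix.vecMulVec u v) = wedgePair u v := by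
  classical
  rw [← wedgePairL_apply]
  have h : ∀ w : V → ℂ, w = ∑ x, w x • (Pi.single x 1 : V → ℂ) := fun w => by
    ext y; simp [Finset.sum_apply, Pi.single_apply]
  conv_rhs => rw [h u, h v]
  simp only [map_sum, map_smul, LinearMap.sum_apply, LinearMap.smul_apply, wedgePairL_apply]
  rw [quadForm, Finset.sum_comm]
  simp only [Finset.smul_sum]
  refine Finset.sum_congr rfl fun x _ => Finset.sum_congr rfl fun y _ => ?_
  simp only [Matrix.vecMulVec_apply, etaPair, smul_smul]
  rw [mul_comm]

lemma quadForm_eq_sum_wedgePair (Q : Matrix V V ℂ) [DecidableEq V] :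
    quadForm Q = ∑ x, wedgePair (Pi.single x 1) (Q x) := by
  have : Q = ∑ x, Matrix.vecMulVec (Pi.single x 1 : V → ℂ) (Q x) := by
    ext a b
    simp [Matrix.sum_apply, Matrix.vecMulVec_apply, Pi.single_apply]
  conv_lhs => rw [this]
  rw [← quadFormL_apply, map_sum]
  exact Finset.sum_congr rfl fun x _ => quadForm_vecMulVec _ _

omit [Fintype V] in
lemma sum_wedgePair_pow_eq_zero {ι : Type*} (s : Finset ι) (u v : ι → V → ℂ) :
    (∑ x ∈ s, wedgePair (u x) (v x)) ^ (s.card + 1) = 0 := by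
  classical
  induction s using Finset.induction_on with
  | empty => simp
  | insert x s hx ih =>
    rw [Finset.sum_insert hx]
    refine Commute.add_pow_eq_zero_of_add_le_succ_of_pow_eq_zero (bal_commute _ _)
      (m := 2) (n := s.card + 1) ?_ ih ?_
    · rw [sq, wedgePair_sq]
    · rw [Finset.card_insert_of_notMem hx]; omega

lemma quadForm_pow_eq_zero (Q : Matrix V V ℂ) : quadForm Q ^ (Fintype.card V + 1) = 0 := by
  classical
  rw [quadForm_eq_sum_wedgePair]
  exact sum_wedgePair_pow_eq_zero Finset.univ _ _

lemma isNilpotent_quadForm (Q : Matrix V V ℂ) : IsNilpotent (quadForm Q) :=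
  ⟨_, quadForm_pow_eq_zero Q⟩

lemma grassExp_eq_exp (Q : Matrix V V ℂ) : grassExp Q = IsNilpotent.exp (quadForm Q) := by
  rw [IsNilpotent.exp_eq_sum (quadForm_pow_eq_zero Q), grassExp]
  refine Finset.sum_congr rfl fun k _ => ?_
  rw [← algebraMap_smul ℂ ((k.factorial : ℚ)⁻¹) (quadForm Q ^ k)]
  simp

lemma grassExp_add (Q Q' : Matrix V V ℂ) : grassExp (Q + Q') = grassExp Q * grassExp Q' := by
  rw [grassExp_eq_exp, grassExp_eq_exp, grassExp_eq_exp, quadForm_add]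
  exact IsNilpotent.exp_add_of_commute (bal_commute _ _) (isNilpotent_quadForm Q)
    (isNilpotent_quadForm Q')

lemma grassExp_zero : grassExp (0 : Matrix V V ℂ) = 1 := by
  rw [grassExp_eq_exp, ← quadFormL_apply, map_zero, IsNilpotent.exp_zero]

lemma grassExp_vecMulVec (u v : V → ℂ) :
    grassExp (Matrix.vecMulVec u v) = 1 + wedgePair u v := by
  rw [grassExp_eq_exp, quadForm_vecMulVec,
    IsNilpotent.exp_eq_sum (k := 2) (by rw [sq, wedgePair_sq])]
  simp [Finset.sum_range_succ]

lemma map_grassExp (f : Bal V →ₐ[ℂ] Bal W) {Q : Matrix V V ℂ} {Q' : Matrix W W ℂ}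
    (h : f (quadForm Q) = quadForm Q') : f (grassExp Q) = grassExp Q' := by
  rw [grassExp_eq_exp, grassExp_eq_exp, IsNilpotent.map_exp (isNilpotent_quadForm Q) f, h]

lemma balMap_quadForm [DecidableEq V] (f g : (V → ℂ) →ₗ[ℂ] (W → ℂ)) (Q : Matrix V V ℂ) :
    balMap f g (quadForm Q) =
      quadForm (∑ x, Matrix.vecMulVec (f (Pi.single x 1)) (g (Q x))) := by
  rw [quadForm_eq_sum_wedgePair, map_sum, ← quadFormL_apply, map_sum]
  refine Finset.sum_congr rfl fun x _ => ?_
  rw [balMap_wedgePair, quadFormL_apply, quadForm_vecMulVec]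

open Classical in
/-- The copy on `c(V)` of a `V × V` matrix, extended by `0`. -/
def pushMat {R : Type*} [AddCommMonoid R] (c : V → W) (Q : Matrix V V R) : Matrix W W R :=
  Matrix.of fun x y => ∑ u, ∑ v, if c u = x ∧ c v = y then Q u v else 0

omit [Fintype W] in
lemma pushVec_apply [DecidableEq W] (c : V → W) (u : V → ℂ) (y : W) :
    pushVec c u y = ∑ x, if c x = y then u x else 0 := by
  classical
  rw [pushVec, Module.Basis.constr_apply_fintype]
  simp [Finset.sum_apply, Pi.single_apply, eq_comm]

lemma relabel_grassExp (c : V → W) (Q : Matrix V V ℂ) :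
    relabel c (grassExp Q) = grassExp (pushMat c Q) := by
  classical
  refine map_grassExp _ ?_
  rw [relabel, balMap_quadForm]
  congr 1
  ext a b
  rw [Matrix.sum_apply, pushMat, Matrix.of_apply]
  refine Finset.sum_congr rfl fun x _ => ?_
  rw [Matrix.vecMulVec_apply, pushVec_apply, pushVec_apply, Finset.mul_sum]
  refine Finset.sum_congr rfl fun y _ => ?_
  simp only [Pi.single_apply]
  rw [Finset.sum_eq_single x (by intro z _ hz; simp [hz]) (by simp)]
  by_cases h1 : c x = a <;> by_cases h2 : c y = b <;> simp [h1, h2]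

lemma scaleDeg_grassExp (t : ℂ) (Q : Matrix V V ℂ) :
    scaleDeg t (grassExp Q) = grassExp (t • Q) := by
  classical
  refine map_grassExp _ ?_
  rw [scaleDeg, balMap_quadForm]
  congr 1
  ext a b
  simp [Matrix.sum_apply, Matrix.vecMulVec_apply, Pi.single_apply]

lemma restrictVars_grassExp (c : V → W) (Q : Matrix W W ℂ) :
    restrictVars c (grassExp Q) = grassExp (Q.submatrix c c) := by
  classical
  refine map_grassExp _ ?_
  rw [restrictVars, balMap_quadForm]
  congr 1
  ext a b
  simp [Matrix.sum_apply, Matrix.vecMulVec_apply, LinearMap.funLeft_apply, Pi.single_apply]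

lemma prod_ofFn_grassExp {n : ℕ} (Q : Fin n → Matrix V V ℂ) :
    (List.ofFn fun i => grassExp (Q i)).prod = grassExp (∑ i, Q i) := by
  induction n with
  | zero => simp [grassExp_zero]
  | succ n ih => rw [List.ofFn_succ, List.prod_cons, ih, Fin.sum_univ_succ, grassExp_add]

/-! ### Low order coefficients -/

/-- The coefficient of the monomial `1`. -/
def coeffOne (V : Type) : Bal V →ₐ[ℂ] ℂ :=
  (ExteriorAlgebra.algebraMapInv (R := ℂ) (M := (V → ℂ) × (V → ℂ))).comp (balanced V).val

omit [Fintype V] in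
lemma coeffOne_wedgePair (u v : V → ℂ) : coeffOne V (wedgePair u v) = 0 := by
  simp [coeffOne, wedgePair, ExteriorAlgebra.algebraMapInv]

lemma coeffOne_quadForm (Q : Matrix V V ℂ) : coeffOne V (quadForm Q) = 0 := by
  simp [quadForm, etaPair, coeffOne_wedgePair]

lemma coeffOne_grassExp (Q : Matrix V V ℂ) : coeffOne V (grassExp Q) = 1 := by
  rw [grassExp, map_sum, Finset.sum_range_succ']
  simp [coeffOne_quadForm]

/-- The linear form `(u, v) ↦ u x` on the space of variables. -/
def dualBar (x : V) : Module.Dual ℂ ((V → ℂ) × (V → ℂ)) :=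
  (LinearMap.proj x).comp (LinearMap.fst ℂ _ _)

/-- The linear form `(u, v) ↦ v x` on the space of variables. -/
def dualEta (x : V) : Module.Dual ℂ ((V → ℂ) × (V → ℂ)) :=
  (LinearMap.proj x).comp (LinearMap.snd ℂ _ _)

omit [Fintype V] in
lemma dualBar_apply (x : V) (p : (V → ℂ) × (V → ℂ)) : dualBar x p = p.1 x := rfl
omit [Fintype V] in
lemma dualEta_apply (x : V) (p : (V → ℂ) × (V → ℂ)) : dualEta x p = p.2 x := rfl

omit [Fintype V] in
lemma contr_dualBar_wedgePair_mul (x : V) (u v : V → ℂ) (Y : Grassmann V) :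
    contr (dualBar x) ((wedgePair u v : Grassmann V) * Y) =
      u x • (ι ℂ ((0, v) : (V → ℂ) × (V → ℂ)) * Y) +
        (wedgePair u v : Grassmann V) * contr (dualBar x) Y := by
  simp only [wedgePair]
  rw [mul_assoc, contr_ι_mul, contr_ι_mul]
  simp [dualBar_apply, mul_assoc]

omit [Fintype V] in
lemma contr_dualEta_wedgePair_mul (y : V) (u v : V → ℂ) (Y : Grassmann V) :
    contr (dualEta y) ((wedgePair u v : Grassmann V) * Y) =
      -(v y • (ι ℂ ((u, 0) : (V → ℂ) × (V → ℂ)) * Y)) +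
        (wedgePair u v : Grassmann V) * contr (dualEta y) Y := by
  simp only [wedgePair]
  rw [mul_assoc, contr_ι_mul, contr_ι_mul]
  simp only [dualEta_apply, Pi.zero_apply, zero_smul, zero_sub, mul_sub, mul_smul_comm, neg_sub,
    mul_assoc]
  abel

omit [Fintype V] in
lemma contr_contr_wedgePair_mul (x y : V) (u v : V → ℂ) (Y : Grassmann V) :
    contr (dualEta y) (contr (dualBar x) ((wedgePair u v : Grassmann V) * Y)) =
      (u x * v y) • Y - u x • (ι ℂ ((0, v) : (V → ℂ) × (V → ℂ)) * contr (dualEta y) Y) -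
        v y • (ι ℂ ((u, 0) : (V → ℂ) × (V → ℂ)) * contr (dualBar x) Y) +
        (wedgePair u v : Grassmann V) * contr (dualEta y) (contr (dualBar x) Y) := by
  rw [contr_dualBar_wedgePair_mul, map_add, map_smul, contr_ι_mul, contr_dualEta_wedgePair_mul]
  simp only [dualEta_apply, smul_sub, smul_smul]
  abel

/-- The matrix of the coefficients of the monomials `η̄_x η_y`. -/
def coeffPair (V : Type) : Bal V →ₗ[ℂ] Matrix V V ℂ where
  toFun X := Matrix.of fun x y =>
    ExteriorAlgebra.algebraMapInv (contr (dualEta y) (contr (dualBar x) (X : Grassmann V)))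
  map_add' X Y := by ext; simp
  map_smul' c X := by ext; simp

omit [Fintype V] in
lemma coeffPair_wedgePair_mul (u v : V → ℂ) (Y : Bal V) :
    coeffPair V (wedgePair u v * Y) = coeffOne V Y • Matrix.vecMulVec u v := by
  ext x y
  simp only [coeffPair, LinearMap.coe_mk, AddHom.coe_mk, Matrix.of_apply]
  rw [MulMemClass.coe_mul, contr_contr_wedgePair_mul]
  have h1 : ∀ a : (V → ℂ) × (V → ℂ), ExteriorAlgebra.algebraMapInv (ι ℂ a) = 0 := fun a => by
    simp [ExteriorAlgebra.algebraMapInv]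
  simp [h1, Matrix.vecMulVec_apply, coeffOne, wedgePair]
  ring

lemma coeffPair_quadForm_mul (Q : Matrix V V ℂ) (Y : Bal V) :
    coeffPair V (quadForm Q * Y) = coeffOne V Y • Q := by
  classical
  rw [quadForm_eq_sum_wedgePair, Finset.sum_mul, map_sum]
  simp_rw [coeffPair_wedgePair_mul, ← Finset.smul_sum]
  congr 1
  ext a b
  simp [Matrix.sum_apply, Matrix.vecMulVec_apply, Pi.single_apply]

lemma coeffPair_grassExp (Q : Matrix V V ℂ) : coeffPair V (grassExp Q) = Q := by
  rcases isEmpty_or_nonempty V with h | h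
  · ext x; exact h.elim x
  obtain ⟨m, hm⟩ := Nat.exists_eq_succ_of_ne_zero (Fintype.card_ne_zero (α := V))
  have h1 : coeffPair V 1 = 0 := by
    ext x y; simp [coeffPair, contr_one]
  rw [grassExp, hm, Finset.sum_range_succ', Finset.sum_range_succ']
  simp only [map_add, map_sum, map_smul, pow_succ' (quadForm Q), coeffPair_quadForm_mul, pow_zero, h1]
  simp [coeffOne_quadForm]

end GrassmannExp

/-! ### Schur complements -/

section Schur

open Matrix

/-- If the columns `p` of `M` can be cleared below the block `q` by a column operation `Φ`, with
`S` left in the block `p`, the determinant factorizes. -/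
lemma det_submatrix_sumElim_of_column_reduction {R V I J : Type*} [CommRing R]
    [Fintype I] [Fintype J] [DecidableEq I] [DecidableEq J]
    (M : Matrix V V R) (p : J → V) (q : I → V) (Φ : Matrix I J R) (S : Matrix J J R)
    (h1 : M.submatrix p p + M.submatrix p q * Φ = S)
    (h2 : M.submatrix q p + M.submatrix q q * Φ = 0) :
    (M.submatrix (Sum.elim p q) (Sum.elim p q)).det = (M.submatrix q q).det * S.det := by
  have h3 : M.submatrix (Sum.elim p q) (Sum.elim p q) =
      fromBlocks (M.submatrix p p) (M.submatrix p q) (M.submatrix q p) (M.submatrix q q) := by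
    ext (a | a) (b | b) <;> rfl
  have h4 : fromBlocks (M.submatrix p p) (M.submatrix p q) (M.submatrix q p) (M.submatrix q q) *
      fromBlocks 1 0 Φ 1 = fromBlocks S (M.submatrix p q) 0 (M.submatrix q q) := by
    rw [fromBlocks_multiply]
    simp [h1, h2]
  have h5 := congrArg det h4
  rw [det_mul, det_fromBlocks_zero₁₂, det_fromBlocks_zero₂₁] at h5
  rw [h3]
  simpa [mul_comm] using h5

variable {V B : Type} [Fintype V] [Fintype B]

/-- `M` has no isotropic vector supported in `s`. -/
def AnisoOn (s : Set V) (M : Matrix V V ℂ) : Prop :=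
  ∀ f : V → ℂ, (∀ y, y ∉ s → f y = 0) → f ≠ 0 → star f ⬝ᵥ (M *ᵥ f) ≠ 0

/-- `S` is the Schur complement of `M` on the image of `c`: every function `g` on `B` extends to a
function `f` on `V` such that `M f` is supported on the image of `c`, where it is `S g`. -/
def IsTrace (c : B → V) (M : Matrix V V ℂ) (S : Matrix B B ℂ) : Prop :=
  ∀ g : B → ℂ, ∃ f : V → ℂ, (∀ x, f (c x) = g x) ∧ M *ᵥ f = pushVec c (S *ᵥ g)

/-- The Schur complement of the entry `(x, x)`, extended by `0`. -/
def elimVar (x : V) (M : Matrix V V ℂ) : Matrix V V ℂ :=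
  Matrix.of fun a b => M a b - M a x * (M x x)⁻¹ * M x b

omit [Fintype V] in
lemma elimVar_row {x : V} {M : Matrix V V ℂ} (h : M x x ≠ 0) (b : V) : elimVar x M x b = 0 := by
  simp [elimVar, h]

omit [Fintype V] in
lemma elimVar_col {x : V} {M : Matrix V V ℂ} (h : M x x ≠ 0) (a : V) : elimVar x M a x = 0 := by
  simp [elimVar, h]

omit [Fintype V] in
lemma eq_elimVar_add (x : V) (M : Matrix V V ℂ) :
    M = elimVar x M + vecMulVec (fun a => (M x x)⁻¹ * M a x) (M x) := by
  ext a b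
  simp [elimVar, vecMulVec_apply]
  ring

/-- Solving the equation at `x`: `M f = (elimVar x M) g` if `f = g` except at `x`. -/
lemma elimVar_mulVec [DecidableEq V] {x : V} {M : Matrix V V ℂ} (h : M x x ≠ 0) (g : V → ℂ) :
    M *ᵥ (Function.update g x (g x - (M x x)⁻¹ * (M *ᵥ g) x)) = elimVar x M *ᵥ g := by
  have h1 : Function.update g x (g x - (M x x)⁻¹ * (M *ᵥ g) x) =
      g - ((M x x)⁻¹ * (M *ᵥ g) x) • Pi.single x 1 := by
    ext y
    by_cases hy : y = x
    · subst hy; simp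
    · simp [hy]
  rw [h1, mulVec_sub, mulVec_smul]
  ext a
  simp only [Pi.sub_apply, Pi.smul_apply, mulVec_single_one, col_apply, smul_eq_mul]
  simp only [mulVec, dotProduct, elimVar, of_apply, sub_mul, Finset.sum_sub_distrib]
  rw [Finset.mul_sum, Finset.sum_mul]
  congr 1
  refine Finset.sum_congr rfl fun y _ => ?_
  ring

lemma AnisoOn.diag_ne_zero {s : Set V} {M : Matrix V V ℂ} (h : AnisoOn s M) {x : V} (hx : x ∈ s) :
    M x x ≠ 0 := by
  classical
  have := h (Pi.single x 1) (fun y hy => by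
    rw [Pi.single_apply, if_neg]; rintro rfl; exact hy hx) (by simp)
  simpa using this

lemma AnisoOn.elimVar {s : Set V} {M : Matrix V V ℂ} (h : AnisoOn s M) {x : V} (hx : x ∈ s) :
    AnisoOn (s \ {x}) (elimVar x M) := by
  classical
  intro g hg hg0
  have hd := h.diag_ne_zero hx
  set f := Function.update g x (g x - (M x x)⁻¹ * (M *ᵥ g) x) with hf
  have h0 : g x = 0 := hg x (by simp)
  have h1 := elimVar_mulVec hd g
  have h2 : star f ⬝ᵥ (M *ᵥ f) = star g ⬝ᵥ (_root_.elimVar x M *ᵥ g) := by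
    rw [h1, dotProduct, dotProduct]
    refine Finset.sum_congr rfl fun y _ => ?_
    by_cases hy : y = x
    · subst hy
      have : (_root_.elimVar y M *ᵥ g) y = 0 := by
        simp [mulVec, dotProduct, elimVar_row hd]
      simp [this]
    · simp [hf, hy]
  rw [← h2]
  refine h f (fun y hy => ?_) ?_
  · have hyx : y ≠ x := by rintro rfl; exact hy hx
    simp only [hf, Function.update_of_ne hyx]
    exact hg y (fun hh => hy hh.1)
  · intro hf0
    refine hg0 (funext fun y => ?_)
    by_cases hy : y = x
    · subst hy; exact h0
    · have := congrFun hf0 y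
      simpa [hf, hy] using this

end Schur

/-! ### Interior products of exponentials -/

section Elimination

open Matrix ExteriorAlgebra

variable {V B : Type} [Fintype V] [Fintype B]

lemma inner_bal (X Z : Bal V) :
    inner ℂ X Z = ∑ T, (starRingEnd ℂ) ((monomialBasis V).repr X T) * (monomialBasis V).repr Z T := by
  change inner ℂ (balCoord V X) (balCoord V Z) = _
  rw [PiLp.inner_apply]
  refine Finset.sum_congr rfl fun T _ => ?_
  rw [RCLike.inner_apply, mul_comm]
  rfl

lemma sum_conj_repr_ι_mul_bar (x : V) (X Z : Grassmann V) [DecidableEq V] :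
    ∑ T, (starRingEnd ℂ) ((monomialBasis V).repr
        (ι ℂ ((Pi.single x 1, 0) : (V → ℂ) × (V → ℂ)) * X) T) * (monomialBasis V).repr Z T =
      ∑ T, (starRingEnd ℂ) ((monomialBasis V).repr X T) *
        (monomialBasis V).repr (contr (dualBar x) Z) T := by
  classical
  let _ : LinearOrder (V ⊕ V) := linearOrderOfSTO WellOrderingRel
  have h := sum_conj_repr_ι_mul ((Pi.basisFun ℂ V).prod (Pi.basisFun ℂ V)) (Sum.inl x) X Z
  have h1 : ((Pi.basisFun ℂ V).prod (Pi.basisFun ℂ V)).coord (Sum.inl x) = dualBar x := by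
    ext p <;> simp [dualBar]
  have h2 : ((Pi.basisFun ℂ V).prod (Pi.basisFun ℂ V)) (Sum.inl x) =
      ((Pi.single x 1, 0) : (V → ℂ) × (V → ℂ)) := by
    ext p <;> simp [Module.Basis.prod_apply]
  rw [h1, h2] at h
  exact h

lemma sum_conj_repr_ι_mul_eta (x : V) (X Z : Grassmann V) [DecidableEq V] :
    ∑ T, (starRingEnd ℂ) ((monomialBasis V).repr
        (ι ℂ ((0, Pi.single x 1) : (V → ℂ) × (V → ℂ)) * X) T) * (monomialBasis V).repr Z T =
      ∑ T, (starRingEnd ℂ) ((monomialBasis V).repr X T) *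
        (monomialBasis V).repr (contr (dualEta x) Z) T := by
  classical
  let _ : LinearOrder (V ⊕ V) := linearOrderOfSTO WellOrderingRel
  have h := sum_conj_repr_ι_mul ((Pi.basisFun ℂ V).prod (Pi.basisFun ℂ V)) (Sum.inr x) X Z
  have h1 : ((Pi.basisFun ℂ V).prod (Pi.basisFun ℂ V)).coord (Sum.inr x) = dualEta x := by
    ext p <;> simp [dualEta]
  have h2 : ((Pi.basisFun ℂ V).prod (Pi.basisFun ℂ V)) (Sum.inr x) =
      ((0, Pi.single x 1) : (V → ℂ) × (V → ℂ)) := by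
    ext p <;> simp [Module.Basis.prod_apply]
  rw [h1, h2] at h
  exact h

/-- The interior product by `η̄_x η_x` is a double contraction. -/
lemma interiorProd_etaPair_eq (x : V) (Z Z' : Bal V)
    (h : contr (dualEta x) (contr (dualBar x) (Z : Grassmann V)) = (Z' : Grassmann V)) :
    interiorProd (etaPair x x) Z = Z' := by
  classical
  refine ext_inner_left ℂ fun X => ?_
  rw [interiorProd, LinearMap.adjoint_inner_right, LinearMap.mulLeft_apply, inner_bal, inner_bal,
    ← h, ← sum_conj_repr_ι_mul_eta, ← sum_conj_repr_ι_mul_bar, ← mul_assoc]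
  refine Finset.sum_congr rfl fun T _ => ?_
  rw [MulMemClass.coe_mul]
  simp only [etaPair, wedgePair]

/-- Contractions by the variables at `x` kill the exponential of a form not involving `x`. -/
lemma contr_grassExp_eq_zero {d : Module.Dual ℂ ((V → ℂ) × (V → ℂ))} {S : Matrix V V ℂ}
    (h : ∀ Y : Grassmann V, contr d Y = 0 → contr d ((quadForm S : Grassmann V) * Y) = 0) :
    contr d (grassExp S : Grassmann V) = 0 := by
  have hp : ∀ k : ℕ, contr d ((quadForm S : Grassmann V) ^ k) = 0 := by
    intro k
    induction k with
    | zero => rw [pow_zero, contr_one]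
    | succ k ih => rw [pow_succ']; exact h _ ih
  rw [grassExp]
  simp [hp]

lemma contr_dualBar_grassExp {S : Matrix V V ℂ} {x : V} (h : ∀ y, S x y = 0) :
    contr (dualBar x) (grassExp S : Grassmann V) = 0 := by
  classical
  refine contr_grassExp_eq_zero fun Y hY => ?_
  rw [quadForm_eq_sum_wedgePair, AddSubmonoidClass.coe_finsetSum, Finset.sum_mul, map_sum]
  refine Finset.sum_eq_zero fun a _ => ?_
  rw [contr_dualBar_wedgePair_mul, hY]
  by_cases hax : a = x
  · subst hax
    have : S a = 0 := funext h
    rw [this, Prod.mk_zero_zero]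
    simp
  · simp [Ne.symm hax]

lemma contr_dualEta_grassExp {S : Matrix V V ℂ} {x : V} (h : ∀ y, S y x = 0) :
    contr (dualEta x) (grassExp S : Grassmann V) = 0 := by
  classical
  refine contr_grassExp_eq_zero fun Y hY => ?_
  rw [quadForm_eq_sum_wedgePair, AddSubmonoidClass.coe_finsetSum, Finset.sum_mul, map_sum]
  refine Finset.sum_eq_zero fun a _ => ?_
  rw [contr_dualEta_wedgePair_mul, hY, h a]
  simp

/-- Gaussian integration over one pair of variables. -/
lemma interiorProd_etaPair_grassExp {x : V} {M : Matrix V V ℂ} (h : M x x ≠ 0) :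
    interiorProd (etaPair x x) (grassExp M) = M x x • grassExp (elimVar x M) := by
  refine interiorProd_etaPair_eq x _ _ ?_
  set u : V → ℂ := fun a => (M x x)⁻¹ * M a x with hu
  have h1 : grassExp M = grassExp (elimVar x M) + wedgePair u (M x) * grassExp (elimVar x M) := by
    conv_lhs => rw [eq_elimVar_add x M, add_comm, grassExp_add, grassExp_vecMulVec]
    rw [add_mul, one_mul]
  have h2 := contr_dualBar_grassExp (x := x) (elimVar_row h)
  have h3 := contr_dualEta_grassExp (x := x) (elimVar_col h)
  rw [h1, AddMemClass.coe_add, MulMemClass.coe_mul, map_add, map_add, contr_contr_wedgePair_mul,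
    h2, h3]
  simp [hu, h]

lemma interiorProd_mul (Y Y' Z : Bal V) :
    interiorProd (Y * Y') Z = interiorProd Y' (interiorProd Y Z) := by
  rw [interiorProd, interiorProd, interiorProd, LinearMap.mulLeft_mul, LinearMap.adjoint_comp]
  rfl

lemma interiorProd_one (Z : Bal V) : interiorProd 1 Z = Z := by
  rw [interiorProd, LinearMap.mulLeft_one, LinearMap.adjoint_id, LinearMap.id_apply]

open Classical in
/-- Gaussian integration over the pairs of variables of a list `l` of points. -/
theorem interiorProd_list_grassExp (l : List V) (hl : l.Nodup) (M : Matrix V V ℂ)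
    (h : AnisoOn {y | y ∈ l} M) :
    ∃ S : Matrix V V ℂ, interiorProd (l.map fun x => etaPair x x).prod (grassExp M) =
        (M.submatrix (Subtype.val : {y // y ∈ l} → V) Subtype.val).det • grassExp S ∧
      (∀ y ∈ l, ∀ z, S y z = 0) ∧
      ∀ g : V → ℂ, ∃ f : V → ℂ, (∀ y, y ∉ l → f y = g y) ∧ M *ᵥ f = S *ᵥ g := by
  induction l generalizing M with
  | nil =>
    refine ⟨M, ?_, by simp, fun g => ⟨g, fun _ _ => rfl, rfl⟩⟩
    rw [List.map_nil, List.prod_nil, interiorProd_one]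
    have : IsEmpty {y : V // y ∈ ([] : List V)} := ⟨fun y => by simpa using y.2⟩
    rw [det_isEmpty, one_smul]
  | cons x l ih =>
    have hxl : x ∉ l := (List.nodup_cons.1 hl).1
    have hx : x ∈ {y | y ∈ x :: l} := by simp
    have hd := h.diag_ne_zero hx
    obtain ⟨S, h1, h2, h3⟩ := ih (List.nodup_cons.1 hl).2 (elimVar x M) (by
      have h4 := h.elimVar hx
      intro f hf
      refine h4 f fun y hy => hf y fun hh => hy ⟨List.mem_cons_of_mem _ hh, ?_⟩
      rintro rfl; exact hxl hh)
    have hdet : (M.submatrix (Subtype.val : {y // y ∈ x :: l} → V) Subtype.val).det =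
        M x x * ((elimVar x M).submatrix (Subtype.val : {y // y ∈ l} → V) Subtype.val).det := by
      have h4 := det_submatrix_sumElim_of_column_reduction M (Subtype.val : {y // y ∈ l} → V)
        (fun _ : Unit => x) (Matrix.of fun _ b => -((M x x)⁻¹ * M x b))
        ((elimVar x M).submatrix Subtype.val Subtype.val)
        (by ext a b; simp [elimVar, mul_apply]; ring)
        (by ext a b; simp [mul_apply, hd])
      rw [det_unique (M.submatrix (fun _ : Unit => x) _)] at h4
      simp only [submatrix_apply] at h4
      rw [← h4]
      let e : {y // y ∈ l} ⊕ Unit → {y // y ∈ x :: l} :=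
        Sum.elim (fun y => ⟨y.1, List.mem_cons_of_mem _ y.2⟩) (fun _ => ⟨x, by simp⟩)
      have he : Function.Bijective e := by
        constructor
        · rintro (⟨a, ha⟩ | a) (⟨b, hb⟩ | b) hab
          · simpa [e] using hab
          · have : a = x := by simpa [e] using hab
            exact absurd (this ▸ ha) hxl
          · have : x = b := by simpa [e] using hab
            exact absurd (this ▸ hb) hxl
          · rfl
        · rintro ⟨y, hy⟩
          rcases List.mem_cons.1 hy with rfl | hy
          · exact ⟨Sum.inr (), rfl⟩
          · exact ⟨Sum.inl ⟨y, hy⟩, rfl⟩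
      rw [← det_submatrix_equiv_self (Equiv.ofBijective e he), submatrix_submatrix]
      congr 2 <;> ext (a | a) <;> rfl
    refine ⟨S, ?_, ?_, ?_⟩
    · rw [List.map_cons, List.prod_cons, interiorProd_mul, interiorProd_etaPair_grassExp hd,
        map_smul, h1, hdet, smul_smul]
    · intro y hy z
      rcases List.mem_cons.1 hy with rfl | hy
      · obtain ⟨f, -, hf⟩ := h3 (Pi.single z 1)
        have h5 := congrFun hf y
        simp only [mulVec_single_one, col_apply] at h5
        rw [← h5]
        simp [mulVec, dotProduct, elimVar_row hd]
      · exact h2 y hy z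
    · intro g
      obtain ⟨f, hf1, hf2⟩ := h3 g
      refine ⟨_, ?_, (elimVar_mulVec hd f).trans hf2⟩
      intro y hy
      have hyx : y ≠ x := by rintro rfl; simp at hy
      rw [Function.update_of_ne hyx]
      exact hf1 y fun hh => hy (List.mem_cons_of_mem _ hh)

end Elimination

/-! ### Pushing matrices forward and taking Schur complements -/

section Push

open Matrix

variable {V W B I J : Type} [Fintype V] [Fintype W] [Fintype B] [Fintype I] [Fintype J]

omit [Fintype W] in
lemma pushVec_comp (g : V → W) (c : B → V) (u : B → ℂ) :
    pushVec (g ∘ c) u = pushVec g (pushVec c u) := by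
  classical
  ext y
  rw [pushVec_apply, pushVec_apply]
  simp_rw [pushVec_apply]
  have : ∀ x, (if g x = y then ∑ b, if c b = x then u b else 0 else 0) =
      ∑ b, if c b = x then (if g x = y then u b else 0) else 0 := by
    intro x
    split_ifs <;> simp
  simp_rw [this]
  rw [Finset.sum_comm]
  simp

omit [Fintype V] [Fintype W] in
lemma pushVec_of_injective {c : B → V} (hc : Function.Injective c) (u : B → ℂ) (b : B) :
    pushVec c u (c b) = u b := by
  classical
  rw [pushVec_apply]
  simp [hc.eq_iff]

omit [Fintype V] in
lemma pushVec_of_notMem {c : B → V} (u : B → ℂ) {y : V} (hy : ∀ b, c b ≠ y) :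
    pushVec c u y = 0 := by
  classical
  rw [pushVec_apply]
  exact Finset.sum_eq_zero fun b _ => if_neg (hy b)

lemma pushMat_mulVec (c : B → V) (Q : Matrix B B ℂ) (f : V → ℂ) :
    pushMat c Q *ᵥ f = pushVec c (Q *ᵥ (f ∘ c)) := by
  classical
  ext y
  rw [pushVec_apply]
  simp only [mulVec, dotProduct, pushMat, of_apply, Finset.sum_mul, Function.comp_apply]
  rw [Finset.sum_comm]
  refine Finset.sum_congr rfl fun b _ => ?_
  rw [Finset.sum_comm]
  by_cases hb : c b = y
  · simp [hb, ite_mul]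
  · simp [hb]

lemma dotProduct_pushVec (c : B → V) (f : V → ℂ) (u : B → ℂ) :
    f ⬝ᵥ pushVec c u = (f ∘ c) ⬝ᵥ u := by
  classical
  simp only [dotProduct, pushVec_apply, Finset.mul_sum]
  rw [Finset.sum_comm]
  simp

omit [Fintype V] in
lemma pushMat_of_injOn {c : B → V} (Q : Matrix B B ℂ) {a b : B} (ha : ∀ x, c x = c a → x = a)
    (hb : ∀ x, c x = c b → x = b) : pushMat c Q (c a) (c b) = Q a b := by
  classical
  simp only [pushMat, of_apply]
  rw [Finset.sum_eq_single a, Finset.sum_eq_single b]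
  · simp
  · intro x _ hx
    rw [if_neg]
    exact fun h => hx (hb x h.2)
  · simp
  · intro x _ hx
    refine Finset.sum_eq_zero fun y _ => ?_
    rw [if_neg]
    exact fun h => hx (ha x h.1)
  · simp

omit [Fintype V] in
lemma pushMat_of_notMem_left {c : B → V} (Q : Matrix B B ℂ) {x : V} (y : V) (h : ∀ b, c b ≠ x) :
    pushMat c Q x y = 0 := by
  classical
  simp [pushMat, h]

omit [Fintype V] in
lemma pushMat_of_notMem_right {c : B → V} (Q : Matrix B B ℂ) (x : V) {y : V} (h : ∀ b, c b ≠ y) :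
    pushMat c Q x y = 0 := by
  classical
  simp [pushMat, h]

lemma IsTrace.trans {c : B → V} {b : J → B} {M : Matrix V V ℂ} {S : Matrix B B ℂ}
    {T : Matrix J J ℂ} (h1 : IsTrace c M S) (h2 : IsTrace b S T) : IsTrace (c ∘ b) M T := by
  intro g
  obtain ⟨f, hf1, hf2⟩ := h2 g
  obtain ⟨k, hk1, hk2⟩ := h1 f
  exact ⟨k, fun x => (hk1 _).trans (hf1 x), by rw [hk2, hf2, pushVec_comp]⟩

/-- Determinants factorize through Schur complements. -/
lemma IsTrace.det_submatrix [DecidableEq I] [DecidableEq J] (e : B ⊕ I ≃ V)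
    {M : Matrix V V ℂ} {S : Matrix B B ℂ} (h : IsTrace (e ∘ Sum.inl) M S) (p : J → B) :
    (M.submatrix (Sum.elim (e ∘ Sum.inl ∘ p) (e ∘ Sum.inr))
      (Sum.elim (e ∘ Sum.inl ∘ p) (e ∘ Sum.inr))).det =
      (M.submatrix (e ∘ Sum.inr) (e ∘ Sum.inr)).det * (S.submatrix p p).det := by
  classical
  choose f hf1 hf2 using fun j : J => h (Pi.single (p j) 1)
  have key : ∀ (v : V) (j : J), M v (e (Sum.inl (p j))) +
      ∑ i, M v (e (Sum.inr i)) * f j (e (Sum.inr i)) =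
      pushVec (e ∘ Sum.inl) (S.col (p j)) v := by
    intro v j
    have h1 := congrFun (hf2 j) v
    rw [mulVec_single_one] at h1
    rw [← h1, mulVec, dotProduct, ← e.sum_comp, Fintype.sum_sum_type]
    congr 1
    have h2 : ∀ b, f j (e (Sum.inl b)) = (Pi.single (p j) 1 : B → ℂ) b := hf1 j
    simp [h2, Pi.single_apply]
  refine det_submatrix_sumElim_of_column_reduction M _ _
    (Matrix.of fun i j => f j (e (Sum.inr i))) _ ?_ ?_
  · ext a j
    simp only [Matrix.add_apply, submatrix_apply, mul_apply, of_apply, Function.comp_apply]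
    rw [key, show e (Sum.inl (p a)) = (e ∘ Sum.inl) (p a) from rfl,
      pushVec_of_injective (e.injective.comp Sum.inl_injective)]
    rfl
  · ext i j
    simp only [Matrix.add_apply, submatrix_apply, mul_apply, of_apply, Function.comp_apply]
    rw [key, pushVec_of_notMem]
    · rfl
    · intro b hb
      have := e.injective hb
      simp at this

/-- A quantitative non-degeneracy condition, stable under gluing and Schur complements:
`δ ‖f‖² ≤ Re (θ ⟨f, M f⟩)`. -/
def Coer (θ : ℂ) (δ : ℝ) (M : Matrix V V ℂ) : Prop :=
  ∀ f : V → ℂ, δ * ∑ x, ‖f x‖ ^ 2 ≤ (θ * (star f ⬝ᵥ (M *ᵥ f))).re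

lemma sum_norm_sq_pos {f : V → ℂ} (hf : f ≠ 0) : 0 < ∑ x, ‖f x‖ ^ 2 := by
  obtain ⟨x, hx⟩ := Function.ne_iff.1 hf
  exact Finset.sum_pos' (fun _ _ => by positivity) ⟨x, Finset.mem_univ x, by
    have := norm_pos_iff.2 hx; positivity⟩

lemma Coer.anisoOn {θ : ℂ} {δ : ℝ} (hδ : 0 < δ) {M : Matrix V V ℂ} (h : Coer θ δ M) (s : Set V) :
    AnisoOn s M := by
  intro f _ hf h0
  have h1 := h f
  rw [h0, mul_zero, Complex.zero_re] at h1
  have := sum_norm_sq_pos hf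
  nlinarith

lemma IsTrace.coer {θ : ℂ} {δ : ℝ} (hδ : 0 ≤ δ) {c : B → V} (hc : Function.Injective c)
    {M : Matrix V V ℂ} {S : Matrix B B ℂ} (h : IsTrace c M S) (hM : Coer θ δ M) : Coer θ δ S := by
  intro g
  obtain ⟨f, hf1, hf2⟩ := h g
  have h1 := hM f
  have h2 : star f ⬝ᵥ (M *ᵥ f) = star g ⬝ᵥ (S *ᵥ g) := by
    rw [hf2, dotProduct_pushVec]
    congr 1
    ext x
    simp [hf1]
  rw [h2] at h1
  refine le_trans (mul_le_mul_of_nonneg_left ?_ hδ) h1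
  have h3 : ∑ x, ‖g x‖ ^ 2 = ∑ x, ‖f (c x)‖ ^ 2 := by simp_rw [hf1]
  rw [h3]
  classical
  rw [← Finset.sum_image (f := fun v => ‖f v‖ ^ 2) (fun x _ y _ hxy => hc hxy)]
  exact Finset.sum_le_sum_of_subset_of_nonneg (Finset.subset_univ _) fun _ _ _ => by positivity

lemma Coer.submatrix {θ : ℂ} {δ : ℝ} {M : Matrix V V ℂ} (h : Coer θ δ M)
    {c : B → V} (hc : Function.Injective c) : Coer θ δ (M.submatrix c c) := by
  classical
  intro g
  have h1 := h (pushVec c g)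
  have h2 : ∀ u : B → ℂ, ∑ v, ‖pushVec c u v‖ ^ 2 = ∑ x, ‖u x‖ ^ 2 := by
    intro u
    have : ∀ v ∉ Finset.univ.image c, ‖pushVec c u v‖ ^ 2 = 0 := by
      intro v hv
      rw [pushVec_of_notMem]
      · simp
      · intro b hb
        exact hv (Finset.mem_image.2 ⟨b, Finset.mem_univ _, hb⟩)
    rw [← Finset.sum_subset (Finset.subset_univ (Finset.univ.image c)) fun v _ hv => this v hv,
      Finset.sum_image (fun x _ y _ hxy => hc hxy)]
    simp_rw [pushVec_of_injective hc]
  have h3 : star (pushVec c g) ⬝ᵥ (M *ᵥ pushVec c g) =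
      star g ⬝ᵥ (M.submatrix c c *ᵥ g) := by
    have h4 : star (pushVec c g) = pushVec c (star g) := by
      ext v
      simp only [Pi.star_apply, pushVec_apply, star_sum, apply_ite star, star_zero]
    rw [h4, dotProduct_comm, dotProduct_pushVec, dotProduct_comm]
    congr 1
    ext b
    simp only [mulVec, Function.comp_apply]
    rw [dotProduct_pushVec]
    rfl
  rwa [h2, h3] at h1

end Push

/-! ### The self-similar structure of the lattices -/

namespace LatticeData

variable {N N₀ : ℕ} {Γ : Type*} [Group Γ] (D : LatticeData N N₀ Γ)

/-- The inclusion of `F_n` in `F_{n+1}` as the `i`-th of its `N` cells. -/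
def subcell {n : ℕ} (i : Fin N) : D.Vert n → D.Vert (n + 1) :=
  Quotient.map' (fun p => (Fin.snoc (α := fun _ => Fin N) p.1 i, p.2)) (by
    rintro ⟨p, x⟩ ⟨q, y⟩ (h | ⟨k₀, h1, h2, h3⟩)
    · rw [h]
    · refine Or.inr ⟨k₀.castSucc, ?_, ?_, ?_⟩
      · intro k hk
        induction k using Fin.lastCases with
        | last => simp
        | cast k => simpa using h1 k (by simpa using hk)
      · intro k hk
        induction k using Fin.lastCases with
        | last => exact absurd hk (not_lt.2 (Fin.le_last _))
        | cast k => simpa using h2 k (by simpa using hk)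
      · simpa using h3)

/-- The embedding of `F_1` in `F_{n+1}` whose image is the union of the boundaries of the `N`
cells isomorphic to `F_n`. -/
def coarse (n : ℕ) : D.Vert 1 → D.Vert (n + 1) :=
  Quotient.map' (fun p => (Fin.snoc (α := fun _ => Fin N) (fun _ => D.inc p.2) (p.1 0), p.2)) (by
    rintro ⟨p, x⟩ ⟨q, y⟩ (h | ⟨k₀, h1, h2, h3⟩)
    · rw [h]
    · refine Or.inr ⟨Fin.last n, ?_, ?_, ?_⟩
      · intro k hk
        exact absurd hk (not_lt.2 (Fin.le_last _))
      · intro k hk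
        induction k using Fin.lastCases with
        | last => exact absurd hk (lt_irrefl _)
        | cast k => simp
      · have : k₀ = 0 := Subsingleton.elim _ _
        subst this
        simpa using h3)

lemma cell_snoc {n : ℕ} (p : Fin n → Fin N) (i : Fin N) (x : Fin N₀) :
    D.cell (Fin.snoc (α := fun _ => Fin N) p i) x = D.subcell i (D.cell p x) := rfl

lemma coarse_cell (n : ℕ) (i : Fin N) (x : Fin N₀) :
    D.coarse n (D.cell (fun _ => i) x) = D.subcell i (D.bdryPt n x) := rfl

lemma exists_cell {n : ℕ} (v : D.Vert n) : ∃ p x, D.cell p x = v := by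
  induction v using Quotient.inductionOn with
  | h p => exact ⟨p.1, p.2, rfl⟩

lemma exists_cell_one (v : D.Vert 1) : ∃ i x, D.cell (n := 1) (fun _ => i) x = v := by
  obtain ⟨p, x, rfl⟩ := D.exists_cell v
  refine ⟨p 0, x, ?_⟩
  congr 1
  ext k
  rw [Subsingleton.elim k 0]

lemma exists_subcell {n : ℕ} (v : D.Vert (n + 1)) : ∃ i w, D.subcell i w = v := by
  obtain ⟨p, x, rfl⟩ := D.exists_cell v
  exact ⟨p (Fin.last n), D.cell (Fin.init p) x, by rw [← cell_snoc, Fin.snoc_init_self]⟩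

lemma bdryPt_succ (n : ℕ) (x : Fin N₀) :
    D.bdryPt (n + 1) x = D.subcell (D.inc x) (D.bdryPt n x) := by
  rw [bdryPt, bdryPt, ← cell_snoc]
  congr 1
  ext k
  induction k using Fin.lastCases <;> simp

lemma coarse_bdryPt (n : ℕ) (x : Fin N₀) : D.coarse n (D.bdryPt 1 x) = D.bdryPt (n + 1) x := by
  exact (D.bdryPt_succ n x).symm

lemma bdryPt_injective (n : ℕ) : Function.Injective (D.bdryPt n) := by
  intro x y h
  rcases Quotient.exact h with h | ⟨k₀, -, -, h⟩
  · exact (Prod.mk.inj h).2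
  · exact ((Prod.mk.inj (D.glue_corner x _ h)).2).symm

/-- Two cells of `F_{n+1}` isomorphic to `F_n` only meet at boundary points. -/
lemma subcell_eq_subcell {n : ℕ} {i j : Fin N} {v w : D.Vert n}
    (h : D.subcell i v = D.subcell j w) :
    (i = j ∧ v = w) ∨ ∃ x y, v = D.bdryPt n x ∧ w = D.bdryPt n y ∧
      D.cell (n := 1) (fun _ => i) x = D.cell (fun _ => j) y := by
  obtain ⟨p, x, rfl⟩ := D.exists_cell v
  obtain ⟨q, y, rfl⟩ := D.exists_cell w
  rw [← cell_snoc, ← cell_snoc] at h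
  rcases Quotient.exact h with h | ⟨k₀, h1, h2, h3⟩
  · have h4 := (Prod.mk.inj h).1
    have h5 := (Prod.mk.inj h).2
    rw [Fin.snoc_inj] at h4
    exact Or.inl ⟨h4.2, by rw [h4.1, h5]⟩
  · induction k₀ using Fin.lastCases with
    | last =>
      refine Or.inr ⟨x, y, ?_, ?_, ?_⟩
      · rw [bdryPt]; congr 1; ext k
        simpa using congrArg Fin.val (h2 k.castSucc (Fin.castSucc_lt_last k)).1
      · rw [bdryPt]; congr 1; ext k
        simpa using congrArg Fin.val (h2 k.castSucc (Fin.castSucc_lt_last k)).2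
      · refine Quotient.sound (Or.inr ⟨0, ?_, ?_, ?_⟩)
        · intro k hk; exact absurd hk (by rw [Subsingleton.elim k 0]; exact lt_irrefl _)
        · intro k hk; exact absurd hk (by rw [Subsingleton.elim k 0]; exact lt_irrefl _)
        · simpa using h3
    | cast k₀ =>
      refine Or.inl ⟨by simpa using h1 (Fin.last n) (Fin.castSucc_lt_last k₀), ?_⟩
      refine Quotient.sound (Or.inr ⟨k₀, ?_, ?_, ?_⟩)
      · intro k hk
        simpa using h1 k.castSucc (by simpa using hk)
      · intro k hk
        simpa using h2 k.castSucc (by simpa using hk)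
      · simpa using h3

lemma coarse_injective (n : ℕ) : Function.Injective (D.coarse n) := by
  intro v w h
  obtain ⟨i, x, rfl⟩ := D.exists_cell_one v
  obtain ⟨j, y, rfl⟩ := D.exists_cell_one w
  rw [coarse_cell, coarse_cell] at h
  rcases D.subcell_eq_subcell h with ⟨rfl, h'⟩ | ⟨x', y', h1, h2, h3⟩
  · rw [D.bdryPt_injective n h']
  · rw [D.bdryPt_injective n h1, D.bdryPt_injective n h2, h3]

/-- The interior of `F_n`. -/
abbrev Inner (n : ℕ) : Type := {v : D.Vert n // v ∉ D.bdry n}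

lemma subcell_eq_subcell_inner {n : ℕ} {i j : Fin N} {v : D.Vert n} {w : D.Inner n}
    (h : D.subcell i v = D.subcell j w.1) : i = j ∧ v = w.1 := by
  rcases D.subcell_eq_subcell h with h | ⟨x, y, -, h, -⟩
  · exact h
  · exact absurd ⟨y, h.symm⟩ w.2

/-- `F_{n+1}` is the union of `F_1` and of the interiors of its `N` cells. -/
def vertSuccEquiv (n : ℕ) : D.Vert 1 ⊕ (D.Inner n × Fin N) ≃ D.Vert (n + 1) :=
  Equiv.ofBijective (Sum.elim (D.coarse n) fun w => D.subcell w.2 w.1.1) (by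
    constructor
    · rintro (v | ⟨v, i⟩) (w | ⟨w, j⟩) h
      · exact congrArg Sum.inl (D.coarse_injective n h)
      · obtain ⟨i, x, rfl⟩ := D.exists_cell_one v
        have := (D.subcell_eq_subcell_inner (v := D.bdryPt n x) (i := i) (w := w) h).2
        exact absurd ⟨x, this⟩ w.2
      · obtain ⟨j, x, rfl⟩ := D.exists_cell_one w
        have := (D.subcell_eq_subcell_inner (v := D.bdryPt n x) (i := j) (w := v) h.symm).2
        exact absurd ⟨x, this⟩ v.2
      · obtain ⟨h1, h2⟩ := D.subcell_eq_subcell_inner (w := w) h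
        simp only at h1 h2
        rw [h1, Subtype.ext h2]
    · intro v
      obtain ⟨i, w, rfl⟩ := D.exists_subcell v
      by_cases hw : w ∈ D.bdry n
      · obtain ⟨x, rfl⟩ := hw
        exact ⟨Sum.inl (D.cell (fun _ => i) x), rfl⟩
      · exact ⟨Sum.inr (⟨w, hw⟩, i), rfl⟩)

lemma coarse_mem_bdry {n : ℕ} {v : D.Vert 1} :
    D.coarse n v ∈ D.bdry (n + 1) ↔ v ∈ D.bdry 1 := by
  constructor
  · rintro ⟨x, hx⟩
    rw [← coarse_bdryPt] at hx
    exact ⟨x, D.coarse_injective n hx⟩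
  · rintro ⟨x, rfl⟩
    exact ⟨x, (D.coarse_bdryPt n x).symm⟩

lemma subcell_notMem_bdry {n : ℕ} (w : D.Inner n) (i : Fin N) :
    D.subcell i w.1 ∉ D.bdry (n + 1) := by
  rintro ⟨x, hx⟩
  rw [bdryPt_succ] at hx
  exact w.2 ⟨x, (D.subcell_eq_subcell_inner hx).2⟩

/-- The interior of `F_{n+1}` is the union of the interiors of `F_1` and of the `N` cells. -/
def innerSuccEquiv (n : ℕ) : D.Inner 1 ⊕ (D.Inner n × Fin N) ≃ D.Inner (n + 1) :=
  Equiv.ofBijective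
    (Sum.elim (fun v => ⟨D.coarse n v.1, fun h => v.2 (D.coarse_mem_bdry.1 h)⟩)
      fun w => ⟨D.subcell w.2 w.1.1, D.subcell_notMem_bdry w.1 w.2⟩) (by
    constructor
    · intro a b h
      have h1 : Sum.map Subtype.val id a = (Sum.map Subtype.val id b :
          D.Vert 1 ⊕ (D.Inner n × Fin N)) := by
        apply (D.vertSuccEquiv n).injective
        have h2 := congrArg Subtype.val h
        rcases a with a | a <;> rcases b with b | b <;> exact h2
      exact Sum.map_injective.2 ⟨Subtype.val_injective, Function.injective_id⟩ h1
    · rintro ⟨v, hv⟩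
      obtain ⟨a, rfl⟩ := (D.vertSuccEquiv n).surjective v
      rcases a with a | a
      · exact ⟨Sum.inl ⟨a, fun h => hv (D.coarse_mem_bdry.2 h)⟩, rfl⟩
      · exact ⟨Sum.inr a, rfl⟩)

open Classical in
/-- `F_n` is the union of its boundary and of its interior. -/
def vertEquiv (n : ℕ) : Fin N₀ ⊕ D.Inner n ≃ D.Vert n :=
  Equiv.ofBijective (Sum.elim (D.bdryPt n) Subtype.val) (by
    constructor
    · rintro (x | v) (y | w) h
      · exact congrArg Sum.inl (D.bdryPt_injective n h)
      · exact absurd ⟨x, h⟩ w.2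
      · exact absurd ⟨y, h.symm⟩ v.2
      · exact congrArg Sum.inr (Subtype.ext h)
    · intro v
      by_cases hv : v ∈ D.bdry n
      · obtain ⟨x, rfl⟩ := hv
        exact ⟨Sum.inl x, rfl⟩
      · exact ⟨Sum.inr ⟨v, hv⟩, rfl⟩)

/-- Functions on the `N` cells which match on `F_1` define a function on `F_{n+1}`. -/
lemma exists_glue {n : ℕ} {R : Type*} (h : D.Vert 1 → R) (φ : Fin N → D.Vert n → R)
    (hφ : ∀ i x, φ i (D.bdryPt n x) = h (D.cell (fun _ => i) x)) :
    ∃ f : D.Vert (n + 1) → R, ∀ i w, f (D.subcell i w) = φ i w := by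
  choose i w hiw using fun v : D.Vert (n + 1) => D.exists_subcell v
  refine ⟨fun v => φ (i v) (w v), fun j u => ?_⟩
  rcases D.subcell_eq_subcell (hiw (D.subcell j u)) with ⟨h1, h2⟩ | ⟨x, y, h1, h2, h3⟩
  · simp only [h1, h2]
  · simp only [h1]
    rw [hφ, h3, h2, hφ]

lemma card_vert_le (n : ℕ) : Fintype.card (D.Vert n) ≤ N ^ n * N₀ := by
  have h : Function.Surjective fun p : (Fin n → Fin N) × Fin N₀ => D.cell p.1 p.2 := fun v => by
    obtain ⟨p, x, h⟩ := D.exists_cell v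
    exact ⟨(p, x), h⟩
  simpa using Fintype.card_le_of_surjective _ h

/-! ### The glued matrices and the renormalization map -/

/-- The weights `α_1 / α_i`. -/
def wt (i : Fin N) : ℝ := D.alpha D.firstCell * (D.alpha i)⁻¹

lemma wt_pos (i : Fin N) : 0 < D.wt i :=
  mul_pos (D.alpha_pos _) (inv_pos.2 (D.alpha_pos i))

open Matrix in
/-- The sum of the weighted copies of a matrix `Q` on the `0`-cells of `F_n`. -/
def glueMat (n : ℕ) (Q : Matrix (Fin N₀) (Fin N₀) ℂ) : Matrix (D.Vert n) (D.Vert n) ℂ :=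
  ∑ i : Fin n → Fin N, (∏ k, (D.wt (i k) : ℂ)) • pushMat (D.cell i) Q

open Matrix

lemma glueMat_mulVec (n : ℕ) (Q : Matrix (Fin N₀) (Fin N₀) ℂ) (f : D.Vert n → ℂ) :
    D.glueMat n Q *ᵥ f = ∑ i : Fin n → Fin N, (∏ k, (D.wt (i k) : ℂ)) •
      pushVec (D.cell i) (Q *ᵥ (f ∘ D.cell i)) := by
  rw [glueMat, sum_mulVec]
  simp_rw [smul_mulVec, pushMat_mulVec]

lemma glueMat_one_mulVec (Q : Matrix (Fin N₀) (Fin N₀) ℂ) (f : D.Vert 1 → ℂ) :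
    D.glueMat 1 Q *ᵥ f = ∑ i : Fin N, (D.wt i : ℂ) •
      pushVec (D.cell (n := 1) fun _ => i) (Q *ᵥ (f ∘ D.cell fun _ => i)) := by
  rw [glueMat_mulVec, ← (Equiv.funUnique (Fin 1) (Fin N)).symm.sum_comp]
  refine Finset.sum_congr rfl fun i _ => ?_
  simp
  rfl

lemma glueMat_one (Q : Matrix (Fin N₀) (Fin N₀) ℂ) :
    D.glueMat 1 Q = ∑ i : Fin N, pushMat (D.cell (n := 1) fun _ => i) ((D.wt i : ℂ) • Q) := by
  classical
  refine Matrix.toLin'.injective (LinearMap.ext fun f => ?_)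
  rw [toLin'_apply, toLin'_apply, glueMat_one_mulVec, sum_mulVec]
  simp_rw [pushMat_mulVec, smul_mulVec, map_smul]

lemma glueMat_succ_mulVec (n : ℕ) (Q : Matrix (Fin N₀) (Fin N₀) ℂ) (f : D.Vert (n + 1) → ℂ) :
    D.glueMat (n + 1) Q *ᵥ f = ∑ i : Fin N, (D.wt i : ℂ) •
      pushVec (D.subcell i) (D.glueMat n Q *ᵥ (f ∘ D.subcell i)) := by
  rw [glueMat_mulVec, ← (Fin.snocEquiv fun _ : Fin (n + 1) => Fin N).sum_comp,
    Fintype.sum_prod_type]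
  refine Finset.sum_congr rfl fun i _ => ?_
  rw [glueMat_mulVec, map_sum, Finset.smul_sum]
  refine Finset.sum_congr rfl fun p _ => ?_
  rw [map_smul, smul_smul, ← pushVec_comp, Fin.prod_univ_castSucc, mul_comm]
  simp only [Fin.snocEquiv, Equiv.coe_fn_mk, Fin.snoc_castSucc, Fin.snoc_last]
  rfl

lemma glueMat_succ (n : ℕ) (Q : Matrix (Fin N₀) (Fin N₀) ℂ) :
    D.glueMat (n + 1) Q = ∑ i : Fin N, (D.wt i : ℂ) • pushMat (D.subcell i) (D.glueMat n Q) := by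
  classical
  refine Matrix.toLin'.injective (LinearMap.ext fun f => ?_)
  rw [toLin'_apply, toLin'_apply, glueMat_succ_mulVec, sum_mulVec]
  simp_rw [smul_mulVec, pushMat_mulVec]

/-- The Schur complement of the glued matrix on `F_1 ⊆ F_{n+1}` is glued from `N` copies of the
Schur complement on `F = ∂F_n`. -/
lemma isTrace_coarse {n : ℕ} {Q S : Matrix (Fin N₀) (Fin N₀) ℂ}
    (h : IsTrace (D.bdryPt n) (D.glueMat n Q) S) :
    IsTrace (D.coarse n) (D.glueMat (n + 1) Q) (D.glueMat 1 S) := by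
  intro g
  choose φ hφ1 hφ2 using fun i : Fin N => h (g ∘ D.cell fun _ => i)
  obtain ⟨f, hf⟩ := D.exists_glue g φ hφ1
  refine ⟨f, fun v => ?_, ?_⟩
  · obtain ⟨i, x, rfl⟩ := D.exists_cell_one v
    rw [coarse_cell, hf, hφ1]
    rfl
  · rw [glueMat_succ_mulVec, glueMat_one_mulVec, map_sum]
    refine Finset.sum_congr rfl fun i _ => ?_
    rw [map_smul, show f ∘ D.subcell i = φ i from funext (hf i), hφ2, ← pushVec_comp,
      ← pushVec_comp]
    rfl

/-- On the interiors of the `N` cells the glued matrix is block diagonal. -/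
lemma glueMat_succ_inner (n : ℕ) (Q : Matrix (Fin N₀) (Fin N₀) ℂ) (v w : D.Inner n)
    (i j : Fin N) :
    D.glueMat (n + 1) Q (D.subcell i v.1) (D.subcell j w.1) =
      if i = j then D.wt i * D.glueMat n Q v.1 w.1 else 0 := by
  rw [glueMat_succ, Matrix.sum_apply]
  have h0 : ∀ (k i : Fin N) (v : D.Inner n) (u : D.Vert n), k ≠ i →
      D.subcell k u ≠ D.subcell i v.1 := fun k i v u hk h =>
    hk (D.subcell_eq_subcell_inner h).1
  rw [Finset.sum_eq_single i]
  · simp only [Matrix.smul_apply, smul_eq_mul]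
    split_ifs with hij
    · subst hij
      rw [pushMat_of_injOn]
      · exact fun x hx => (D.subcell_eq_subcell_inner hx).2
      · exact fun x hx => (D.subcell_eq_subcell_inner hx).2
    · rw [pushMat_of_notMem_right, mul_zero]
      exact fun b => h0 _ _ _ _ hij
  · intro k _ hk
    rw [Matrix.smul_apply, pushMat_of_notMem_left, smul_zero]
    exact fun b => h0 _ _ _ _ hk
  · simp

open Classical in
/-- The interiors of the cells can be eliminated first, which leaves the Schur complements glued
along `F_1`. -/
lemma det_glueMat_succ_inner {n : ℕ} {Q S : Matrix (Fin N₀) (Fin N₀) ℂ}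
    (h : IsTrace (D.bdryPt n) (D.glueMat n Q) S) :
    ((D.glueMat (n + 1) Q).submatrix (Subtype.val : D.Inner (n + 1) → _) Subtype.val).det =
      ((∏ i, (D.wt i : ℂ)) ^ Fintype.card (D.Inner n) *
        ((D.glueMat n Q).submatrix (Subtype.val : D.Inner n → _) Subtype.val).det ^ N) *
      ((D.glueMat 1 S).submatrix (Subtype.val : D.Inner 1 → _) Subtype.val).det := by
  have h1 := IsTrace.det_submatrix (D.vertSuccEquiv n) (D.isTrace_coarse h)
    (Subtype.val : D.Inner 1 → D.Vert 1)
  have h2 : (D.glueMat (n + 1) Q).submatrix (D.vertSuccEquiv n ∘ Sum.inr)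
      (D.vertSuccEquiv n ∘ Sum.inr) = blockDiagonal fun i : Fin N => (D.wt i : ℂ) •
        (D.glueMat n Q).submatrix (Subtype.val : D.Inner n → _) Subtype.val := by
    ext ⟨v, i⟩ ⟨w, j⟩
    rw [submatrix_apply, blockDiagonal_apply]
    exact D.glueMat_succ_inner n Q v w i j
  rw [h2, det_blockDiagonal] at h1
  simp only [det_smul, Finset.prod_mul_distrib, Finset.prod_const, Finset.card_univ,
    Fintype.card_fin, Finset.prod_pow] at h1
  rw [← h1, ← det_submatrix_equiv_self (D.innerSuccEquiv n), submatrix_submatrix]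
  congr 2 <;> ext (a | a) <;> rfl

open Classical in
lemma det_glueMat {n : ℕ} {Q S : Matrix (Fin N₀) (Fin N₀) ℂ}
    (h : IsTrace (D.bdryPt n) (D.glueMat n Q) S) :
    (D.glueMat n Q).det =
      ((D.glueMat n Q).submatrix (Subtype.val : D.Inner n → _) Subtype.val).det * S.det := by
  have h1 := IsTrace.det_submatrix (D.vertEquiv n) h id
  rw [← det_submatrix_equiv_self (D.vertEquiv n)]
  refine Eq.trans ?_ h1
  congr 2

lemma Coer_glueMat {θ : ℂ} {δ m : ℝ} (hδ : 0 ≤ δ) (hm : 0 ≤ m) (hmw : ∀ i, m ≤ D.wt i)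
    {Q : Matrix (Fin N₀) (Fin N₀) ℂ} (h : Coer θ δ Q) (n : ℕ) :
    Coer θ (δ * m ^ n) (D.glueMat n Q) := by
  intro f
  have h1 : (θ * (star f ⬝ᵥ (D.glueMat n Q *ᵥ f))).re =
      ∑ i : Fin n → Fin N, (∏ k, D.wt (i k)) *
        (θ * (star (f ∘ D.cell i) ⬝ᵥ (Q *ᵥ (f ∘ D.cell i)))).re := by
    rw [glueMat_mulVec, dotProduct_sum, Finset.mul_sum, Complex.re_sum]
    refine Finset.sum_congr rfl fun i _ => ?_
    rw [dotProduct_smul, dotProduct_pushVec, smul_eq_mul, mul_left_comm, ← Complex.ofReal_prod,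
      Complex.re_ofReal_mul]
    rfl
  rw [h1]
  choose p x hpx using fun v : D.Vert n => D.exists_cell v
  have h2 : ∑ v, ‖f v‖ ^ 2 ≤ ∑ i : Fin n → Fin N, ∑ u, ‖f (D.cell i u)‖ ^ 2 := by
    rw [← Fintype.sum_prod_type' (f := fun (i : Fin n → Fin N) u => ‖f (D.cell i u)‖ ^ 2)]
    have hinj : Function.Injective fun v => (p v, x v) := by
      intro v w hvw
      simp only [Prod.mk.injEq] at hvw
      rw [← hpx v, ← hpx w, hvw.1, hvw.2]
    classical
    calc ∑ v, ‖f v‖ ^ 2 = ∑ v, ‖f (D.cell (p v) (x v))‖ ^ 2 := by simp_rw [hpx]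
      _ = ∑ q ∈ Finset.univ.image fun v => (p v, x v), ‖f (D.cell q.1 q.2)‖ ^ 2 := by
        rw [Finset.sum_image fun a _ b _ hab => hinj hab]
      _ ≤ _ := Finset.sum_le_sum_of_subset_of_nonneg (Finset.subset_univ _)
        fun _ _ _ => by positivity
  calc δ * m ^ n * ∑ v, ‖f v‖ ^ 2
      ≤ δ * m ^ n * ∑ i : Fin n → Fin N, ∑ u, ‖f (D.cell i u)‖ ^ 2 := by gcongr
    _ = ∑ i : Fin n → Fin N, m ^ n * (δ * ∑ u, ‖f (D.cell i u)‖ ^ 2) := by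
        rw [Finset.mul_sum]; exact Finset.sum_congr rfl fun _ _ => by ring
    _ ≤ _ := by
        refine Finset.sum_le_sum fun i _ => ?_
        have h3 : m ^ n ≤ ∏ k, D.wt (i k) := by
          have := Finset.prod_le_prod (s := (Finset.univ : Finset (Fin n))) (f := fun _ => m)
            (g := fun k => D.wt (i k)) (fun _ _ => hm) fun k _ => hmw _
          simpa using this
        exact mul_le_mul h3 (h _) (by positivity) (le_trans (by positivity) h3)

lemma glueMap_grassExp (Q : Matrix (Fin N₀) (Fin N₀) ℂ) :
    D.glueMap (grassExp Q) = grassExp (D.glueMat 1 Q) := by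
  rw [glueMap, glueMat_one, ← prod_ofFn_grassExp]
  simp_rw [scaleDeg_grassExp, relabel_grassExp]
  rfl

lemma glueMap_smul (c : ℂ) (X : Bal (Fin N₀)) : D.glueMap (c • X) = c ^ N • D.glueMap X := by
  have h : ∀ (n : ℕ) (Y : Fin n → Bal (D.Vert 1)),
      (List.ofFn fun i => c • Y i).prod = c ^ n • (List.ofFn Y).prod := by
    intro n
    induction n with
    | zero => simp
    | succ n ih =>
      intro Y
      rw [List.ofFn_succ, List.ofFn_succ, List.prod_cons, List.prod_cons, ih, smul_mul_smul_comm,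
        pow_succ']
  rw [glueMap, glueMap]
  simp_rw [map_smul]
  exact h N _

lemma renorm_smul (c : ℂ) (X : Bal (Fin N₀)) : D.renorm (c • X) = c ^ N • D.renorm X := by
  rw [renorm, glueMap_smul, map_smul, map_smul]
  rfl

lemma iterate_renorm_smul (n : ℕ) (c : ℂ) (X : Bal (Fin N₀)) :
    D.renorm^[n] (c • X) = c ^ N ^ n • D.renorm^[n] X := by
  induction n generalizing c X with
  | zero => simp
  | succ n ih => rw [Function.iterate_succ_apply, renorm_smul, ih, ← pow_mul, ← pow_succ']; rfl

open Classical in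
/-- The renormalization map sends the exponential of a quadratic form to a multiple of the
exponential of the Schur complement. -/
lemma exists_renorm_grassExp {Q : Matrix (Fin N₀) (Fin N₀) ℂ}
    (h : AnisoOn (D.bdry 1)ᶜ (D.glueMat 1 Q)) :
    ∃ S, D.renorm (grassExp Q) =
        ((D.glueMat 1 Q).submatrix (Subtype.val : D.Inner 1 → _) Subtype.val).det • grassExp S ∧
      IsTrace (D.bdryPt 1) (D.glueMat 1 Q) S := by
  set l := (Finset.univ.filter fun x => x ∉ D.bdry 1).toList with hl
  have hmem : ∀ x, x ∈ l ↔ x ∉ D.bdry 1 := fun x => by simp [hl]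
  obtain ⟨S, h1, h2, h3⟩ := interiorProd_list_grassExp l (Finset.nodup_toList _) (D.glueMat 1 Q)
    (by
      have : {y | y ∈ l} = (D.bdry 1)ᶜ := by ext y; simp [hmem]
      rw [this]; exact h)
  refine ⟨S.submatrix (D.bdryPt 1) (D.bdryPt 1), ?_, ?_⟩
  · rw [renorm, glueMap_grassExp]
    have h4 : D.interiorMonomial = (l.map fun x => etaPair x x).prod := rfl
    rw [h4, h1, map_smul, restrictVars_grassExp]
    congr 1
    rw [← det_submatrix_equiv_self (Equiv.subtypeEquivRight hmem), submatrix_submatrix]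
    rfl
  · intro g
    obtain ⟨f, hf1, hf2⟩ := h3 (pushVec (D.bdryPt 1) g)
    refine ⟨f, fun x => ?_, ?_⟩
    · rw [hf1, pushVec_of_injective (D.bdryPt_injective 1)]
      rw [hmem, not_not]
      exact ⟨x, rfl⟩
    · rw [hf2]
      ext v
      by_cases hv : v ∈ D.bdry 1
      · obtain ⟨x, rfl⟩ := hv
        rw [pushVec_of_injective (D.bdryPt_injective 1)]
        simp only [mulVec]
        rw [dotProduct_pushVec]
        rfl
      · rw [pushVec_of_notMem _ (fun b hb => hv ⟨b, hb⟩)]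
        simp [mulVec, dotProduct, h2 v ((hmem v).2 hv)]

open Classical in
/-- The constants relating the iterates of the renormalization map and the determinants of the
glued matrices.  They are produced by the scalings `τ_t`, which do not commute with the interior
products. -/
def gaussConst : ℕ → ℝ
  | 0 => 1
  | n + 1 => gaussConst n ^ N * ((∏ i, D.wt i) ^ Fintype.card (D.Inner n))⁻¹

open Classical in
lemma gaussConst_pos (n : ℕ) : 0 < D.gaussConst n := by
  induction n with
  | zero => exact one_pos
  | succ n ih =>
    exact mul_pos (pow_pos ih _) (inv_pos.2 (pow_pos (Finset.prod_pos fun i _ => D.wt_pos i) _))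

open Classical in
/-- The Dirichlet determinant, normalized so as to be a coefficient of an iterate of `R`. -/
def kappa (n : ℕ) (Q : Matrix (Fin N₀) (Fin N₀) ℂ) : ℂ :=
  D.gaussConst n * ((D.glueMat n Q).submatrix (Subtype.val : D.Inner n → _) Subtype.val).det

lemma kappa_succ {n : ℕ} {Q S : Matrix (Fin N₀) (Fin N₀) ℂ}
    (h : IsTrace (D.bdryPt n) (D.glueMat n Q) S) [Fintype (D.Inner 1)] [DecidableEq (D.Inner 1)] :
    D.kappa (n + 1) Q = D.kappa n Q ^ N *
      ((D.glueMat 1 S).submatrix (Subtype.val : D.Inner 1 → _) Subtype.val).det := by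
  have h5 : (∏ i, (D.wt i : ℂ)) ≠ 0 :=
    Finset.prod_ne_zero_iff.2 fun i _ => by exact_mod_cast (D.wt_pos i).ne'
  rw [kappa, kappa, D.det_glueMat_succ_inner h, gaussConst, mul_pow]
  push_cast
  field_simp
  congr!

/-- The smallest weight is at most `1`, the weight of the first cell. -/
lemma exists_minWt : ∃ m, 0 < m ∧ m ≤ 1 ∧ ∀ i, m ≤ D.wt i := by
  have : Nonempty (Fin N) := ⟨D.firstCell⟩
  obtain ⟨i, hi⟩ := Finite.exists_min D.wt
  refine ⟨D.wt i, D.wt_pos i, ?_, hi⟩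
  refine (hi D.firstCell).trans ?_
  rw [wt, mul_inv_cancel₀ (D.alpha_pos _).ne']

lemma isTrace_zero (Q : Matrix (Fin N₀) (Fin N₀) ℂ) :
    IsTrace (D.bdryPt 0) (D.glueMat 0 Q) Q := by
  have hsurj : Function.Surjective (D.bdryPt 0) := fun v => by
    obtain ⟨p, x, rfl⟩ := D.exists_cell v
    exact ⟨x, by rw [bdryPt, Subsingleton.elim p]⟩
  let e := Equiv.ofBijective _ ⟨D.bdryPt_injective 0, hsurj⟩
  intro g
  refine ⟨g ∘ e.symm, fun x => ?_, ?_⟩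
  · have : e.symm (D.bdryPt 0 x) = x := e.symm_apply_apply x
    rw [Function.comp_apply, this]
  · rw [glueMat_mulVec, Fintype.sum_unique]
    have h1 : D.cell default = D.bdryPt 0 := by
      ext x; rw [bdryPt, Subsingleton.elim default]
    rw [h1]
    have h2 : (g ∘ e.symm) ∘ D.bdryPt 0 = g := by
      ext x; exact congrArg g (e.symm_apply_apply x)
    rw [h2]
    simp

/-- The iterates of the renormalization map on the exponential of a coercive form, in terms of
the glued matrix on `F_n`. -/
theorem exists_iterate_renorm_grassExp {θ : ℂ} {δ : ℝ} (hδ : 0 < δ)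
    {Q : Matrix (Fin N₀) (Fin N₀) ℂ} (h : Coer θ δ Q) (n : ℕ) :
    ∃ S, D.renorm^[n] (grassExp Q) = D.kappa n Q • grassExp S ∧
      IsTrace (D.bdryPt n) (D.glueMat n Q) S := by
  classical
  obtain ⟨m, hm0, -, hmw⟩ := D.exists_minWt
  induction n with
  | zero =>
    refine ⟨Q, ?_, D.isTrace_zero Q⟩
    have : IsEmpty (D.Inner 0) := ⟨fun v => v.2 (by
      obtain ⟨p, x, hx⟩ := D.exists_cell v.1
      exact ⟨x, by rw [← hx, bdryPt, Subsingleton.elim p]⟩)⟩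
    simp [kappa, gaussConst]
  | succ n ih =>
    obtain ⟨S, h1, h2⟩ := ih
    have hS : Coer θ (δ * m ^ n) S :=
      h2.coer (by positivity) (D.bdryPt_injective n) (D.Coer_glueMat hδ.le hm0.le hmw h n)
    have hS1 := D.Coer_glueMat (by positivity) hm0.le hmw hS 1
    obtain ⟨T, h3, h4⟩ := D.exists_renorm_grassExp (hS1.anisoOn (by positivity) _)
    refine ⟨T, ?_, ?_⟩
    · rw [Function.iterate_succ_apply', h1, renorm_smul, h3, smul_smul]
      rw [D.kappa_succ h2]
    · have := (D.isTrace_coarse h2).trans h4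
      rwa [show D.coarse n ∘ D.bdryPt 1 = D.bdryPt (n + 1) from
        funext fun x => D.coarse_bdryPt n x] at this

end LatticeData

/-! ### Continuity properties of the Grassmann algebra -/

section BalNorm

variable {V : Type} [Fintype V]

/-- The multiplication of `𝒜` as a continuous bilinear map. -/
def balMul (V : Type) [Fintype V] : Bal V →L[ℂ] Bal V →L[ℂ] Bal V :=
  (LinearMap.mul ℂ (Bal V)).toContinuousBilinearMap

lemma norm_bal_mul_le (X Y : Bal V) : ‖X * Y‖ ≤ ‖balMul V‖ * ‖X‖ * ‖Y‖ :=
  (balMul V).le_opNorm₂ X Y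

lemma norm_bal_pow_le (X : Bal V) (k : ℕ) :
    ‖X ^ k‖ ≤ (‖balMul V‖ * ‖X‖) ^ k * ‖(1 : Bal V)‖ := by
  induction k with
  | zero => simp
  | succ k ih =>
    rw [pow_succ', pow_succ', mul_assoc]
    exact (norm_bal_mul_le _ _).trans (mul_le_mul_of_nonneg_left ih (by positivity))

lemma AnalyticAt.bal_mul {E : Type*} [NormedAddCommGroup E] [NormedSpace ℂ E] {f g : E → Bal V}
    {x : E} (hf : AnalyticAt ℂ f x) (hg : AnalyticAt ℂ g x) :
    AnalyticAt ℂ (fun y => f y * g y) x :=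
  ((balMul V).analyticAt_bilinear (f x, g x)).comp₂ hf hg

lemma analyticAt_of_linear {E F : Type*} [NormedAddCommGroup E] [NormedSpace ℂ E]
    [FiniteDimensional ℂ E] [NormedAddCommGroup F] [NormedSpace ℂ F] (L : E →ₗ[ℂ] F) (x : E) :
    AnalyticAt ℂ L x :=
  (LinearMap.toContinuousLinearMap L).analyticAt x

lemma exists_norm_linear_le {E F : Type*} [NormedAddCommGroup E] [NormedSpace ℂ E]
    [FiniteDimensional ℂ E] [NormedAddCommGroup F] [NormedSpace ℂ F] (L : E →ₗ[ℂ] F) :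
    ∃ C, 0 < C ∧ ∀ x, ‖L x‖ ≤ C * ‖x‖ := by
  refine ⟨‖LinearMap.toContinuousLinearMap L‖ + 1, by positivity, fun x => ?_⟩
  refine ((LinearMap.toContinuousLinearMap L).le_opNorm x).trans ?_
  gcongr
  linarith

lemma norm_quadForm_le {S : Matrix V V ℂ} {K : ℝ} (hS : ∀ a b, ‖S a b‖ ≤ K) :
    ‖quadForm S‖ ≤ K * ∑ x, ∑ y, ‖(etaPair x y : Bal V)‖ := by
  rw [quadForm, Finset.mul_sum]
  refine (norm_sum_le _ _).trans (Finset.sum_le_sum fun x _ => ?_)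
  rw [Finset.mul_sum]
  refine (norm_sum_le _ _).trans (Finset.sum_le_sum fun y _ => ?_)
  rw [norm_smul]
  exact mul_le_mul_of_nonneg_right (hS x y) (norm_nonneg _)

/-- The exponential of a quadratic form grows at most polynomially with its coefficients. -/
lemma exists_norm_grassExp_le (V : Type) [Fintype V] : ∃ C, 0 < C ∧ ∀ (S : Matrix V V ℂ) (K : ℝ),
    0 ≤ K → (∀ a b, ‖S a b‖ ≤ K) → ‖grassExp S‖ ≤ C * (1 + K) ^ Fintype.card V := by
  set c := ‖balMul V‖ * ∑ x, ∑ y, ‖(etaPair x y : Bal V)‖ with hc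
  have hc0 : 0 ≤ c := by positivity
  refine ⟨(Fintype.card V + 1) * ((1 + c) ^ Fintype.card V * (‖(1 : Bal V)‖ + 1)), by positivity,
    fun S K hK hS => ?_⟩
  rw [grassExp]
  refine (norm_sum_le _ _).trans ?_
  have h : ∀ k ∈ Finset.range (Fintype.card V + 1),
      ‖((k.factorial : ℂ)⁻¹) • quadForm S ^ k‖ ≤
        (1 + c) ^ Fintype.card V * (‖(1 : Bal V)‖ + 1) * (1 + K) ^ Fintype.card V := by
    intro k hk
    rw [norm_smul]
    have h1 : ‖((k.factorial : ℂ)⁻¹)‖ ≤ 1 := by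
      rw [norm_inv, Complex.norm_natCast]
      exact inv_le_one_of_one_le₀ (by exact_mod_cast Nat.one_le_iff_ne_zero.2 k.factorial_ne_zero)
    have h2 : ‖balMul V‖ * ‖quadForm S‖ ≤ (1 + c) * (1 + K) := by
      have := mul_le_mul_of_nonneg_left (norm_quadForm_le hS) (norm_nonneg (balMul V))
      have h3 : ‖balMul V‖ * ‖quadForm S‖ ≤ c * K := by rw [hc]; linarith
      nlinarith
    have h3 : ‖quadForm S ^ k‖ ≤ ((1 + c) * (1 + K)) ^ Fintype.card V * (‖(1 : Bal V)‖ + 1) := by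
      refine (norm_bal_pow_le _ _).trans (mul_le_mul ?_ (by linarith) (norm_nonneg _)
        (by positivity))
      refine (pow_le_pow_left₀ (by positivity) h2 k).trans ?_
      refine pow_le_pow_right₀ ?_ (Nat.lt_succ_iff.1 (Finset.mem_range.1 hk))
      nlinarith
    calc _ ≤ 1 * (((1 + c) * (1 + K)) ^ Fintype.card V * (‖(1 : Bal V)‖ + 1)) :=
          mul_le_mul h1 h3 (norm_nonneg _) zero_le_one
      _ = _ := by rw [mul_pow]; ring
  refine (Finset.sum_le_sum h).trans (le_of_eq ?_)
  rw [Finset.sum_const, Finset.card_range]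
  push_cast [nsmul_eq_mul]
  ring

lemma analyticAt_grassExp_comp {E : Type*} [NormedAddCommGroup E] [NormedSpace ℂ E]
    {f : E → Bal V} {g : E → Matrix V V ℂ} {x : E} (hf : AnalyticAt ℂ f x)
    (hfg : ∀ y, f y = quadForm (g y)) : AnalyticAt ℂ (fun y => grassExp (g y)) x := by
  have h : ∀ k : ℕ, AnalyticAt ℂ (fun y => f y ^ k) x := by
    intro k
    induction k with
    | zero => simpa using analyticAt_const
    | succ k ih => simpa only [pow_succ] using ih.bal_mul hf
  simp only [grassExp, ← hfg]
  exact Finset.analyticAt_fun_sum _ fun k _ => analyticAt_const.fun_smul (h k)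

end BalNorm

namespace LatticeData

variable {N N₀ : ℕ} {Γ : Type*} [Group Γ] (D : LatticeData N N₀ Γ)

include D in
lemma two_le : 2 ≤ N := le_trans D.one_lt D.le

include D in
lemma one_lt_cast : (1 : ℝ) < N := by exact_mod_cast D.two_le

lemma renorm_zero : D.renorm 0 = 0 := by
  have h := D.renorm_smul 0 0
  rw [zero_smul] at h
  rw [h, zero_pow (by have := D.two_le; omega), zero_smul]

/-- The factors of `glueMap` as linear maps. -/
def glueFactor (i : Fin N) : Bal (Fin N₀) →ₗ[ℂ] Bal (D.Vert 1) :=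
  ((relabel (D.cell (n := 1) fun _ => i)).comp
    (scaleDeg (((D.alpha D.firstCell * (D.alpha i)⁻¹ : ℝ)) : ℂ))).toLinearMap

/-- The linear map applied to `glueMap X` in the definition of the renormalization map. -/
def berezin : Bal (D.Vert 1) →ₗ[ℂ] Bal (Fin N₀) :=
  (restrictVars (D.bdryPt 1)).toLinearMap ∘ₗ interiorProd D.interiorMonomial

lemma renorm_eq (X : Bal (Fin N₀)) :
    D.renorm X = D.berezin (List.ofFn fun i => D.glueFactor i X).prod := rfl

lemma analyticAt_renorm (X : Bal (Fin N₀)) : AnalyticAt ℂ D.renorm X := by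
  have h : ∀ (n : ℕ) (L : Fin n → Bal (Fin N₀) →ₗ[ℂ] Bal (D.Vert 1)),
      AnalyticAt ℂ (fun X => (List.ofFn fun i => L i X).prod) X := by
    intro n
    induction n with
    | zero => intro L; simpa using analyticAt_const
    | succ n ih =>
      intro L
      simp only [List.ofFn_succ, List.prod_cons]
      exact (analyticAt_of_linear (L 0) X).bal_mul (ih fun i => L i.succ)
  exact (analyticAt_of_linear D.berezin _).comp (h N D.glueFactor)

lemma analyticAt_iterate_renorm (n : ℕ) (X : Bal (Fin N₀)) : AnalyticAt ℂ D.renorm^[n] X := by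
  induction n generalizing X with
  | zero => exact analyticAt_id
  | succ n ih => exact (ih _).comp (D.analyticAt_renorm X)

lemma exists_norm_renorm_le : ∃ C, 1 ≤ C ∧ ∀ X, ‖D.renorm X‖ ≤ C * ‖X‖ ^ N := by
  have h : ∀ (n : ℕ) (L : Fin n → Bal (Fin N₀) →ₗ[ℂ] Bal (D.Vert 1)),
      ∃ C, 0 < C ∧ ∀ X, ‖(List.ofFn fun i => L i X).prod‖ ≤ C * ‖X‖ ^ n := by
    intro n
    induction n with
    | zero => exact fun L => ⟨‖(1 : Bal (D.Vert 1))‖ + 1, by positivity, fun X => by simp⟩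
    | succ n ih =>
      intro L
      obtain ⟨C, hC, h1⟩ := ih fun i => L i.succ
      obtain ⟨B, hB, h2⟩ := exists_norm_linear_le (L 0)
      refine ⟨(‖balMul (D.Vert 1)‖ + 1) * B * C, by positivity, fun X => ?_⟩
      simp only [List.ofFn_succ, List.prod_cons]
      refine (norm_bal_mul_le _ _).trans ?_
      calc _ ≤ (‖balMul (D.Vert 1)‖ + 1) * (B * ‖X‖) * (C * ‖X‖ ^ n) := by
            gcongr
            · linarith
            · exact h2 X
            · exact h1 X
        _ = _ := by ring
  obtain ⟨C, hC, h1⟩ := h N D.glueFactor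
  obtain ⟨B, hB, h2⟩ := exists_norm_linear_le D.berezin
  refine ⟨B * C + 1, by nlinarith, fun X => ?_⟩
  rw [renorm_eq]
  calc _ ≤ B * (C * ‖X‖ ^ N) := (h2 _).trans (mul_le_mul_of_nonneg_left (h1 X) hB.le)
    _ ≤ _ := by nlinarith [pow_nonneg (norm_nonneg X) N]

/-! ### Existence of the Green function -/

lemma greenSeq_of_ne_zero {n : ℕ} {x : Bal (Fin N₀)} (h : D.renorm^[n] x ≠ 0) :
    D.greenSeq n x = ((((N : ℝ) ^ n)⁻¹ * Real.log ‖D.renorm^[n] x‖ : ℝ) : EReal) := by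
  rw [greenSeq, ← ofReal_norm, ENNReal.log_ofReal_of_pos (norm_pos_iff.2 h),
    EReal.coe_mul]

lemma greenSeq_of_eq_zero {n : ℕ} {x : Bal (Fin N₀)} (h : D.renorm^[n] x = 0) :
    D.greenSeq n x = ⊥ := by
  rw [greenSeq, h]
  simp only [enorm_zero, ENNReal.log_zero]
  have := D.one_lt_cast
  exact EReal.coe_mul_bot_of_pos (by positivity)

/-- `N⁻ⁿ ln ‖Rⁿ(x)‖` is decreasing in `n` up to a summable correction, since `R` is homogeneous
of degree `N`. -/
lemma exists_tendsto_greenSeq (x : Bal (Fin N₀)) :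
    ∃ l : EReal, Tendsto (fun n => D.greenSeq n x) atTop (𝓝 l) ∧ l ≠ ⊤ := by
  by_cases h0 : ∃ n, D.renorm^[n] x = 0
  · obtain ⟨n, hn⟩ := h0
    refine ⟨⊥, ?_, bot_ne_top⟩
    refine tendsto_const_nhds.congr' ?_
    filter_upwards [eventually_ge_atTop n] with k hk
    obtain ⟨j, rfl⟩ := Nat.exists_eq_add_of_le' hk
    rw [greenSeq_of_eq_zero]
    rw [Function.iterate_add_apply, hn]
    exact Function.iterate_fixed D.renorm_zero j
  · push Not at h0
    obtain ⟨C, hC1, hC⟩ := D.exists_norm_renorm_le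
    have hN := D.one_lt_cast
    have hlC : 0 ≤ Real.log C := Real.log_nonneg hC1
    -- `‖R X‖ ≤ C ‖X‖ ^ N` makes `r n` decrease up to an error `log C / N ^ (n + 1)`, which `e`
    -- compensates since `N ≥ 2`
    set r : ℕ → ℝ := fun n => ((N : ℝ) ^ n)⁻¹ * Real.log ‖D.renorm^[n] x‖ with hr
    set e : ℕ → ℝ := fun n => Real.log C * ((N : ℝ) ^ n)⁻¹ with he
    have hanti : Antitone fun n => r n + e n := by
      refine antitone_nat_of_succ_le fun n => ?_
      have h1 : Real.log ‖D.renorm^[n + 1] x‖ ≤ Real.log C + N * Real.log ‖D.renorm^[n] x‖ := by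
        have hp := norm_pos_iff.2 (h0 n)
        rw [← Real.log_pow, ← Real.log_mul (by positivity) (by positivity)]
        refine Real.log_le_log (norm_pos_iff.2 (h0 _)) ?_
        rw [Function.iterate_succ_apply']
        exact hC _
      have hp : 0 < ((N : ℝ) ^ (n + 1))⁻¹ := by positivity
      have h3 : ((N : ℝ) ^ n)⁻¹ = N * ((N : ℝ) ^ (n + 1))⁻¹ := by
        rw [pow_succ]; field_simp
      simp only [hr, he, h3]
      have h4 := mul_le_mul_of_nonneg_left h1 hp.le
      have h5 : 2 * (((N : ℝ) ^ (n + 1))⁻¹ * Real.log C) ≤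
          N * (((N : ℝ) ^ (n + 1))⁻¹ * Real.log C) :=
        mul_le_mul_of_nonneg_right (by exact_mod_cast D.two_le) (by positivity)
      nlinarith
    have he0 : Tendsto e atTop (𝓝 0) := by
      have := (tendsto_inv_atTop_zero.comp (tendsto_pow_atTop_atTop_of_one_lt hN)).const_mul
        (Real.log C)
      simpa using this
    have hgr : (fun n => D.greenSeq n x) = fun n => ((r n : ℝ) : EReal) :=
      funext fun n => D.greenSeq_of_ne_zero (h0 n)
    rw [hgr]
    rcases tendsto_atTop_of_antitone hanti with h | ⟨l, h⟩
    · refine ⟨⊥, ?_, bot_ne_top⟩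
      rw [EReal.tendsto_coe_nhds_bot_iff]
      refine tendsto_atBot_mono (fun n => ?_) h
      have : 0 ≤ e n := by positivity
      linarith
    · refine ⟨(l : EReal), ?_, EReal.coe_ne_top l⟩
      rw [EReal.tendsto_coe]
      simpa using h.sub he0

/-- The Green function is the limit of the normalized logarithms, and it is not `+∞`. -/
theorem tendsto_greenSeq (x : Bal (Fin N₀)) :
    Tendsto (fun n => D.greenSeq n x) atTop (𝓝 (D.green x)) ∧ D.green x ≠ ⊤ := by
  obtain ⟨l, h1, h2⟩ := D.exists_tendsto_greenSeq x
  have : D.green x = l := h1.limUnder_eq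
  rw [this]
  exact ⟨h1, h2⟩

/-! ### Existence of the asymptotic order of vanishing -/

lemma projPull_renorm_comp (F : Projectivization ℂ (Bal (Fin N₀)) → Bal (Fin N₀)) :
    projPull (fun y => D.renorm (F y)) = fun v => D.renorm (projPull F v) := by
  ext1 v
  by_cases hv : v ≠ 0
  · simp [projPull, hv]
  · simp [projPull, hv, renorm_zero]

/-- Since `R` is homogeneous of degree `N`, it multiplies the orders of vanishing by at least `N`. -/
lemma vanishesToOrder_renorm {X : Set (Projectivization ℂ (Bal (Fin N₀)))}
    {f : Projectivization ℂ (Bal (Fin N₀)) → Bal (Fin N₀)} {x} {p : ℕ}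
    (h : VanishesToOrder X f x p) : VanishesToOrder X (fun y => D.renorm (f y)) x (N * p) := by
  obtain ⟨F, hF, hFf, hO⟩ := h
  obtain ⟨C, -, hC⟩ := D.exists_norm_renorm_le
  refine ⟨fun y => D.renorm (F y), ?_, ?_, ?_⟩
  · rw [HolAt, projPull_renorm_comp]
    exact (D.analyticAt_renorm _).comp hF
  · filter_upwards [hFf] with y hy
    rw [hy]
  · rw [projPull_renorm_comp]
    have h1 : (fun v => D.renorm (projPull F v)) =O[𝓝 x.rep] fun v => ‖projPull F v‖ ^ N := by
      refine Asymptotics.IsBigO.of_bound C (Eventually.of_forall fun v => ?_)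
      rw [norm_pow, norm_norm]
      exact hC _
    refine h1.trans ?_
    have h2 := hO.norm_left.pow N
    simpa only [← pow_mul, mul_comm] using h2

lemma mul_rho_le (n : ℕ) (x : Projectivization ℂ (Bal (Fin N₀))) :
    (N : ℕ∞) * D.rho n x ≤ D.rho (n + 1) x := by
  rw [rho]
  simp only [vanishingOrder, ENat.mul_iSup]
  refine iSup_le fun s => iSup_le fun hs => iSup_le fun p => iSup_le fun hp => ?_
  rw [rho]
  refine le_trans ?_ (le_iSup₂ (f := fun s (_ : IsLocalSection D.lagG s x) =>
    vanishingOrder D.lagG (fun y => D.renorm^[n + 1] (s y)) x) s hs)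
  have h := D.vanishesToOrder_renorm hp
  have h1 : (fun y => D.renorm (D.renorm^[n] (s y))) = fun y => D.renorm^[n + 1] (s y) := by
    ext1 y; rw [Function.iterate_succ_apply']
  rw [h1] at h
  exact_mod_cast le_iSup₂ (f := fun (p : ℕ) (_ : VanishesToOrder D.lagG _ x p) => (p : ℕ∞)) _ h

lemma rhoSeq_mono (x : Projectivization ℂ (Bal (Fin N₀))) :
    Monotone fun n => D.rhoSeq n x := by
  refine monotone_nat_of_le_succ fun n => ?_
  have h : (N : ℝ≥0∞) * (D.rho n x : ℝ≥0∞) ≤ (D.rho (n + 1) x : ℝ≥0∞) := by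
    exact_mod_cast ENat.toENNReal_le.2 (D.mul_rho_le n x)
  have hN : (N : ℝ≥0∞) ≠ 0 := by have := D.two_le; simp; omega
  rw [rhoSeq, rhoSeq, pow_succ']
  calc (D.rho n x : ℝ≥0∞) / (N : ℝ≥0∞) ^ n
      = (N * (D.rho n x : ℝ≥0∞)) / (N * (N : ℝ≥0∞) ^ n) :=
        (ENNReal.mul_div_mul_left _ _ hN (by simp)).symm
    _ ≤ _ := by gcongr

/-- The asymptotic order of vanishing is the limit of an increasing sequence. -/
theorem tendsto_rhoSeq (x : Projectivization ℂ (Bal (Fin N₀))) :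
    Tendsto (fun n => D.rhoSeq n x) atTop (𝓝 (D.rhoInf x)) := by
  have h := tendsto_atTop_iSup (D.rhoSeq_mono x)
  have : D.rhoInf x = ⨆ n, D.rhoSeq n x := h.limUnder_eq
  rwa [this]

end LatticeData

/-! ### Bounds for coercive matrices -/

section CoerBounds

open Matrix

variable {V B : Type} [Fintype V] [Fintype B]

lemma pow_card_le_norm_multiset_prod {δ : ℝ} (hδ : 0 ≤ δ) (s : Multiset ℂ)
    (h : ∀ r ∈ s, δ ≤ ‖r‖) : δ ^ Multiset.card s ≤ ‖s.prod‖ := by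
  induction s using Multiset.induction_on with
  | empty => simp
  | cons a s ih =>
    rw [Multiset.card_cons, Multiset.prod_cons, norm_mul, pow_succ']
    exact mul_le_mul (h a (Multiset.mem_cons_self a s))
      (ih fun r hr => h r (Multiset.mem_cons_of_mem hr)) (by positivity) (norm_nonneg _)

/-- All eigenvalues of a coercive matrix have modulus at least `δ`. -/
lemma Coer.pow_card_le_norm_det [DecidableEq V] {θ : ℂ} {δ : ℝ} (hθ : ‖θ‖ ≤ 1) (hδ : 0 ≤ δ)
    {M : Matrix V V ℂ} (h : Coer θ δ M) : δ ^ Fintype.card V ≤ ‖M.det‖ := by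
  rw [det_eq_prod_roots_charpoly]
  have hcard : Multiset.card M.charpoly.roots = Fintype.card V := by
    rw [← IsAlgClosed.splits M.charpoly |>.natDegree_eq_card_roots, charpoly_natDegree_eq_dim]
  rw [← hcard]
  refine pow_card_le_norm_multiset_prod hδ _ fun r hr => ?_
  have hr0 := (Polynomial.mem_roots'.1 hr).2
  rw [Polynomial.IsRoot, eval_charpoly] at hr0
  obtain ⟨f, hf0, hf⟩ := exists_mulVec_eq_zero_iff.2 hr0
  have hf1 : M *ᵥ f = r • f := by
    rw [sub_mulVec, sub_eq_zero] at hf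
    rw [← hf]
    ext x
    simp
  have h1 := h f
  have hs := sum_norm_sq_pos hf0
  have h2 : star f ⬝ᵥ f = ((∑ x, ‖f x‖ ^ 2 : ℝ) : ℂ) := by
    push_cast
    simp only [dotProduct, Pi.star_apply]
    refine Finset.sum_congr rfl fun x _ => ?_
    rw [← Complex.conj_mul']
    rfl
  rw [hf1, dotProduct_smul, h2, smul_eq_mul, ← mul_assoc, Complex.re_mul_ofReal] at h1
  have h3 := le_of_mul_le_mul_right h1 hs
  calc δ ≤ (θ * r).re := h3
    _ ≤ ‖θ * r‖ := Complex.re_le_norm _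
    _ ≤ ‖r‖ := by rw [norm_mul]; exact mul_le_of_le_one_left (norm_nonneg _) hθ

/-- The Schur complements of a coercive matrix are bounded. -/
lemma IsTrace.norm_entry_le {θ : ℂ} {δ K : ℝ} (hθ : ‖θ‖ ≤ 1) (hδ : 0 < δ) (hK : 0 ≤ K)
    {c : B → V} (hc : Function.Injective c) {M : Matrix V V ℂ} {S : Matrix B B ℂ}
    (h : IsTrace c M S) (hM : Coer θ δ M) (hMK : ∀ x y, ‖M x y‖ ≤ K) (a b : B) :
    ‖S a b‖ ≤ K ^ 2 * Fintype.card V / δ := by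
  classical
  obtain ⟨f, hf1, hf2⟩ := h (Pi.single b 1)
  set s := ∑ x, ‖f x‖ with hs
  have hs0 : 0 ≤ s := by positivity
  have hbound : ∀ a, ‖S a b‖ ≤ K * s := by
    intro a
    have h1 : S a b = (M *ᵥ f) (c a) := by
      rw [hf2, pushVec_of_injective hc, mulVec_single_one]
      rfl
    rw [h1, mulVec, dotProduct, hs, Finset.mul_sum]
    refine (norm_sum_le _ _).trans (Finset.sum_le_sum fun x _ => ?_)
    rw [norm_mul]
    exact mul_le_mul_of_nonneg_right (hMK _ _) (norm_nonneg _)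
  have h1 : star f ⬝ᵥ (M *ᵥ f) = S b b := by
    rw [hf2, dotProduct_pushVec]
    have : star f ∘ c = star (Pi.single b 1) := by
      ext x
      simp [hf1]
    rw [this, mulVec_single_one, ← Pi.single_star, star_one, single_one_dotProduct]
    rfl
  have h2 : δ * ∑ x, ‖f x‖ ^ 2 ≤ K * s := by
    refine (hM f).trans ?_
    rw [h1]
    refine (Complex.re_le_norm _).trans ?_
    rw [norm_mul]
    exact (mul_le_of_le_one_left (norm_nonneg _) hθ).trans (hbound b)
  have h3 : s ^ 2 ≤ Fintype.card V * ∑ x, ‖f x‖ ^ 2 := by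
    have := sq_sum_le_card_mul_sum_sq (s := (Finset.univ : Finset V)) (f := fun x => ‖f x‖)
    simpa using this
  have h4 : s ≤ K * Fintype.card V / δ := by
    rw [le_div_iff₀ hδ]
    rcases hs0.eq_or_lt with h0 | h0
    · rw [← h0, zero_mul]; positivity
    · have h5 : δ * s ^ 2 ≤ Fintype.card V * (K * s) := by
        calc δ * s ^ 2 ≤ δ * (Fintype.card V * ∑ x, ‖f x‖ ^ 2) := by gcongr
          _ = Fintype.card V * (δ * ∑ x, ‖f x‖ ^ 2) := by ring
          _ ≤ _ := by gcongr
      refine le_of_mul_le_mul_right ?_ h0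
      linarith
  calc ‖S a b‖ ≤ K * s := hbound a
    _ ≤ K * (K * Fintype.card V / δ) := by gcongr
    _ = _ := by ring

end CoerBounds

namespace LatticeData

variable {N N₀ : ℕ} {Γ : Type*} [Group Γ] (D : LatticeData N N₀ Γ)

open Matrix

lemma norm_glueMat_le (n : ℕ) (Q : Matrix (Fin N₀) (Fin N₀) ℂ) (x y : D.Vert n) :
    ‖D.glueMat n Q x y‖ ≤ (∑ i, D.wt i) ^ n * ∑ u, ∑ v, ‖Q u v‖ := by
  classical
  rw [glueMat, Matrix.sum_apply, Fintype.sum_pow, Finset.sum_mul]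
  refine (norm_sum_le _ _).trans (Finset.sum_le_sum fun p _ => ?_)
  rw [Matrix.smul_apply, norm_smul, norm_prod]
  simp only [Complex.norm_real, Real.norm_of_nonneg (D.wt_pos _).le]
  refine mul_le_mul_of_nonneg_left ?_ (Finset.prod_nonneg fun k _ => (D.wt_pos _).le)
  rw [pushMat, of_apply]
  refine (norm_sum_le _ _).trans (Finset.sum_le_sum fun u _ => ?_)
  refine (norm_sum_le _ _).trans (Finset.sum_le_sum fun v _ => ?_)
  split_ifs <;> simp

/-- The Schur complements on the boundary are bounded, and bounded below, exponentially. -/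
lemma exists_trace_bound {θ : ℂ} {δ : ℝ} (hθ : ‖θ‖ ≤ 1) (hδ : 0 < δ)
    {Q : Matrix (Fin N₀) (Fin N₀) ℂ} (h : Coer θ δ Q) :
    ∃ A : ℝ, 1 ≤ A ∧ ∀ n S, IsTrace (D.bdryPt n) (D.glueMat n Q) S →
      (∀ a b, ‖S a b‖ ≤ A ^ (n + 1)) ∧ Coer θ (A ^ (n + 1))⁻¹ S ∧
      Coer θ (A ^ (n + 2))⁻¹ (D.glueMat 1 S) := by
  obtain ⟨m, hm0, -, hmw⟩ := D.exists_minWt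
  set W := ∑ i, D.wt i with hW
  have hW0 : 0 ≤ W := Finset.sum_nonneg fun i _ => (D.wt_pos i).le
  set q := ∑ u, ∑ v, ‖Q u v‖ with hq
  have hq0 : 0 ≤ q := by positivity
  have hN := D.one_lt_cast
  set a := q ^ 2 * N₀ / δ with ha
  set b := W ^ 2 * N / m with hb
  have ha0 : 0 ≤ a := by positivity
  have hb0 : 0 ≤ b := by positivity
  set A := 1 + a + b + δ⁻¹ + m⁻¹ with hA
  have hδ' : 0 < δ⁻¹ := inv_pos.2 hδ
  have hm' : 0 < m⁻¹ := inv_pos.2 hm0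
  have hA1 : 1 ≤ A := by linarith
  have hweak : ∀ {W : Type} [Fintype W] {M : Matrix W W ℂ} {s t : ℝ}, s ≤ t → Coer θ t M →
      Coer θ s M := fun hst hM f =>
    (mul_le_mul_of_nonneg_right hst (by positivity)).trans (hM f)
  have hinv : ∀ k : ℕ, (A ^ (k + 1))⁻¹ ≤ δ * m ^ k := by
    intro k
    rw [inv_le_comm₀ (by positivity) (by positivity), mul_inv, ← inv_pow, pow_succ']
    gcongr <;> linarith
  refine ⟨A, hA1, fun n S hS => ?_⟩
  have h1 := D.Coer_glueMat hδ.le hm0.le hmw h n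
  have h2 := hS.coer (by positivity) (D.bdryPt_injective n) h1
  refine ⟨fun x y => ?_, hweak (hinv n) h2, ?_⟩
  · have h3 := hS.norm_entry_le hθ (by positivity) (by positivity) (D.bdryPt_injective n) h1
      (D.norm_glueMat_le n Q) x y
    refine h3.trans ?_
    have h4 : (Fintype.card (D.Vert n) : ℝ) ≤ N ^ n * N₀ := by exact_mod_cast D.card_vert_le n
    calc (W ^ n * q) ^ 2 * Fintype.card (D.Vert n) / (δ * m ^ n)
        ≤ (W ^ n * q) ^ 2 * (N ^ n * N₀) / (δ * m ^ n) := by gcongr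
      _ = a * b ^ n := by rw [ha, hb, div_pow, mul_pow (W ^ 2)]; field_simp; ring
      _ ≤ A * A ^ n := by gcongr <;> linarith
      _ = A ^ (n + 1) := by ring
  · have h3 := D.Coer_glueMat (by positivity) hm0.le hmw h2 1
    refine hweak (le_trans (hinv (n + 1)) (le_of_eq ?_)) h3
    ring

open Classical in
lemma kappa_ne_zero {θ : ℂ} {δ : ℝ} (hθ : ‖θ‖ ≤ 1) (hδ : 0 < δ)
    {Q : Matrix (Fin N₀) (Fin N₀) ℂ} (h : Coer θ δ Q) (n : ℕ) : D.kappa n Q ≠ 0 := by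
  obtain ⟨m, hm0, -, hmw⟩ := D.exists_minWt
  have h1 := ((D.Coer_glueMat hδ.le hm0.le hmw h n).submatrix
    (Subtype.val_injective (p := fun v => v ∉ D.bdry n))).pow_card_le_norm_det hθ (by positivity)
  refine mul_ne_zero (by exact_mod_cast (D.gaussConst_pos n).ne') ?_
  rw [← norm_pos_iff]
  exact lt_of_lt_of_le (by positivity) h1

include D in
lemma tendsto_linear_div_pow (c : ℝ) :
    Tendsto (fun n : ℕ => ((N : ℝ) ^ n)⁻¹ * (c * (n + 1))) atTop (𝓝 0) := by
  have hN := D.one_lt_cast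
  have h1 := tendsto_pow_const_div_const_pow_of_one_lt 1 hN
  have h2 := tendsto_inv_atTop_zero.comp (tendsto_pow_atTop_atTop_of_one_lt hN)
  have h3 := (h1.const_mul c).add (h2.const_mul c)
  simp only [mul_zero, add_zero] at h3
  refine h3.congr fun n => ?_
  simp only [Function.comp_apply]
  field_simp

include D in
lemma tendsto_zero_of_abs_le_linear {u : ℕ → ℝ} {c : ℝ} (h : ∀ n, |u n| ≤ c * (n + 1)) :
    Tendsto (fun n : ℕ => ((N : ℝ) ^ n)⁻¹ * u n) atTop (𝓝 0) := by
  refine squeeze_zero_norm (fun n => ?_) (D.tendsto_linear_div_pow c)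
  rw [norm_mul, Real.norm_eq_abs (u n), Real.norm_of_nonneg (by positivity)]
  exact mul_le_mul_of_nonneg_left (h n) (by positivity)

/-- For a coercive matrix the Green function is finite, and the Dirichlet and Neumann
determinants have the same exponential rate of growth. -/
theorem exists_tendsto_log_det {θ : ℂ} {δ : ℝ} (hθ : ‖θ‖ ≤ 1) (hδ : 0 < δ)
    {Q : Matrix (Fin N₀) (Fin N₀) ℂ} (h : Coer θ δ Q) [∀ n, DecidableEq (D.Vert n)] :
    ∃ g : ℝ, D.green (grassExp Q) = (g : EReal) ∧
      Tendsto (fun n => ((N : ℝ) ^ n)⁻¹ * Real.log ‖D.kappa n Q‖) atTop (𝓝 g) ∧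
      Tendsto (fun n => ((N : ℝ) ^ n)⁻¹ *
        Real.log (D.gaussConst n * ‖(D.glueMat n Q).det‖)) atTop (𝓝 g) := by
  classical
  choose S hS1 hS2 using D.exists_iterate_renorm_grassExp hδ h
  obtain ⟨A, hA1, hA⟩ := D.exists_trace_bound hθ hδ h
  have hN := D.one_lt_cast
  have hlA : 0 ≤ Real.log A := Real.log_nonneg hA1
  have hA0 : 0 < A := by linarith
  have hkap := D.kappa_ne_zero hθ hδ h
  -- the factor `grassExp (S n)` of `R^n (grassExp Q)` grows at most exponentially with `n`, and its
  -- coefficient of `1` bounds it from below, so that it does not contribute to the limit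
  obtain ⟨C, hC0, hC⟩ := exists_norm_grassExp_le (Fin N₀)
  obtain ⟨B, hB0, hB⟩ := exists_norm_linear_le (coeffOne (Fin N₀)).toLinearMap
  have hexp : ∃ c, ∀ n, |Real.log ‖grassExp (S n)‖| ≤ c * ((n : ℝ) + 1) := by
    refine ⟨|Real.log C| + |Real.log B| + N₀ * (Real.log 2 + Real.log A), fun n => ?_⟩
    have hp := norm_pos_iff.2 (grassExp_ne_zero (S n))
    have hup : Real.log ‖grassExp (S n)‖ ≤ Real.log C + N₀ * (Real.log 2 + (n + 1) * Real.log A) := by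
      have h1 := hC (S n) (A ^ (n + 1)) (by positivity) (hA n _ (hS2 n)).1
      rw [Fintype.card_fin] at h1
      have h2 : 1 + A ^ (n + 1) ≤ 2 * A ^ (n + 1) := by
        have := one_le_pow₀ hA1 (n := n + 1)
        linarith
      have h3 : ‖grassExp (S n)‖ ≤ C * (2 * A ^ (n + 1)) ^ N₀ := h1.trans (by gcongr)
      have h4 := Real.log_le_log hp h3
      rw [Real.log_mul (by positivity) (by positivity), Real.log_pow,
        Real.log_mul (by positivity) (by positivity), Real.log_pow] at h4
      push_cast at h4
      exact h4
    have hlo : -Real.log B ≤ Real.log ‖grassExp (S n)‖ := by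
      have h1 := hB (grassExp (S n))
      rw [AlgHom.toLinearMap_apply, coeffOne_grassExp, norm_one] at h1
      rw [← Real.log_inv]
      refine Real.log_le_log (by positivity) ?_
      rwa [inv_le_iff_one_le_mul₀' hB0]
    have hl2 : 0 ≤ Real.log 2 := Real.log_nonneg (by norm_num)
    have a1 := le_abs_self (Real.log C)
    have a2 := le_abs_self (Real.log B)
    have a3 := abs_nonneg (Real.log C)
    have a4 := abs_nonneg (Real.log B)
    have hn : (0 : ℝ) ≤ n := n.cast_nonneg
    have hN0 : (0 : ℝ) ≤ N₀ := N₀.cast_nonneg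
    have e1 : 0 ≤ (N₀ : ℝ) * Real.log 2 * n := by positivity
    have e2 : 0 ≤ (N₀ : ℝ) * Real.log A * (n + 1) := by positivity
    have e3 : 0 ≤ (N₀ : ℝ) * Real.log 2 := by positivity
    rw [abs_le]
    constructor <;> nlinarith
  -- neither does the factor `(S n).det` relating the Neumann and Dirichlet determinants
  have hdet : ∃ c, ∀ n, |Real.log ‖(S n).det‖| ≤ c * ((n : ℝ) + 1) := by
    refine ⟨Real.log N₀.factorial + N₀ * Real.log A, fun n => ?_⟩
    obtain ⟨h1, h2, -⟩ := hA n _ (hS2 n)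
    have h3 := h2.pow_card_le_norm_det hθ (by positivity)
    rw [Fintype.card_fin] at h3
    have hp : 0 < ‖(S n).det‖ := lt_of_lt_of_le (by positivity) h3
    have h4 := Real.log_le_log (by positivity) h3
    rw [inv_pow, Real.log_inv, Real.log_pow, Real.log_pow] at h4
    have h5 : ‖(S n).det‖ ≤ N₀.factorial * (A ^ (n + 1)) ^ N₀ := by
      have := det_le (A := S n) (abv := NormedField.toAbsoluteValue ℂ) (x := A ^ (n + 1)) h1
      rw [nsmul_eq_mul, Fintype.card_fin] at this
      exact this
    have h6 := Real.log_le_log hp h5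
    rw [Real.log_mul (by exact_mod_cast N₀.factorial_ne_zero) (by positivity), Real.log_pow,
      Real.log_pow] at h6
    push_cast at h4 h6
    have hf : 0 ≤ Real.log N₀.factorial := Real.log_natCast_nonneg _
    have hn : (0 : ℝ) ≤ n := n.cast_nonneg
    have e1 : 0 ≤ Real.log N₀.factorial * (n : ℝ) := by positivity
    rw [abs_le]
    constructor <;> nlinarith
  -- the Dirichlet determinants are bounded below because each step multiplies `a` by `N`, up to an
  -- error of linear size
  set a : ℕ → ℝ := fun n => Real.log ‖D.kappa n Q‖ with ha
  have hrec : ∃ c, 0 ≤ c ∧ ∀ n : ℕ, N * a n - c * (n + 2) ≤ a (n + 1) := by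
    refine ⟨Fintype.card (D.Inner 1) * Real.log A, by positivity, fun n => ?_⟩
    have h1 := (((hA n _ (hS2 n)).2.2).submatrix
      (Subtype.val_injective (p := fun v => v ∉ D.bdry 1))).pow_card_le_norm_det hθ (by positivity)
    have h2 := Real.log_le_log (by positivity) h1
    rw [inv_pow, Real.log_inv, Real.log_pow, Real.log_pow] at h2
    simp only [ha]
    rw [D.kappa_succ (hS2 n), norm_mul, norm_pow, Real.log_mul, Real.log_pow]
    · push_cast at h2
      linarith
    · exact pow_ne_zero _ (norm_ne_zero_iff.2 (hkap n))
    · exact (lt_of_lt_of_le (by positivity) h1).ne'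
  obtain ⟨c, hc0, hrec⟩ := hrec
  have hlow : ∀ n, a 0 - 3 * c ≤ ((N : ℝ) ^ n)⁻¹ * a n := by
    set e : ℕ → ℝ := fun n => ((N : ℝ) ^ n)⁻¹ * (c * (n + 3)) with he
    have hmono : Monotone fun n => ((N : ℝ) ^ n)⁻¹ * a n - e n := by
      refine monotone_nat_of_le_succ fun n => ?_
      have h3 : ((N : ℝ) ^ n)⁻¹ = N * ((N : ℝ) ^ (n + 1))⁻¹ := by
        rw [pow_succ]; field_simp
      have hp : 0 < ((N : ℝ) ^ (n + 1))⁻¹ := by positivity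
      simp only [he, h3]
      push_cast
      have h4 : N * a n - N * (c * (n + 3)) ≤ a (n + 1) - c * (n + 1 + 3) := by
        have h5 := hrec n
        have h6 : 2 * (c * ((n : ℝ) + 3)) ≤ N * (c * (n + 3)) :=
          mul_le_mul_of_nonneg_right (by exact_mod_cast D.two_le) (by positivity)
        nlinarith
      have h5 := mul_le_mul_of_nonneg_left h4 hp.le
      linarith
    intro n
    have h1 := hmono (Nat.zero_le n)
    have h2 : 0 ≤ e n := by positivity
    simp only [pow_zero, inv_one, one_mul, he, Nat.cast_zero] at h1 h2
    linarith
  obtain ⟨c1, hexp⟩ := hexp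
  obtain ⟨c2, hdet⟩ := hdet
  have hexp0 := D.tendsto_zero_of_abs_le_linear hexp
  have hdet0 := D.tendsto_zero_of_abs_le_linear hdet
  have hR : ∀ n, D.renorm^[n] (grassExp Q) ≠ 0 := fun n => by
    rw [hS1]; exact smul_ne_zero (hkap n) (grassExp_ne_zero _)
  have hgs : ∀ n, D.greenSeq n (grassExp Q) = ((((N : ℝ) ^ n)⁻¹ * a n +
      ((N : ℝ) ^ n)⁻¹ * Real.log ‖grassExp (S n)‖ : ℝ) : EReal) := by
    intro n
    rw [D.greenSeq_of_ne_zero (hR n), hS1, norm_smul, Real.log_mul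
      (norm_ne_zero_iff.2 (hkap n)) (norm_ne_zero_iff.2 (grassExp_ne_zero _)), mul_add]
  obtain ⟨hg1, hg2⟩ := D.tendsto_greenSeq (grassExp Q)
  obtain ⟨L, hL⟩ := hexp0.bddBelow_range
  have hbot : D.green (grassExp Q) ≠ ⊥ := by
    have h1 : ((a 0 - 3 * c + L : ℝ) : EReal) ≤ D.green (grassExp Q) := by
      refine ge_of_tendsto' hg1 fun n => ?_
      rw [hgs, EReal.coe_le_coe_iff]
      exact add_le_add (hlow n) (hL ⟨n, rfl⟩)
    intro hb
    rw [hb, le_bot_iff] at h1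
    exact EReal.coe_ne_bot _ h1
  set g := (D.green (grassExp Q)).toReal with hg
  have hgg : D.green (grassExp Q) = (g : EReal) := (EReal.coe_toReal hg2 hbot).symm
  have hk : Tendsto (fun n => ((N : ℝ) ^ n)⁻¹ * a n) atTop (𝓝 g) := by
    rw [hgg] at hg1
    simp_rw [hgs] at hg1
    have := (EReal.tendsto_coe.1 hg1).sub hexp0
    simpa using this
  refine ⟨g, hgg, hk, ?_⟩
  have := hk.add hdet0
  rw [add_zero] at this
  refine this.congr fun n => ?_
  have h1 : D.gaussConst n * ‖(D.glueMat n Q).det‖ = ‖D.kappa n Q‖ * ‖(S n).det‖ := by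
    have h2 : (D.gaussConst n : ℂ) * (D.glueMat n Q).det = D.kappa n Q * (S n).det := by
      rw [kappa, mul_assoc]
      congr 1
      convert D.det_glueMat (hS2 n)
    have h3 := congrArg norm h2
    rwa [norm_mul, norm_mul, Complex.norm_real, Real.norm_of_nonneg (D.gaussConst_pos n).le] at h3
  have h3 := (hA n _ (hS2 n)).2.1.pow_card_le_norm_det hθ (by positivity)
  rw [h1, Real.log_mul (norm_ne_zero_iff.2 (hkap n)) (lt_of_lt_of_le (by positivity) h3).ne',
    mul_add]

end LatticeData

/-! ### Pairs of quadratic forms and their eigenvalues -/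

section SymmetricPairs

open Matrix

variable {V B : Type} [Fintype V] [Fintype B]

/-- The operator `H` with `⟨A f, g⟩ = - ∫ (H f) g db`. -/
def formOp (A : Matrix V V ℝ) (b : V → ℝ) : Matrix V V ℝ :=
  Matrix.of fun x y => -(b x)⁻¹ * A x y

/-- The symmetric form of `A` is bounded by `C` times the form of the measure `b`. -/
def FormBound (C : ℝ) (A : Matrix V V ℝ) (b : V → ℝ) : Prop :=
  ∀ f : V → ℝ, |f ⬝ᵥ A *ᵥ f| ≤ C * ∑ x, b x * f x ^ 2

lemma FormBound.submatrix {C : ℝ} {A : Matrix V V ℝ} {b : V → ℝ} (h : FormBound C A b)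
    {c : B → V} (hc : Function.Injective c) : FormBound C (A.submatrix c c) (b ∘ c) := by
  classical
  intro g
  set f : V → ℝ := Function.extend c g 0 with hf
  have hfc : ∀ x, f (c x) = g x := fun x => hc.extend_apply _ _ _
  have hf0 : ∀ v, v ∉ Set.range c → f v = 0 := fun v hv =>
    Function.extend_apply' _ _ _ fun ⟨x, hx⟩ => hv ⟨x, hx⟩
  have key : ∀ F : V → ℝ, (∀ v, v ∉ Set.range c → F v = 0) → ∑ v, F v = ∑ x, F (c x) := by
    intro F hF
    rw [← Finset.sum_image (f := F) (s := Finset.univ) (g := c) fun x _ y _ h => hc h]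
    refine (Finset.sum_subset (Finset.subset_univ _) fun v _ hv => hF v ?_).symm
    rintro ⟨x, rfl⟩
    exact hv (Finset.mem_image_of_mem _ (Finset.mem_univ _))
  have h1 := h f
  have h2 : f ⬝ᵥ A *ᵥ f = g ⬝ᵥ A.submatrix c c *ᵥ g := by
    simp only [dotProduct, mulVec, submatrix_apply]
    rw [key _ fun v hv => by simp [hf0 v hv]]
    refine Finset.sum_congr rfl fun x _ => ?_
    rw [hfc, key _ fun v hv => by simp [hf0 v hv]]
    simp only [hfc]
  rw [h2, key _ fun v hv => by simp [hf0 v hv]] at h1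
  simpa only [hfc, Function.comp_apply] using h1

lemma dotProduct_pushMat_mulVec (c : B → V) (Q : Matrix B B ℝ) (f : V → ℝ) :
    f ⬝ᵥ pushMat c Q *ᵥ f = (f ∘ c) ⬝ᵥ Q *ᵥ (f ∘ c) := by
  classical
  set E : Matrix B V ℝ := of fun u x => if c u = x then 1 else 0 with hE
  have h1 : pushMat c Q = Eᵀ * (Q * E) := by
    ext x y
    rw [pushMat, of_apply, mul_apply]
    refine Finset.sum_congr rfl fun u _ => ?_
    rw [mul_apply, Finset.mul_sum]
    refine Finset.sum_congr rfl fun v _ => ?_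
    by_cases hx : c u = x <;> by_cases hy : c v = y <;> simp [hE, hx, hy]
  have h2 : E *ᵥ f = f ∘ c := by
    ext u
    simp [hE, mulVec, dotProduct]
  rw [h1, ← mulVec_mulVec, ← mulVec_mulVec, h2, dotProduct_mulVec, vecMul_transpose, h2]

variable [DecidableEq V]

/-- Simultaneous diagonalization of a symmetric form and a positive diagonal form. -/
lemma exists_simultaneous_diagonalization {A : Matrix V V ℝ} (hA : A.IsSymm) {b : V → ℝ}
    (hb : ∀ x, 0 < b x) : ∃ (P : Matrix V V ℝ) (e : V → ℝ), IsUnit P.det ∧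
      A = -(P * diagonal e * Pᵀ) ∧ diagonal b = P * Pᵀ := by
  set r : V → ℝ := fun x => √(b x) with hr
  have hr0 : ∀ x, r x ≠ 0 := fun x => (Real.sqrt_pos.2 (hb x)).ne'
  have hrr : ∀ x, r x * r x = b x := fun x => Real.mul_self_sqrt (hb x).le
  set K : Matrix V V ℝ := of fun x y => -((r x)⁻¹ * A x y * (r y)⁻¹) with hK
  have hKs : K.IsHermitian := by
    ext x y
    have : A y x = A x y := hA.apply x y
    simp only [hK, conjTranspose_apply, of_apply, star_trivial, this]
    ring
  have hsp := hKs.spectral_theorem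
  rw [Unitary.conjStarAlgAut_apply] at hsp
  set U : Matrix V V ℝ := (hKs.eigenvectorUnitary : Matrix V V ℝ) with hU
  have hUU : U * Uᵀ = 1 := Unitary.coe_mul_star_self hKs.eigenvectorUnitary
  refine ⟨diagonal r * U, hKs.eigenvalues, ?_, ?_, ?_⟩
  · rw [det_mul]
    refine IsUnit.mul ?_ ?_
    · rw [det_diagonal]
      exact (Finset.prod_ne_zero_iff.2 fun x _ => hr0 x).isUnit
    · have h1 := congrArg Matrix.det hUU
      rw [det_mul, det_one] at h1
      exact IsUnit.of_mul_eq_one _ h1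
  · have h1 : A = -(diagonal r * K * diagonal r) := by
      ext x y
      rw [neg_apply, mul_diagonal, diagonal_mul, hK, of_apply]
      have := hr0 x
      have := hr0 y
      field_simp
    have h2 : K = U * diagonal hKs.eigenvalues * Uᵀ := hsp
    conv_lhs => rw [h1, h2]
    simp only [transpose_mul, diagonal_transpose, mul_assoc]
  · rw [transpose_mul, diagonal_transpose, mul_assoc, ← mul_assoc U, hUU, one_mul,
      diagonal_mul_diagonal]
    simp only [hrr]

/-- A perturbation of size `s` of a diagonal matrix has a determinant of order `s ^ m`, with `m` the
number of diagonal entries equal to `0`. -/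
lemma exists_det_diagonal_add_smul (d : V → ℂ) (H : Matrix V V ℂ) : ∃ r : ℂ → ℂ, Continuous r ∧
    ∀ s : ℂ, (diagonal d + s • H).det = s ^ Fintype.card {x // d x = 0} * r s := by
  classical
  refine ⟨fun s => (of fun i j => if d i = 0 then H i j else diagonal d i j + s * H i j).det,
    ?_, fun s => ?_⟩
  · refine Continuous.matrix_det (continuous_matrix fun i j => ?_)
    by_cases h : d i = 0
    · simpa [h] using continuous_const
    · simp only [of_apply, h, if_false]
      fun_prop
  · have h1 : diagonal d + s • H = diagonal (fun i => if d i = 0 then s else 1) *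
        of fun i j => if d i = 0 then H i j else diagonal d i j + s * H i j := by
      ext i j
      rw [diagonal_mul, Matrix.add_apply, Matrix.smul_apply, of_apply, smul_eq_mul]
      by_cases h : d i = 0
      · by_cases hij : i = j
        · subst hij
          simp [h]
        · simp [h, hij]
      · simp [h]
    rw [h1, det_mul, det_diagonal, Finset.prod_ite, Finset.prod_const, Finset.prod_const_one,
      mul_one, Fintype.card_subtype]

/-- The eigenvalues of the operator of a symmetric form, their multiplicities, and the determinant
of the pencil of forms. -/
lemma exists_eigenvalues {A : Matrix V V ℝ} (hA : A.IsSymm) {b : V → ℝ} (hb : ∀ x, 0 < b x) :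
    ∃ e : V → ℝ, (formOp A b).charpoly.roots = Finset.univ.val.map e ∧
      (∀ z : ℂ, (A.map (fun r : ℝ => (r : ℂ)) + z • diagonal fun x => (b x : ℂ)).det =
        (∏ x, (b x : ℂ)) * ∏ x, (z - e x)) ∧
      (∀ t : ℝ, Module.finrank ℝ (LinearMap.ker (toLin' (A + t • diagonal b))) =
        Fintype.card {x // e x = t}) ∧
      (∀ C, FormBound C A b → ∀ x, |e x| ≤ C) ∧
      ∀ (t : ℝ) (H : Matrix V V ℂ), ∃ r : ℂ → ℂ, Continuous r ∧ ∀ s : ℂ,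
        (A.map (fun r : ℝ => (r : ℂ)) + (t : ℂ) • (diagonal fun x => (b x : ℂ)) + s • H).det =
          s ^ Fintype.card {x // e x = t} * r s := by
  obtain ⟨P, e, hP, hAP, hbP⟩ := exists_simultaneous_diagonalization hA hb
  have hPt : IsUnit Pᵀ.det := by rwa [det_transpose]
  obtain ⟨Pc, hPc, hdet⟩ : ∃ Pc : Matrix V V ℂ, (∀ z : ℂ,
      A.map (fun r : ℝ => (r : ℂ)) + z • (diagonal fun x => (b x : ℂ)) =
        Pc * (diagonal fun x => z - e x) * Pcᵀ) ∧ Pc.det * Pc.det = ∏ x, (b x : ℂ) := by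
    set Pc : Matrix V V ℂ := P.map (fun r : ℝ => (r : ℂ)) with hPc
    have hm : ∀ M M' : Matrix V V ℝ, (M * M').map (fun r : ℝ => (r : ℂ)) =
        M.map (fun r : ℝ => (r : ℂ)) * M'.map (fun r : ℝ => (r : ℂ)) := fun M M' =>
      Matrix.map_mul (f := Complex.ofRealHom)
    have hd : ∀ d : V → ℝ, (diagonal d).map (fun r : ℝ => (r : ℂ)) =
        diagonal fun x => (d x : ℂ) := fun d => diagonal_map (by simp)
    have h1 : (diagonal fun x => (b x : ℂ)) = Pc * Pcᵀ := by
      rw [← hd, hbP, hm, hPc, transpose_map]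
    have h2 : A.map (fun r : ℝ => (r : ℂ)) = -(Pc * (diagonal fun x => (e x : ℂ)) * Pcᵀ) := by
      conv_lhs => rw [hAP]
      rw [← hd, hPc, ← transpose_map, ← hm, ← hm]
      ext x y
      simp
    refine ⟨Pc, fun z => ?_, ?_⟩
    · have h4 : (diagonal fun x => z - (e x : ℂ)) = z • (1 : Matrix V V ℂ) -
          diagonal fun x => (e x : ℂ) := by
        ext x y
        by_cases h : x = y <;> simp [h]
      rw [h1, h2, h4, mul_sub, sub_mul, Matrix.mul_smul, mul_one, Matrix.smul_mul]
      abel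
    · have := congrArg Matrix.det h1
      rw [det_diagonal, det_mul, det_transpose] at this
      exact this.symm
  refine ⟨e, ?_, ?_, ?_, ?_, ?_⟩
  · have h1 : diagonal b * formOp A b = -A := by
      ext x y
      rw [diagonal_mul, formOp, of_apply, neg_apply]
      have := (hb x).ne'
      field_simp
    have h2 : Pᵀ * formOp A b = diagonal e * Pᵀ := by
      have h3 : P * (Pᵀ * formOp A b) = P * (diagonal e * Pᵀ) := by
        rw [← mul_assoc, ← hbP, h1, hAP, neg_neg, mul_assoc]
      have h4 := congrArg (P⁻¹ * ·) h3
      simpa only [← mul_assoc, nonsing_inv_mul P hP, one_mul] using h4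
    have h3 : formOp A b = Pᵀ⁻¹ * (diagonal e * Pᵀ) := by
      rw [← h2, ← mul_assoc, nonsing_inv_mul _ hPt, one_mul]
    rw [h3, charpoly_mul_comm, mul_assoc, mul_nonsing_inv _ hPt, mul_one, charpoly_diagonal,
      Polynomial.roots_prod _ _ (Finset.prod_ne_zero_iff.2 fun x _ => Polynomial.X_sub_C_ne_zero _)]
    simp
  · intro z
    rw [hPc, det_mul, det_mul, det_transpose, det_diagonal, ← hdet]
    ring
  · intro t
    have h1 : A + t • diagonal b = P * (diagonal fun x => t - e x) * Pᵀ := by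
      have h4 : (diagonal fun x => t - e x) = t • (1 : Matrix V V ℝ) - diagonal e := by
        ext x y
        by_cases h : x = y <;> simp [h]
      conv_lhs => rw [hbP, hAP]
      rw [h4, mul_sub, sub_mul, Matrix.mul_smul, mul_one, Matrix.smul_mul]
      abel
    have h2 : (A + t • diagonal b).rank = Fintype.card {x // t - e x ≠ 0} := by
      rw [h1, rank_mul_eq_left_of_isUnit_det _ _ hPt, rank_mul_eq_right_of_isUnit_det _ _ hP,
        rank_diagonal]
    have h3 := LinearMap.finrank_range_add_finrank_ker (toLin' (A + t • diagonal b))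
    rw [Module.finrank_fintype_fun_eq_card] at h3
    have h4 : Module.finrank ℝ (LinearMap.range (toLin' (A + t • diagonal b))) =
        Fintype.card {x // t - e x ≠ 0} := h2
    have h5 : Fintype.card {x // e x = t} + Fintype.card {x // ¬ e x = t} = Fintype.card V := by
      simpa using Fintype.card_subtype_compl (fun x => e x = t) |>.symm ▸
        Nat.add_sub_cancel' (Fintype.card_subtype_le fun x => e x = t)
    have h6 : Fintype.card {x // t - e x ≠ 0} = Fintype.card {x // ¬ e x = t} :=
      Fintype.card_congr (Equiv.subtypeEquivRight fun x => by rw [sub_ne_zero, ne_comm])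
    omega
  · intro C hC x
    -- the columns of the inverse transpose are eigenvectors
    set f : V → ℝ := Pᵀ⁻¹ *ᵥ Pi.single x 1 with hf
    have h1 : Pᵀ *ᵥ f = Pi.single x 1 := by
      rw [hf, mulVec_mulVec, mul_nonsing_inv _ hPt, one_mulVec]
    have h2 : f ⬝ᵥ diagonal b *ᵥ f = 1 := by
      rw [hbP, ← mulVec_mulVec, h1, dotProduct_mulVec, ← mulVec_transpose, h1]
      simp
    have h3 : f ⬝ᵥ A *ᵥ f = -e x := by
      conv_lhs => rw [hAP]
      rw [neg_mulVec, dotProduct_neg, mul_assoc, ← mulVec_mulVec, ← mulVec_mulVec, h1,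
        dotProduct_mulVec, ← mulVec_transpose, h1]
      simp
    have h4 : ∑ y, b y * f y ^ 2 = 1 := by
      rw [← h2, dotProduct]
      refine Finset.sum_congr rfl fun y _ => ?_
      rw [mulVec_diagonal]
      ring
    have h5 := hC f
    rwa [h3, h4, mul_one, abs_neg] at h5
  · intro t H
    have hu : IsUnit Pc.det := by
      refine isUnit_iff_ne_zero.2 fun h => ?_
      rw [h, zero_mul] at hdet
      exact Finset.prod_ne_zero_iff.2 (fun x _ => by exact_mod_cast (hb x).ne') hdet.symm
    have hut : IsUnit Pcᵀ.det := by rwa [det_transpose]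
    obtain ⟨r, hr, h⟩ := exists_det_diagonal_add_smul (fun x => (t : ℂ) - e x)
      (Pc⁻¹ * H * Pcᵀ⁻¹)
    refine ⟨fun s => Pc.det * Pc.det * r s, continuous_const.mul hr, fun s => ?_⟩
    have h1 : H = Pc * (Pc⁻¹ * H * Pcᵀ⁻¹) * Pcᵀ := by
      rw [mul_assoc, mul_assoc (Pc⁻¹ * H), nonsing_inv_mul _ hut, mul_one, ← mul_assoc,
        mul_nonsing_inv _ hu, one_mul]
    have h2 : Fintype.card {x // e x = t} = Fintype.card {x // (t : ℂ) - e x = 0} :=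
      Fintype.card_congr (Equiv.subtypeEquivRight fun x => by
        rw [sub_eq_zero, Complex.ofReal_inj, eq_comm])
    have h3 : A.map (fun r : ℝ => (r : ℂ)) + (t : ℂ) • (diagonal fun x => (b x : ℂ)) + s • H =
        Pc * ((diagonal fun x => (t : ℂ) - e x) + s • (Pc⁻¹ * H * Pcᵀ⁻¹)) * Pcᵀ := by
      rw [mul_add, add_mul, Matrix.mul_smul, Matrix.smul_mul, ← h1, hPc]
    rw [h3, det_mul, det_mul, h, det_transpose, h2]
    ring

end SymmetricPairs

namespace LatticeData

variable {N N₀ : ℕ} {Γ : Type*} [Group Γ] (D : LatticeData N N₀ Γ)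

open Matrix

/-! ### The difference operators on the lattices, normalized independently of the blow-up -/

/-- The operator `A_n` for the constant blow-up by the first cell. -/
def baseA (n : ℕ) : Matrix (D.Vert n) (D.Vert n) ℝ :=
  ∑ i : Fin n → Fin N, (∏ k, D.wt (i k)) • pushMat (D.cell i) D.opA

open Classical in
/-- The measure `b_n` for the constant blow-up by the first cell. -/
def baseB (n : ℕ) (x : D.Vert n) : ℝ :=
  ∑ i : Fin n → Fin N, (∏ k, D.wt (i k)) * ∑ u, if D.cell i u = x then D.mass u else 0

/-- The ratio of `A_n` and of its normalization, and also of `b_n` and of its normalization. -/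
def blowupScale (ω : ℕ → Fin N) (n : ℕ) : ℝ := ∏ k : Fin n, D.alpha (ω k) * (D.alpha D.firstCell)⁻¹

lemma blowupScale_pos (ω : ℕ → Fin N) (n : ℕ) : 0 < D.blowupScale ω n :=
  Finset.prod_pos fun _ _ => mul_pos (D.alpha_pos _) (inv_pos.2 (D.alpha_pos _))

lemma opAn_eq (ω : ℕ → Fin N) (n : ℕ) : D.opAn ω n = D.blowupScale ω n • D.baseA n := by
  rw [opAn, baseA, Finset.smul_sum]
  refine Finset.sum_congr rfl fun i _ => ?_
  rw [smul_smul, blowupScale, ← Finset.prod_mul_distrib, ← Finset.prod_mul_distrib]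
  congr 1
  refine Finset.prod_congr rfl fun k _ => ?_
  have := (D.alpha_pos D.firstCell).ne'
  rw [wt]
  field_simp

lemma massN_eq (ω : ℕ → Fin N) (n : ℕ) (x : D.Vert n) :
    D.massN ω n x = D.blowupScale ω n * D.baseB n x := by
  classical
  rw [massN, baseB, Finset.mul_sum]
  refine Finset.sum_congr rfl fun i _ => ?_
  rw [← mul_assoc, blowupScale, ← Finset.prod_mul_distrib, ← Finset.prod_mul_distrib]
  congr 1
  · refine Finset.prod_congr rfl fun k _ => ?_
    have h1 := (D.alpha_pos D.firstCell).ne'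
    have h2 := (D.beta_pos (ω k)).ne'
    have h3 := (D.alpha_pos (i k)).ne'
    have h4 := inv_injective (D.gamma_const (ω k) (i k))
    rw [wt]
    field_simp
    linarith

lemma hPlus_eq (ω : ℕ → Fin N) (n : ℕ) : D.hPlus ω n = formOp (D.baseA n) (D.baseB n) := by
  ext x y
  have := (D.blowupScale_pos ω n).ne'
  rw [hPlus, formOp, of_apply, of_apply, massN_eq, opAn_eq, Matrix.smul_apply, smul_eq_mul, mul_inv]
  field_simp

lemma hMinus_eq (ω : ℕ → Fin N) (n : ℕ) : D.hMinus ω n =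
    formOp ((D.baseA n).submatrix (Subtype.val : D.Inner n → _) Subtype.val)
      (D.baseB n ∘ Subtype.val) := by
  rw [hMinus, hPlus_eq]
  rfl

lemma baseB_pos (n : ℕ) (x : D.Vert n) : 0 < D.baseB n x := by
  classical
  obtain ⟨i, u, h⟩ := D.exists_cell x
  have hw : ∀ j : Fin n → Fin N, 0 < ∏ k, D.wt (j k) := fun j =>
    Finset.prod_pos fun k _ => D.wt_pos _
  have h0 : ∀ j : Fin n → Fin N, ∀ u, 0 ≤ if D.cell j u = x then D.mass u else 0 := fun j u => by
    split_ifs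
    exacts [(D.mass_pos u).le, le_rfl]
  rw [baseB]
  refine Finset.sum_pos' (fun j _ => mul_nonneg (hw j).le (Finset.sum_nonneg fun u _ => ?_))
    ⟨i, Finset.mem_univ _, mul_pos (hw i) (Finset.sum_pos' (fun u _ => ?_)
      ⟨u, Finset.mem_univ _, ?_⟩)⟩
  · convert h0 j u
  · convert h0 i u
  · rw [if_pos h]
    exact D.mass_pos u

lemma opA_isSymm : D.opA.IsSymm := by
  ext x y
  simp only [transpose_apply, opA, of_apply]
  by_cases h : x = y
  · rw [h]
  · rw [if_neg h, if_neg (Ne.symm h), D.cond_symm]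

lemma baseA_isSymm (n : ℕ) : (D.baseA n).IsSymm := by
  classical
  ext x y
  rw [transpose_apply, baseA, Matrix.sum_apply, Matrix.sum_apply]
  refine Finset.sum_congr rfl fun i _ => ?_
  rw [Matrix.smul_apply, Matrix.smul_apply, pushMat, of_apply, of_apply, Finset.sum_comm]
  congr 1
  refine Finset.sum_congr rfl fun u _ => Finset.sum_congr rfl fun v _ => ?_
  rw [D.opA_isSymm.apply u v]
  simp only [and_comm]

/-- The glued copies of `A + z I_b` form the pencil of the normalized operators. -/
lemma glueMat_pencil [∀ n, DecidableEq (D.Vert n)] (n : ℕ) (z : ℂ) :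
    D.glueMat n (D.pencil z) = (D.baseA n).map (fun r : ℝ => (r : ℂ)) +
      z • diagonal fun x => (D.baseB n x : ℂ) := by
  classical
  ext x y
  have h1 : ∀ i : Fin n → Fin N, pushMat (D.cell i) (D.pencil z) x y =
      ((pushMat (D.cell i) D.opA x y : ℝ) : ℂ) +
        z * if x = y then ∑ u, (if D.cell i u = x then (D.mass u : ℂ) else 0) else 0 := by
    intro i
    have h2 : ∀ u v : Fin N₀, (if D.cell i u = x ∧ D.cell i v = y then D.pencil z u v else 0) =
        ((if D.cell i u = x ∧ D.cell i v = y then D.opA u v else 0 : ℝ) : ℂ) +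
          z * if v = u then (if D.cell i u = x ∧ x = y then (D.mass u : ℂ) else 0) else 0 := by
      intro u v
      by_cases huv : v = u
      · subst huv
        by_cases hx : D.cell i v = x
        · by_cases hy : x = y <;> simp [hx, hy, pencil]
        · simp [hx]
      · by_cases hx : D.cell i u = x ∧ D.cell i v = y
        · simp [huv, hx, pencil, diagonal_apply_ne _ (Ne.symm huv)]
        · simp [huv, hx]
    have h3 : pushMat (D.cell i) (D.pencil z) x y =
        ∑ u, ∑ v, if D.cell i u = x ∧ D.cell i v = y then D.pencil z u v else 0 := by
      rw [pushMat, of_apply]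
      congr!
    have h4 : pushMat (D.cell i) D.opA x y =
        ∑ u, ∑ v, if D.cell i u = x ∧ D.cell i v = y then D.opA u v else 0 := by
      rw [pushMat, of_apply]
      congr!
    rw [h3, h4, Finset.sum_congr rfl fun u _ => Finset.sum_congr rfl fun v _ => h2 u v]
    simp_rw [Finset.sum_add_distrib, ← Finset.mul_sum, Finset.sum_ite_eq', Finset.mem_univ,
      if_true]
    push_cast
    congr 2
    by_cases hy : x = y <;> simp [hy]
  rw [glueMat, Matrix.sum_apply, Matrix.add_apply, Matrix.map_apply, baseA, Matrix.sum_apply,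
    Matrix.smul_apply, diagonal_apply, smul_eq_mul]
  simp_rw [Matrix.smul_apply, h1, smul_eq_mul, mul_add, Finset.sum_add_distrib]
  congr 1
  · push_cast
    rfl
  · by_cases hy : x = y
    · subst hy
      simp only [if_true, baseB]
      push_cast
      rw [Finset.mul_sum]
      refine Finset.sum_congr rfl fun i _ => ?_
      rw [mul_left_comm]
      congr! 4
      split_ifs <;> simp
    · simp [hy]

lemma exists_minMass : ∃ m, 0 < m ∧ ∀ x, m ≤ D.mass x := by
  have : Nonempty (Fin N₀) := ⟨⟨0, lt_trans Nat.zero_lt_one D.one_lt⟩⟩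
  obtain ⟨i, hi⟩ := Finite.exists_min D.mass
  exact ⟨D.mass i, D.mass_pos i, hi⟩

lemma exists_formBound_opA : ∃ C, 0 ≤ C ∧ FormBound C D.opA D.mass := by
  obtain ⟨m, hm, hmass⟩ := D.exists_minMass
  set K := ∑ x, ∑ y, |D.opA x y| with hK
  have hK0 : 0 ≤ K := Finset.sum_nonneg fun _ _ => Finset.sum_nonneg fun _ _ => abs_nonneg _
  refine ⟨K / m, by positivity, fun f => ?_⟩
  have hsq : ∀ x, f x ^ 2 ≤ (∑ x, D.mass x * f x ^ 2) / m := by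
    intro x
    rw [le_div_iff₀ hm]
    calc f x ^ 2 * m ≤ D.mass x * f x ^ 2 := by nlinarith [hmass x, sq_nonneg (f x)]
      _ ≤ _ := Finset.single_le_sum (f := fun x => D.mass x * f x ^ 2)
        (fun y _ => mul_nonneg (D.mass_pos y).le (sq_nonneg _)) (Finset.mem_univ x)
  have h1 : ∀ x y, |f x * (D.opA x y * f y)| ≤
      |D.opA x y| * ((∑ x, D.mass x * f x ^ 2) / m) := by
    intro x y
    have h2 : |f x| * |f y| ≤ (∑ x, D.mass x * f x ^ 2) / m := by
      have := hsq x
      have := hsq y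
      nlinarith [sq_nonneg (|f x| - |f y|), sq_abs (f x), sq_abs (f y)]
    rw [abs_mul, abs_mul]
    nlinarith [abs_nonneg (D.opA x y)]
  have h3 : f ⬝ᵥ D.opA *ᵥ f = ∑ x, ∑ y, f x * (D.opA x y * f y) := by
    simp only [dotProduct, mulVec, Finset.mul_sum]
  rw [h3]
  calc _ ≤ ∑ x, ∑ y, |f x * (D.opA x y * f y)| :=
        (Finset.abs_sum_le_sum_abs _ _).trans
          (Finset.sum_le_sum fun x _ => Finset.abs_sum_le_sum_abs _ _)
    _ ≤ ∑ x, ∑ y, |D.opA x y| * ((∑ x, D.mass x * f x ^ 2) / m) :=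
        Finset.sum_le_sum fun x _ => Finset.sum_le_sum fun y _ => h1 x y
    _ = _ := by
        simp_rw [← Finset.sum_mul]
        ring

lemma dotProduct_baseA_mulVec (n : ℕ) (f : D.Vert n → ℝ) :
    f ⬝ᵥ D.baseA n *ᵥ f = ∑ i : Fin n → Fin N, (∏ k, D.wt (i k)) *
      ((f ∘ D.cell i) ⬝ᵥ D.opA *ᵥ (f ∘ D.cell i)) := by
  classical
  rw [baseA, sum_mulVec, dotProduct_sum]
  refine Finset.sum_congr rfl fun i _ => ?_
  rw [smul_mulVec, dotProduct_smul, smul_eq_mul, dotProduct_pushMat_mulVec]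

lemma sum_baseB_mul (n : ℕ) (f : D.Vert n → ℝ) :
    ∑ x, D.baseB n x * f x = ∑ i : Fin n → Fin N, (∏ k, D.wt (i k)) *
      ∑ u, D.mass u * f (D.cell i u) := by
  classical
  simp_rw [baseB, Finset.sum_mul]
  rw [Finset.sum_comm]
  refine Finset.sum_congr rfl fun i _ => ?_
  simp_rw [mul_assoc, ← Finset.mul_sum, Finset.sum_mul]
  congr 1
  rw [Finset.sum_comm]
  simp [ite_mul]

lemma exists_formBound : ∃ C, 0 ≤ C ∧ ∀ n, FormBound C (D.baseA n) (D.baseB n) := by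
  obtain ⟨C, hC0, hC⟩ := D.exists_formBound_opA
  refine ⟨C, hC0, fun n f => ?_⟩
  have hw : ∀ j : Fin n → Fin N, 0 < ∏ k, D.wt (j k) := fun j =>
    Finset.prod_pos fun k _ => D.wt_pos _
  rw [dotProduct_baseA_mulVec, D.sum_baseB_mul n fun x => f x ^ 2, Finset.mul_sum]
  refine (Finset.abs_sum_le_sum_abs _ _).trans (Finset.sum_le_sum fun i _ => ?_)
  rw [abs_mul, abs_of_pos (hw i), mul_left_comm]
  exact mul_le_mul_of_nonneg_left (hC _) (hw i).le

lemma im_dotProduct_pencil_mulVec (z : ℂ) (f : Fin N₀ → ℂ) :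
    (star f ⬝ᵥ D.pencil z *ᵥ f).im = z.im * ∑ x, D.mass x * ‖f x‖ ^ 2 := by
  have h1 : (star f ⬝ᵥ D.opA.map (fun r : ℝ => (r : ℂ)) *ᵥ f).im = 0 := by
    rw [← Complex.conj_eq_iff_im]
    have h2 : D.opA.map (fun r : ℝ => (r : ℂ)) *ᵥ star f =
        star (D.opA.map (fun r : ℝ => (r : ℂ)) *ᵥ f) := by
      ext x
      simp [mulVec, dotProduct]
    have h3 : (D.opA.map (fun r : ℝ => (r : ℂ)))ᵀ = D.opA.map (fun r : ℝ => (r : ℂ)) := by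
      rw [← transpose_map, D.opA_isSymm.eq]
    calc (starRingEnd ℂ) (star f ⬝ᵥ D.opA.map (fun r : ℝ => (r : ℂ)) *ᵥ f)
        = star (star f ⬝ᵥ D.opA.map (fun r : ℝ => (r : ℂ)) *ᵥ f) := rfl
      _ = star (D.opA.map (fun r : ℝ => (r : ℂ)) *ᵥ f) ⬝ᵥ f := by
        rw [← star_dotProduct_star, star_star]
      _ = _ := by
        rw [← h2, dotProduct_comm, dotProduct_mulVec, ← mulVec_transpose, h3,
          dotProduct_comm]
  have h4 : star f ⬝ᵥ (diagonal fun x => (D.mass x : ℂ)) *ᵥ f =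
      ((∑ x, D.mass x * ‖f x‖ ^ 2 : ℝ) : ℂ) := by
    rw [dotProduct]
    push_cast
    refine Finset.sum_congr rfl fun x _ => ?_
    rw [mulVec_diagonal, Pi.star_apply, mul_left_comm]
    congr 1
    exact Complex.conj_mul' _
  rw [pencil, add_mulVec, dotProduct_add, Complex.add_im, h1, smul_mulVec, dotProduct_smul, h4,
    smul_eq_mul, Complex.im_mul_ofReal, zero_add]

/-- Away from the real axis the matrices `A + z I_b` are coercive. -/
lemma exists_coer_pencil {z : ℂ} (hz : z.im ≠ 0) :
    ∃ (θ : ℂ) (δ : ℝ), ‖θ‖ ≤ 1 ∧ 0 < δ ∧ Coer θ δ (D.pencil z) := by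
  obtain ⟨m, hm, hmass⟩ := D.exists_minMass
  have hle : ∀ f : Fin N₀ → ℂ, m * ∑ x, ‖f x‖ ^ 2 ≤ ∑ x, D.mass x * ‖f x‖ ^ 2 := by
    intro f
    rw [Finset.mul_sum]
    exact Finset.sum_le_sum fun x _ => mul_le_mul_of_nonneg_right (hmass x) (by positivity)
  rcases lt_or_gt_of_ne hz with h | h
  · refine ⟨Complex.I, -z.im * m, by simp, mul_pos (by linarith) hm, fun f => ?_⟩
    rw [Complex.I_mul_re, D.im_dotProduct_pencil_mulVec]
    nlinarith [hle f]
  · refine ⟨-Complex.I, z.im * m, by simp, mul_pos h hm, fun f => ?_⟩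
    rw [neg_mul, Complex.neg_re, Complex.I_mul_re, D.im_dotProduct_pencil_mulVec]
    nlinarith [hle f]

end LatticeData

/-! ### The logarithmic potential in the plane -/

section LogPotential

/-- The second derivative in the direction `v`. -/
def secondDeriv (v : ℂ) (f : ℂ → ℝ) (z : ℂ) : ℝ := fderiv ℝ (fun w => fderiv ℝ f w v) z v

lemma ContDiff.fderiv_apply_const {f : ℂ → ℝ} (hf : ContDiff ℝ (⊤ : ℕ∞) f) (v : ℂ) :
    ContDiff ℝ (⊤ : ℕ∞) fun w => fderiv ℝ f w v :=
  (hf.fderiv_right (m := (⊤ : ℕ∞)) (by simp)).clm_apply contDiff_const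

lemma laplacian_eq_secondDeriv {f : ℂ → ℝ} (hf : ContDiff ℝ (⊤ : ℕ∞) f) (z : ℂ) :
    Laplacian.laplacian f z = secondDeriv 1 f z + secondDeriv Complex.I f z := by
  have h1 : DifferentiableAt ℝ (fderiv ℝ f) z :=
    ((hf.fderiv_right (m := (⊤ : ℕ∞)) (by simp)).differentiable (by simp)) z
  have h2 : ∀ v, secondDeriv v f z = iteratedFDeriv ℝ 2 f z ![v, v] := by
    intro v
    rw [secondDeriv, iteratedFDeriv_two_apply, fderiv_clm_apply h1 (by fun_prop)]
    simp
  rw [InnerProductSpace.laplacian_eq_iteratedFDeriv_complexPlane, h2, h2]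

lemma HasCompactSupport.fderiv_apply_const {f : ℂ → ℝ} (hf : HasCompactSupport f) (v : ℂ) :
    HasCompactSupport fun w => fderiv ℝ f w v :=
  hf.fderiv_apply (𝕜 := ℝ) v

/-- Two integrations by parts. -/
lemma integral_mul_secondDeriv {F ψ : ℂ → ℝ} (hF : ContDiff ℝ (⊤ : ℕ∞) F)
    (hψ : ContDiff ℝ (⊤ : ℕ∞) ψ) (hs : HasCompactSupport ψ) (v : ℂ) :
    ∫ z, F z * secondDeriv v ψ z = ∫ z, secondDeriv v F z * ψ z := by
  have hψ' := hψ.fderiv_apply_const v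
  have hF' := hF.fderiv_apply_const v
  have hs' := hs.fderiv_apply_const v
  have key : ∀ {f g : ℂ → ℝ}, ContDiff ℝ (⊤ : ℕ∞) f → ContDiff ℝ (⊤ : ℕ∞) g →
      HasCompactSupport g → ∫ z, f z * fderiv ℝ g z v = -∫ z, fderiv ℝ f z v * g z := by
    intro f g hf hg hsg
    have hfc := hf.continuous
    have hgc := hg.continuous
    have hf' := (hf.fderiv_apply_const v).continuous
    have hg' := (hg.fderiv_apply_const v).continuous
    refine integral_mul_fderiv_eq_neg_fderiv_mul_of_integrable ?_ ?_ ?_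
      (fun x _ => hf.differentiable (by simp) x) (fun x _ => hg.differentiable (by simp) x)
    · exact (hf'.mul hgc).integrable_of_hasCompactSupport hsg.mul_left
    · exact (hfc.mul hg').integrable_of_hasCompactSupport (hsg.fderiv_apply_const v).mul_left
    · exact (hfc.mul hgc).integrable_of_hasCompactSupport hsg.mul_left
  have h1 := key hF hψ' hs'
  have h2 := key hF' hψ hs
  simp only [secondDeriv]
  rw [h1, h2, neg_neg]

lemma ContDiff.secondDeriv {ψ : ℂ → ℝ} (hψ : ContDiff ℝ (⊤ : ℕ∞) ψ) (v : ℂ) :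
    ContDiff ℝ (⊤ : ℕ∞) (secondDeriv v ψ) :=
  (hψ.fderiv_apply_const v).fderiv_apply_const v

lemma HasCompactSupport.secondDeriv {ψ : ℂ → ℝ} (hs : HasCompactSupport ψ) (v : ℂ) :
    HasCompactSupport (secondDeriv v ψ) :=
  (hs.fderiv_apply_const v).fderiv_apply_const v

lemma integral_mul_laplacian {F ψ : ℂ → ℝ} (hF : ContDiff ℝ (⊤ : ℕ∞) F)
    (hψ : ContDiff ℝ (⊤ : ℕ∞) ψ) (hs : HasCompactSupport ψ) :
    ∫ z, F z * Laplacian.laplacian ψ z =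
      ∫ z, (secondDeriv 1 F z + secondDeriv Complex.I F z) * ψ z := by
  simp_rw [laplacian_eq_secondDeriv hψ, mul_add, add_mul]
  have i1 : ∀ v, Integrable fun z => F z * secondDeriv v ψ z := fun v =>
    (hF.continuous.mul (hψ.secondDeriv v).continuous).integrable_of_hasCompactSupport
      (hs.secondDeriv v).mul_left
  have i2 : ∀ v, Integrable fun z => secondDeriv v F z * ψ z := fun v =>
    ((hF.secondDeriv v).continuous.mul hψ.continuous).integrable_of_hasCompactSupport hs.mul_left
  rw [integral_add (i1 1) (i1 _), integral_add (i2 1) (i2 _), integral_mul_secondDeriv hF hψ hs,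
    integral_mul_secondDeriv hF hψ hs]

lemma ContDiff.continuous_laplacian {ψ : ℂ → ℝ} (hψ : ContDiff ℝ (⊤ : ℕ∞) ψ) :
    Continuous (Laplacian.laplacian ψ) := by
  rw [show Laplacian.laplacian ψ = fun z => _ from funext (laplacian_eq_secondDeriv hψ)]
  exact (hψ.secondDeriv 1).continuous.add (hψ.secondDeriv _).continuous

lemma HasCompactSupport.laplacian {ψ : ℂ → ℝ} (hs : HasCompactSupport ψ)
    (hψ : ContDiff ℝ (⊤ : ℕ∞) ψ) : HasCompactSupport (Laplacian.laplacian ψ) := by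
  rw [show Laplacian.laplacian ψ = fun z => _ from funext (laplacian_eq_secondDeriv hψ)]
  exact (hs.secondDeriv 1).add (hs.secondDeriv _)

lemma integral_laplacian {ψ : ℂ → ℝ} (hψ : ContDiff ℝ (⊤ : ℕ∞) ψ) (hs : HasCompactSupport ψ) :
    ∫ z, Laplacian.laplacian ψ z = 0 := by
  have h := integral_mul_laplacian (F := fun _ => 1) contDiff_const hψ hs
  simpa [secondDeriv] using h

/-- A smooth approximation of `log ‖z‖`. -/
def smoothLog (ε : ℝ) (z : ℂ) : ℝ := 2⁻¹ * Real.log (z.re ^ 2 + z.im ^ 2 + ε ^ 2)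

lemma smoothLog_arg_pos {ε : ℝ} (hε : 0 < ε) (z : ℂ) : 0 < z.re ^ 2 + z.im ^ 2 + ε ^ 2 := by
  positivity

lemma contDiff_re : ContDiff ℝ (⊤ : ℕ∞) Complex.re := Complex.reCLM.contDiff
lemma contDiff_im : ContDiff ℝ (⊤ : ℕ∞) Complex.im := Complex.imCLM.contDiff

lemma contDiff_smoothLog {ε : ℝ} (hε : 0 < ε) : ContDiff ℝ (⊤ : ℕ∞) (smoothLog ε) :=
  contDiff_const.mul ((((contDiff_re.pow 2).add (contDiff_im.pow 2)).add contDiff_const).log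
    fun z => (smoothLog_arg_pos hε z).ne')

/-- The Laplacian of `smoothLog ε` is an approximation of `2π` times the Dirac mass at `0`. -/
lemma secondDeriv_smoothLog {ε : ℝ} (hε : 0 < ε) (z : ℂ) :
    secondDeriv 1 (smoothLog ε) z + secondDeriv Complex.I (smoothLog ε) z =
      2 * ε ^ 2 / (z.re ^ 2 + z.im ^ 2 + ε ^ 2) ^ 2 := by
  have hre : ∀ w : ℂ, HasFDerivAt Complex.re Complex.reCLM w := fun w => Complex.reCLM.hasFDerivAt
  have him : ∀ w : ℂ, HasFDerivAt Complex.im Complex.imCLM w := fun w => Complex.imCLM.hasFDerivAt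
  have hq : ∀ w : ℂ, HasFDerivAt (fun w : ℂ => w.re ^ 2 + w.im ^ 2 + ε ^ 2) _ w := fun w =>
    (((hre w).pow 2).add ((him w).pow 2)).add_const (ε ^ 2)
  have hf : ∀ w v : ℂ, fderiv ℝ (smoothLog ε) w v =
      (w.re * v.re + w.im * v.im) * (w.re ^ 2 + w.im ^ 2 + ε ^ 2)⁻¹ := by
    intro w v
    have h1 : HasFDerivAt (smoothLog ε) _ w :=
      ((hq w).log (smoothLog_arg_pos hε w).ne').const_mul 2⁻¹
    rw [h1.fderiv]
    simp
    ring
  have hg : ∀ v : ℂ, secondDeriv v (smoothLog ε) z =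
      (v.re ^ 2 + v.im ^ 2) * (z.re ^ 2 + z.im ^ 2 + ε ^ 2)⁻¹ -
        2 * (z.re * v.re + z.im * v.im) ^ 2 * ((z.re ^ 2 + z.im ^ 2 + ε ^ 2) ^ 2)⁻¹ := by
    intro v
    rw [secondDeriv, show (fun w => fderiv ℝ (smoothLog ε) w v) = fun w => _ from
      funext fun w => hf w v]
    have h1 := ((((hre z).mul_const v.re).add ((him z).mul_const v.im)).mul
      ((hasDerivAt_inv (smoothLog_arg_pos hε z).ne').comp_hasFDerivAt z (hq z))).fderiv
    have h2 := congrArg (fun T : ℂ →L[ℝ] ℝ => T v) h1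
    refine Eq.trans h2 ?_
    simp
    ring
  have h0 := (smoothLog_arg_pos hε z).ne'
  rw [hg, hg]
  simp
  field_simp
  ring

lemma integral_two_div_one_add_norm_sq_sq :
    ∫ w : ℂ, 2 / (1 + ‖w‖ ^ 2) ^ 2 = 2 * Real.pi := by
  have h1 := integral_fun_norm_addHaar (volume : Measure ℂ) fun r : ℝ => 2 / (1 + r ^ 2) ^ 2
  rw [h1, Complex.finrank_real_complex]
  have hd : ∀ x ∈ Set.Ioi (0 : ℝ), HasDerivAt (fun y : ℝ => -(1 + y ^ 2)⁻¹)
      (x ^ (2 - 1) • (2 / (1 + x ^ 2) ^ 2)) x := by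
    intro x _
    have h2 := (((hasDerivAt_id x).pow 2).const_add 1).inv (by
      have : 0 < 1 + x ^ 2 := by positivity
      exact this.ne')
    have h3 := h2.neg
    simp only [id_eq] at h3
    refine h3.congr_deriv ?_
    simp
    ring
  have ht : Tendsto (fun y : ℝ => -(1 + y ^ 2)⁻¹) atTop (𝓝 0) := by
    rw [← neg_zero]
    refine (tendsto_inv_atTop_zero.comp ?_).neg
    exact tendsto_atTop_add_const_left _ _ (tendsto_pow_atTop (by norm_num))
  have hc : ContinuousWithinAt (fun y : ℝ => -(1 + y ^ 2)⁻¹) (Set.Ici 0) 0 := by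
    refine Continuous.continuousWithinAt ?_
    refine ((continuous_const.add (continuous_id.pow 2)).inv₀ fun y => ?_).neg
    have : 0 < 1 + y ^ 2 := by positivity
    exact this.ne'
  have h4 := integral_Ioi_of_hasDerivAt_of_nonneg hc hd (fun x hx => by
    have : (0 : ℝ) < x := hx
    positivity) ht
  rw [h4, measureReal_def, Complex.volume_ball]
  simp

/-- `|log |Im z||` dominates all the functions `log ‖z - t‖`, `t` real, near the real axis. -/
lemma abs_log_norm_sub_le {z : ℂ} (hz : z.im ≠ 0) (t : ℝ) :
    |Real.log ‖z - t‖| ≤ |Real.log z.im| + ‖z‖ + |t| := by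
  have h1 : |z.im| ≤ ‖z - t‖ := by
    have := Complex.abs_im_le_norm (z - t)
    simpa using this
  have h0 : 0 < |z.im| := abs_pos.2 hz
  have h2 := Real.log_le_log h0 h1
  rw [Real.log_abs] at h2
  have h3 : Real.log ‖z - t‖ ≤ ‖z - t‖ := (Real.log_le_sub_one_of_pos (h0.trans_le h1)).trans
    (by linarith)
  have h4 : ‖z - t‖ ≤ ‖z‖ + |t| := (norm_sub_le _ _).trans (by simp)
  have h5 := neg_abs_le (Real.log z.im)
  have h6 := abs_nonneg (Real.log z.im)
  have h7 := norm_nonneg z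
  have h8 := abs_nonneg t
  rw [abs_le]
  constructor <;> linarith

lemma ae_im_ne_zero : ∀ᵐ z : ℂ, z.im ≠ 0 := by
  have h := Measure.addHaar_submodule (volume : Measure ℂ) (LinearMap.ker Complex.imLm) (by
    intro h
    have : Complex.I ∈ LinearMap.ker Complex.imLm := h ▸ Submodule.mem_top
    simp at this)
  rw [ae_iff]
  convert h using 2
  ext z
  simp

lemma locallyIntegrable_log_abs_im : LocallyIntegrable fun z : ℂ => |Real.log z.im| := by
  rw [locallyIntegrable_iff]
  intro K hK
  obtain ⟨R, hR⟩ := hK.isBounded.subset_closedBall 0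
  set s : Set ℝ := Set.Icc (-R) R with hs
  have h1 : Integrable (fun p : ℝ × ℝ => (1 : ℝ) * |Real.log p.2|)
      ((volume.restrict s).prod (volume.restrict s)) := by
    refine Integrable.mul_prod (f := fun _ => (1 : ℝ)) (g := fun x => |Real.log x|) ?_ ?_
    · exact integrable_const _
    · refine Integrable.abs ?_
      rcases le_or_gt (-R) R with h | h
      · exact ((intervalIntegrable_iff_integrableOn_Icc_of_le h).1
          intervalIntegral.intervalIntegrable_log')
      · rw [hs, Set.Icc_eq_empty (not_le.2 h)]
        simp
  rw [Measure.prod_restrict] at h1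
  have h2 : IntegrableOn (fun p : ℝ × ℝ => |Real.log p.2|) (s ×ˢ s) := by
    rw [IntegrableOn, Measure.volume_eq_prod]
    simpa using h1
  have h3 := (Complex.volume_preserving_equiv_real_prod.integrableOn_comp_preimage
    Complex.measurableEquivRealProd.measurableEmbedding).2 h2
  refine h3.mono_set fun z hz => ?_
  have h4 : ‖z‖ ≤ R := by simpa using hR hz
  exact ⟨abs_le.1 ((Complex.abs_re_le_norm z).trans h4),
    abs_le.1 ((Complex.abs_im_le_norm z).trans h4)⟩

lemma measurable_log_norm_sub (t : ℝ) : Measurable fun z : ℂ => Real.log ‖z - t‖ := by fun_prop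

/-- `(2π)⁻¹ log ‖z‖` is a fundamental solution of the Laplace equation. -/
lemma integral_log_norm_mul_laplacian {ψ : ℂ → ℝ} (hψ : ContDiff ℝ (⊤ : ℕ∞) ψ)
    (hs : HasCompactSupport ψ) :
    ∫ z : ℂ, Real.log ‖z‖ * Laplacian.laplacian ψ z = 2 * Real.pi * ψ 0 := by
  have hψc := hψ.continuous
  have hlc := hψ.continuous_laplacian
  have hls := hs.laplacian hψ
  set ε : ℕ → ℝ := fun n => 1 / ((n : ℝ) + 1) with hε
  have hε0 : ∀ n, 0 < ε n := fun n => by positivity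
  have hε1 : ∀ n, ε n ≤ 1 := fun n => by
    rw [hε]
    exact (div_le_one (by positivity)).2 (by linarith [n.cast_nonneg (α := ℝ)])
  have hεt : Tendsto ε atTop (𝓝 0) := tendsto_one_div_add_atTop_nhds_zero_nat
  obtain ⟨M, hM⟩ := hs.exists_bound_of_continuous hψc
  -- the limit of the smoothed potentials
  have h1 : Tendsto (fun n => ∫ z, smoothLog (ε n) z * Laplacian.laplacian ψ z) atTop
      (𝓝 (∫ z : ℂ, Real.log ‖z‖ * Laplacian.laplacian ψ z)) := by
    refine tendsto_integral_of_dominated_convergence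
      (fun z => (|Real.log z.im| + ‖z‖ + 1) * |Laplacian.laplacian ψ z|) ?_ ?_ ?_ ?_
    · intro n
      exact ((contDiff_smoothLog (hε0 n)).continuous.mul hlc).aestronglyMeasurable
    · have h2 : LocallyIntegrable fun z : ℂ => |Real.log z.im| + ‖z‖ + 1 := by
        have : Continuous fun z : ℂ => ‖z‖ + 1 := by fun_prop
        have h3 := locallyIntegrable_log_abs_im.add this.locallyIntegrable
        refine h3.congr ?_
        filter_upwards with z
        simp [add_assoc]
      have h3 := h2.integrable_smul_left_of_hasCompactSupport
        (continuous_abs.comp hlc) (hls.comp_left (g := fun x : ℝ => |x|) abs_zero)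
      refine h3.congr ?_
      filter_upwards with z
      simp [mul_comm]
    · intro n
      filter_upwards [ae_im_ne_zero] with z hz
      rw [norm_mul, Real.norm_eq_abs, Real.norm_eq_abs]
      refine mul_le_mul_of_nonneg_right ?_ (abs_nonneg _)
      have h0 : 0 < |z.im| := abs_pos.2 hz
      have hn := norm_nonneg z
      have h2 : |z.im| ^ 2 ≤ z.re ^ 2 + z.im ^ 2 + ε n ^ 2 := by
        rw [sq_abs]; nlinarith [sq_nonneg z.re, sq_nonneg (ε n)]
      have h3 := Real.log_le_log (by positivity) h2
      rw [Real.log_pow, Real.log_abs] at h3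
      have h4 : z.re ^ 2 + z.im ^ 2 + ε n ^ 2 ≤ (‖z‖ + 1) ^ 2 := by
        have : z.re ^ 2 + z.im ^ 2 = ‖z‖ ^ 2 := by
          rw [Complex.sq_norm, Complex.normSq_apply]; ring
        nlinarith [hε0 n, hε1 n]
      have h5 := Real.log_le_log (smoothLog_arg_pos (hε0 n) z) h4
      rw [Real.log_pow] at h5
      have h6 := Real.log_le_sub_one_of_pos (show 0 < ‖z‖ + 1 by positivity)
      have h7 := neg_abs_le (Real.log z.im)
      have h8 := abs_nonneg (Real.log z.im)
      push_cast at h3 h5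
      rw [smoothLog, abs_le]
      constructor <;> linarith
    · filter_upwards [ae_im_ne_zero] with z hz
      refine Tendsto.mul_const _ ?_
      have h0 : 0 < z.re ^ 2 + z.im ^ 2 + 0 ^ 2 := by positivity
      have h2 : Real.log ‖z‖ = 2⁻¹ * Real.log (z.re ^ 2 + z.im ^ 2 + 0 ^ 2) := by
        have : z.re ^ 2 + z.im ^ 2 + 0 ^ 2 = ‖z‖ ^ 2 := by
          rw [Complex.sq_norm, Complex.normSq_apply]; ring
        rw [this, Real.log_pow]
        push_cast
        ring
      rw [h2]
      exact ((Real.continuousAt_log h0.ne').tendsto.comp ((hεt.pow 2).const_add _)).const_mul _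
  -- the same integrals, after integration by parts and scaling
  have h2 : ∀ n, ∫ z, smoothLog (ε n) z * Laplacian.laplacian ψ z =
      ∫ w : ℂ, 2 / (1 + ‖w‖ ^ 2) ^ 2 * ψ (ε n • w) := by
    intro n
    have h0 := hε0 n
    rw [integral_mul_laplacian (contDiff_smoothLog h0) hψ hs]
    simp_rw [secondDeriv_smoothLog h0]
    have h3 := Measure.integral_comp_smul (volume : Measure ℂ)
      (fun z : ℂ => 2 * ε n ^ 2 / (z.re ^ 2 + z.im ^ 2 + ε n ^ 2) ^ 2 * ψ z) (ε n)
    rw [Complex.finrank_real_complex, abs_of_pos (by positivity), eq_comm, smul_eq_mul,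
      inv_mul_eq_iff_eq_mul₀ (by positivity), ← integral_const_mul] at h3
    rw [h3]
    refine integral_congr_ae (Eventually.of_forall fun w => ?_)
    have h4 : ‖w‖ ^ 2 = w.re ^ 2 + w.im ^ 2 := by
      rw [Complex.sq_norm, Complex.normSq_apply]; ring
    have h5 : 0 < 1 + (w.re ^ 2 + w.im ^ 2) := by positivity
    have h6 : 0 < (ε n * w.re) ^ 2 + (ε n * w.im) ^ 2 + ε n ^ 2 := by positivity
    simp only [h4, Complex.real_smul, Complex.mul_re, Complex.mul_im, Complex.ofReal_re,
      Complex.ofReal_im, zero_mul, sub_zero, add_zero]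
    rw [← mul_assoc]
    congr 1
    rw [show (ε n * w.re) ^ 2 + (ε n * w.im) ^ 2 + ε n ^ 2 =
      ε n ^ 2 * (1 + (w.re ^ 2 + w.im ^ 2)) by ring]
    field_simp
  have h3 : Tendsto (fun n => ∫ w : ℂ, 2 / (1 + ‖w‖ ^ 2) ^ 2 * ψ (ε n • w)) atTop
      (𝓝 (∫ w : ℂ, 2 / (1 + ‖w‖ ^ 2) ^ 2 * ψ 0)) := by
    have hc : Continuous fun w : ℂ => 2 / (1 + ‖w‖ ^ 2) ^ 2 := by
      refine continuous_const.div (by fun_prop) fun w => by positivity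
    refine tendsto_integral_of_dominated_convergence (fun w => 2 / (1 + ‖w‖ ^ 2) ^ 2 * M) ?_ ?_ ?_ ?_
    · intro n
      exact (hc.mul (hψc.comp (continuous_const_smul _))).aestronglyMeasurable
    · have h4 := integrable_rpow_neg_one_add_norm_sq (E := ℂ) (μ := volume) (r := 4)
        (by rw [Complex.finrank_real_complex]; norm_num)
      refine ((h4.const_mul 2).mul_const M).congr ?_
      filter_upwards with w
      rw [show (-4 : ℝ) / 2 = -((2 : ℕ) : ℝ) by norm_num, Real.rpow_neg (by positivity),
        Real.rpow_natCast, div_eq_mul_inv]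
    · intro n
      filter_upwards with w
      rw [norm_mul, Real.norm_of_nonneg (by positivity)]
      exact mul_le_mul_of_nonneg_left (hM _) (by positivity)
    · filter_upwards with w
      refine Tendsto.const_mul _ ?_
      have h4 : Tendsto (fun n => ε n • w) atTop (𝓝 0) := by
        simpa using hεt.smul_const w
      exact (hψc.tendsto 0).comp h4
  simp_rw [h2] at h1
  rw [tendsto_nhds_unique h1 h3, integral_mul_const, integral_two_div_one_add_norm_sq_sq]

lemma laplacian_comp_add {ψ : ℂ → ℝ} (hψ : ContDiff ℝ (⊤ : ℕ∞) ψ) (t z : ℂ) :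
    Laplacian.laplacian (fun w => ψ (w + t)) z = Laplacian.laplacian ψ (z + t) := by
  have h : ContDiff ℝ (⊤ : ℕ∞) fun w => ψ (w + t) := hψ.comp (contDiff_id.add contDiff_const)
  rw [laplacian_eq_secondDeriv h, laplacian_eq_secondDeriv hψ]
  simp only [secondDeriv, fderiv_comp_add_right]
  rw [fderiv_comp_add_right (f := fun w => fderiv ℝ ψ w 1),
    fderiv_comp_add_right (f := fun w => fderiv ℝ ψ w Complex.I)]

lemma integral_log_norm_sub_mul_laplacian {ψ : ℂ → ℝ} (hψ : ContDiff ℝ (⊤ : ℕ∞) ψ)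
    (hs : HasCompactSupport ψ) (t : ℂ) :
    ∫ z : ℂ, Real.log ‖z - t‖ * Laplacian.laplacian ψ z = 2 * Real.pi * ψ t := by
  have h1 := integral_log_norm_mul_laplacian (ψ := fun w => ψ (w + t))
    (hψ.comp (contDiff_id.add contDiff_const))
    (hs.comp_homeomorph (Homeomorph.addRight t))
  rw [zero_add] at h1
  rw [← h1, ← integral_add_right_eq_self _ t]
  simp_rw [laplacian_comp_add hψ, add_sub_cancel_right]

end LogPotential

/-! ### Convergence of empirical measures from convergence of logarithmic potentials -/

section Potentials

/-- If the logarithmic potentials of finite sums of Dirac masses on the real line converge off the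
real line, then these sums converge, as distributions on the plane, to `(2π)⁻¹` times the
Laplacian of the limit. -/
theorem tendsto_sum_of_tendsto_log {ι : ℕ → Type} [∀ n, Fintype (ι n)] (e : ∀ n, ι n → ℝ)
    {C K : ℝ} {L : ℕ → ℝ} (hL : ∀ n, 0 < L n) (he : ∀ n j, |e n j| ≤ C)
    (hcard : ∀ n, (Fintype.card (ι n) : ℝ) ≤ K * L n) (c : ℕ → ℝ) {g : ℂ → ℝ}
    (hg : ∀ z : ℂ, z.im ≠ 0 → Tendsto (fun n => (L n)⁻¹ *
      (c n + ∑ j, Real.log ‖z - e n j‖)) atTop (𝓝 (g z))) :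
    LocallyIntegrable g ∧ ∀ ψ : ℂ → ℝ, ContDiff ℝ (⊤ : ℕ∞) ψ → HasCompactSupport ψ →
      Tendsto (fun n => (L n)⁻¹ * ∑ j, ψ (e n j)) atTop
        (𝓝 ((2 * Real.pi)⁻¹ * ∫ z, g z * Laplacian.laplacian ψ z)) := by
  have hsum : ∀ n (z : ℂ), z.im ≠ 0 → |(L n)⁻¹ * ∑ j, Real.log ‖z - e n j‖| ≤
      K * (|Real.log z.im| + ‖z‖ + |C|) := by
    intro n z hz
    rw [abs_mul, abs_of_pos (inv_pos.2 (hL n)), inv_mul_le_iff₀ (hL n)]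
    have h0 : 0 ≤ |Real.log z.im| + ‖z‖ + |C| := by positivity
    calc |∑ j, Real.log ‖z - e n j‖| ≤ ∑ j, |Real.log ‖z - e n j‖| :=
          Finset.abs_sum_le_sum_abs _ _
      _ ≤ ∑ _j : ι n, (|Real.log z.im| + ‖z‖ + |C|) := by
          refine Finset.sum_le_sum fun j _ => (abs_log_norm_sub_le hz _).trans ?_
          have := (he n j).trans (le_abs_self C)
          linarith
      _ = Fintype.card (ι n) * (|Real.log z.im| + ‖z‖ + |C|) := by
          rw [Finset.sum_const, nsmul_eq_mul, Finset.card_univ]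
      _ ≤ K * L n * (|Real.log z.im| + ‖z‖ + |C|) := mul_le_mul_of_nonneg_right (hcard n) h0
      _ = _ := by ring
  -- the additive constants are bounded, because the potentials converge at `I`
  obtain ⟨B, hB⟩ : ∃ B, ∀ n, |(L n)⁻¹ * c n| ≤ B := by
    obtain ⟨B, hB⟩ := (hg Complex.I (by simp)).norm.bddAbove_range
    refine ⟨B + K * (|Real.log (Complex.I).im| + ‖Complex.I‖ + |C|), fun n => ?_⟩
    have h1 : ‖(L n)⁻¹ * (c n + ∑ j, Real.log ‖Complex.I - e n j‖)‖ ≤ B := hB ⟨n, rfl⟩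
    have h2 := hsum n Complex.I (by simp)
    rw [mul_add, Real.norm_eq_abs] at h1
    have h3 := abs_sub_abs_le_abs_sub ((L n)⁻¹ * c n) (-((L n)⁻¹ * ∑ j, Real.log ‖Complex.I - e n j‖))
    rw [abs_neg, sub_neg_eq_add] at h3
    linarith
  set q : ℕ → ℂ → ℝ := fun n z => (L n)⁻¹ * (c n + ∑ j, Real.log ‖z - e n j‖) with hq
  set M : ℂ → ℝ := fun z => B + K * (|Real.log z.im| + ‖z‖ + |C|) with hM
  have hqM : ∀ n (z : ℂ), z.im ≠ 0 → |q n z| ≤ M z := by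
    intro n z hz
    simp only [hq, mul_add, hM]
    have := abs_add_le ((L n)⁻¹ * c n) ((L n)⁻¹ * ∑ j, Real.log ‖z - e n j‖)
    have := hsum n z hz
    have := hB n
    linarith
  have hMi : LocallyIntegrable M := by
    have h1 : Continuous fun z : ℂ => B + K * (‖z‖ + |C|) := by fun_prop
    have h3 : LocallyIntegrable fun z : ℂ => K * |Real.log z.im| :=
      locallyIntegrable_log_abs_im.smul K
    refine (h1.locallyIntegrable.add h3).congr ?_
    filter_upwards with z
    simp only [Pi.add_apply, hM]
    ring
  have hqm : ∀ n, Measurable (q n) := fun n => by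
    refine (measurable_const.add ?_).const_mul _
    exact Finset.measurable_sum _ fun j _ => measurable_log_norm_sub _
  have hgm : AEStronglyMeasurable g volume := by
    refine aestronglyMeasurable_of_tendsto_ae atTop (fun n => (hqm n).aestronglyMeasurable) ?_
    filter_upwards [ae_im_ne_zero] with z hz using hg z hz
  have hgi : LocallyIntegrable g := by
    refine hMi.mono hgm ?_
    filter_upwards [ae_im_ne_zero] with z hz
    have h1 : |g z| ≤ M z := le_of_tendsto' (hg z hz).abs fun n => hqM n z hz
    exact h1.trans (le_abs_self _)
  refine ⟨hgi, fun ψ hψ hs => ?_⟩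
  have hlc := hψ.continuous_laplacian
  have hls := hs.laplacian hψ
  have h1 : Tendsto (fun n => ∫ z, q n z * Laplacian.laplacian ψ z) atTop
      (𝓝 (∫ z, g z * Laplacian.laplacian ψ z)) := by
    refine tendsto_integral_of_dominated_convergence
      (fun z => M z * |Laplacian.laplacian ψ z|) ?_ ?_ ?_ ?_
    · intro n
      exact (hqm n).aestronglyMeasurable.mul hlc.aestronglyMeasurable
    · have h3 := hMi.integrable_smul_left_of_hasCompactSupport
        (continuous_abs.comp hlc) (hls.comp_left (g := fun x : ℝ => |x|) abs_zero)
      refine h3.congr ?_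
      filter_upwards with z
      simp [mul_comm]
    · intro n
      filter_upwards [ae_im_ne_zero] with z hz
      rw [norm_mul, Real.norm_eq_abs, Real.norm_eq_abs]
      exact mul_le_mul_of_nonneg_right (hqM n z hz) (abs_nonneg _)
    · filter_upwards [ae_im_ne_zero] with z hz
      exact (hg z hz).mul_const _
  have hli : ∀ t : ℝ, Integrable fun z : ℂ => Real.log ‖z - t‖ * Laplacian.laplacian ψ z := by
    intro t
    have h2 : LocallyIntegrable fun z : ℂ => Real.log ‖z - t‖ := by
      have h3 : Continuous fun z : ℂ => ‖z‖ + |t| := by fun_prop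
      refine (locallyIntegrable_log_abs_im.add h3.locallyIntegrable).mono
        (measurable_log_norm_sub t).aestronglyMeasurable ?_
      filter_upwards [ae_im_ne_zero] with z hz
      refine (abs_log_norm_sub_le hz t).trans ((le_abs_self _).trans (le_of_eq ?_))
      simp [add_assoc]
    refine (h2.integrable_smul_left_of_hasCompactSupport hlc hls).congr ?_
    filter_upwards with z
    simp [mul_comm]
  have h2 : ∀ n, ∫ z, q n z * Laplacian.laplacian ψ z =
      2 * Real.pi * ((L n)⁻¹ * ∑ j, ψ (e n j)) := by
    intro n
    have h3 : ∀ z, q n z * Laplacian.laplacian ψ z =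
        (L n)⁻¹ * c n * Laplacian.laplacian ψ z +
          (L n)⁻¹ * ∑ j, Real.log ‖z - e n j‖ * Laplacian.laplacian ψ z := by
      intro z
      simp only [hq, ← Finset.sum_mul]
      ring
    simp_rw [h3]
    rw [integral_add, integral_const_mul, integral_const_mul, integral_finsetSum,
      integral_laplacian hψ hs]
    · simp_rw [integral_log_norm_sub_mul_laplacian hψ hs, ← Finset.mul_sum]
      ring
    · exact fun j _ => hli _
    · exact (hlc.integrable_of_hasCompactSupport hls).const_mul _
    · exact (integrable_finsetSum _ fun j _ => hli _).const_mul _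
  simp_rw [h2] at h1
  have h3 := h1.const_mul (2 * Real.pi)⁻¹
  refine h3.congr fun n => ?_
  rw [← mul_assoc, inv_mul_cancel₀ (by positivity), one_mul]

end Potentials

/-! ### Weak limits of measures on a compact interval -/

section WeakLimits

/-- On a compact interval, the integral of a bounded continuous function is approximated by the
integral of the restriction to the real line of a test function on the plane. -/
lemma exists_test_near (C : ℝ) (f : BoundedContinuousFunction ℝ ℝ) {ε : ℝ} (hε : 0 < ε) :
    ∃ ψ : ℂ → ℝ, ContDiff ℝ (⊤ : ℕ∞) ψ ∧ HasCompactSupport ψ ∧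
      ∀ t ∈ Set.Icc (-C) C, |ψ (t : ℂ) - f t| ≤ ε := by
  obtain ⟨p, hp⟩ := exists_polynomial_near_of_continuousOn (-C) C f f.continuous.continuousOn ε hε
  let χ : ContDiffBump (0 : ℂ) := ⟨|C| + 1, |C| + 2, by positivity, by linarith⟩
  refine ⟨fun z => p.eval z.re * χ z, ?_, ?_, fun t ht => ?_⟩
  · have h1 : ContDiff ℝ (⊤ : ℕ∞) fun x : ℝ => p.eval x := by
      simpa using Polynomial.contDiff_aeval (𝕜 := ℝ) p (⊤ : ℕ∞)
    exact (h1.comp contDiff_re).mul χ.contDiff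
  · exact χ.hasCompactSupport.mul_left
  · have h1 : χ (t : ℂ) = 1 := by
      refine χ.one_of_mem_closedBall ?_
      rw [mem_closedBall_zero_iff, Complex.norm_real, Real.norm_eq_abs]
      have : |t| ≤ |C| := (abs_le.2 ht).trans (le_abs_self C)
      change |t| ≤ |C| + 1
      linarith
    simp only [h1, mul_one, Complex.ofReal_re]
    exact (hp t ht).le

/-- Measures on a compact interval only see the values of functions there. -/
lemma abs_integral_sub_le {C ε : ℝ} {K : ℝ≥0} {f h : ℝ → ℝ} (hf : Continuous f)
    (hh : Continuous h) (hfh : ∀ t ∈ Set.Icc (-C) C, |h t - f t| ≤ ε) (hε : 0 ≤ ε)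
    {μ : FiniteMeasure ℝ} (hm : μ.mass ≤ K) (hμ : μ (Set.Icc (-C) C)ᶜ = 0) :
    |∫ t, h t ∂(μ : Measure ℝ) - ∫ t, f t ∂(μ : Measure ℝ)| ≤ ε * K := by
  have h0 : (μ : Measure ℝ) (Set.Icc (-C) C)ᶜ = 0 := (μ.null_iff_toMeasure_null _).1 hμ
  have hae : ∀ᵐ t ∂(μ : Measure ℝ), t ∈ Set.Icc (-C) C := h0
  have hi : ∀ g : ℝ → ℝ, Continuous g → Integrable g (μ : Measure ℝ) := by
    intro g hg
    obtain ⟨M, hM⟩ := isCompact_Icc.exists_bound_of_continuousOn (s := Set.Icc (-C) C)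
      hg.continuousOn
    exact Integrable.of_bound hg.aestronglyMeasurable M (hae.mono fun t ht => hM t ht)
  rw [← integral_sub (hi _ hh) (hi _ hf), ← Real.norm_eq_abs]
  refine (norm_integral_le_of_norm_le_const (hae.mono fun t ht => hfh t ht)).trans ?_
  refine mul_le_mul_of_nonneg_left ?_ hε
  rw [FiniteMeasure.measureReal_eq_coe_coeFn]
  exact_mod_cast hm

/-- Measures carried by a fixed compact interval converge weakly as soon as their integrals
against the test functions on the plane converge. -/
lemma tendsto_of_tendsto_integral_test {C : ℝ} {K : ℝ≥0} {σ : ℕ → FiniteMeasure ℝ}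
    {μ : FiniteMeasure ℝ} (hm : ∀ n, (σ n).mass ≤ K) (hσ : ∀ n, σ n (Set.Icc (-C) C)ᶜ = 0)
    (hm' : μ.mass ≤ K) (hμ : μ (Set.Icc (-C) C)ᶜ = 0)
    (h : ∀ ψ : ℂ → ℝ, ContDiff ℝ (⊤ : ℕ∞) ψ → HasCompactSupport ψ →
      Tendsto (fun n => ∫ t : ℝ, ψ t ∂(σ n : Measure ℝ)) atTop
        (𝓝 (∫ t : ℝ, ψ t ∂(μ : Measure ℝ)))) : Tendsto σ atTop (𝓝 μ) := by
  rw [FiniteMeasure.tendsto_iff_forall_integral_tendsto]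
  intro f
  rw [Metric.tendsto_atTop]
  intro ε hε
  set δ := ε / (3 * (K + 1)) with hδ
  have hδ0 : 0 < δ := by positivity
  have hδK : δ * K < ε / 3 := by
    rw [hδ, div_mul_eq_mul_div, div_lt_div_iff₀ (by positivity) (by norm_num)]
    nlinarith [K.coe_nonneg]
  obtain ⟨ψ, h1, h2, h3⟩ := exists_test_near C f hδ0
  have hψc : Continuous fun t : ℝ => ψ t := h1.continuous.comp Complex.continuous_ofReal
  obtain ⟨n₀, hn₀⟩ := Metric.tendsto_atTop.1 (h ψ h1 h2) (ε / 3) (by positivity)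
  refine ⟨n₀, fun n hn => ?_⟩
  have h4 := hn₀ n hn
  have h5 := abs_integral_sub_le f.continuous hψc h3 hδ0.le (hm n) (hσ n)
  have h6 := abs_integral_sub_le f.continuous hψc h3 hδ0.le hm' hμ
  rw [Real.dist_eq] at h4 ⊢
  rw [abs_le] at h5 h6
  rw [abs_lt] at h4 ⊢
  constructor <;> linarith [h5.1, h5.2, h6.1, h6.2, h4.1, h4.2]

/-- By compactness, the limit of the integrals against test functions is the integral for some
measure. -/
lemma exists_finiteMeasure_of_tendsto {C : ℝ} {K : ℝ≥0} {σ : ℕ → FiniteMeasure ℝ}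
    (hm : ∀ n, (σ n).mass ≤ K) (hσ : ∀ n, σ n (Set.Icc (-C) C)ᶜ = 0) {Λ : (ℂ → ℝ) → ℝ}
    (h : ∀ ψ : ℂ → ℝ, ContDiff ℝ (⊤ : ℕ∞) ψ → HasCompactSupport ψ →
      Tendsto (fun n => ∫ t : ℝ, ψ t ∂(σ n : Measure ℝ)) atTop (𝓝 (Λ ψ))) :
    ∃ μ : FiniteMeasure ℝ, μ.mass ≤ K ∧ μ (Set.Icc (-C) C)ᶜ = 0 ∧
      ∀ ψ : ℂ → ℝ, ContDiff ℝ (⊤ : ℕ∞) ψ → HasCompactSupport ψ →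
        ∫ t : ℝ, ψ t ∂(μ : Measure ℝ) = Λ ψ := by
  obtain ⟨μ, ⟨h1, h2⟩, h3⟩ := (isCompact_setOfPred_finiteMeasure_le_of_isCompact K
    (isCompact_Icc (a := -C) (b := C))).exists_mapClusterPt (f := atTop) (u := σ)
    (tendsto_principal.2 (Eventually.of_forall fun n => ⟨hm n, hσ n⟩))
  refine ⟨μ, h1, h2, fun ψ hψ hs => ?_⟩
  obtain ⟨M, hM⟩ := hs.exists_bound_of_continuous hψ.continuous
  let f : BoundedContinuousFunction ℝ ℝ := BoundedContinuousFunction.ofNormedAddCommGroup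
    (fun t : ℝ => ψ t) (hψ.continuous.comp Complex.continuous_ofReal) M fun t => hM _
  have h4 := h3.continuousAt_comp
    (FiniteMeasure.continuous_integral_boundedContinuousFunction f).continuousAt
  have h5 : ClusterPt (∫ t : ℝ, ψ t ∂(μ : Measure ℝ)) (𝓝 (Λ ψ)) :=
    ClusterPt.mono h4 (h ψ hψ hs)
  exact eq_of_nhds_neBot h5

end WeakLimits

/-! ### The density of states -/

section EmpiricalMeasures

variable {ι : Type} [Fintype ι] (c : ℝ≥0) (e : ι → ℝ)

lemma sum_map_diracAt {s : Multiset ℝ} (h : s = Finset.univ.val.map e) :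
    (s.map LatticeData.diracAt).sum = ∑ j, LatticeData.diracAt (e j) := by
  rw [h, Multiset.map_map]
  rfl

lemma toMeasure_smul_sum_diracAt : ((c • ∑ j, LatticeData.diracAt (e j) : FiniteMeasure ℝ) :
    Measure ℝ) = c • ∑ j, Measure.dirac (e j) := by
  rw [FiniteMeasure.toMeasure_smul, FiniteMeasure.toMeasure_sum]
  rfl

lemma integral_smul_sum_diracAt (f : ℝ → ℝ) :
    ∫ t, f t ∂((c • ∑ j, LatticeData.diracAt (e j) : FiniteMeasure ℝ) : Measure ℝ) =
      c * ∑ j, f (e j) := by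
  rw [toMeasure_smul_sum_diracAt, integral_smul_nnreal_measure, integral_finsetSum_measure]
  · simp [NNReal.smul_def]
  · intro j _
    exact integrable_dirac (by simp)

lemma smul_sum_diracAt_apply {s : Set ℝ} (hs : ∀ j, e j ∉ s) (hm : MeasurableSet s) :
    (c • ∑ j, LatticeData.diracAt (e j) : FiniteMeasure ℝ) s = 0 := by
  rw [FiniteMeasure.null_iff_toMeasure_null, toMeasure_smul_sum_diracAt]
  simp [Measure.dirac_apply' _ hm, hs]

lemma mass_smul_sum_diracAt : (c • ∑ j, LatticeData.diracAt (e j) : FiniteMeasure ℝ).mass =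
    c * Fintype.card ι := by
  have h : ((c • ∑ j, LatticeData.diracAt (e j) : FiniteMeasure ℝ).mass : ℝ≥0∞) =
      ((c * Fintype.card ι : ℝ≥0) : ℝ≥0∞) := by
    rw [FiniteMeasure.ennreal_mass, toMeasure_smul_sum_diracAt]
    rw [Measure.smul_apply, Measure.finsetSum_apply, ENNReal.smul_def, smul_eq_mul]
    simp
  exact_mod_cast h

end EmpiricalMeasures

namespace LatticeData

variable {N N₀ : ℕ} {Γ : Type*} [Group Γ] (D : LatticeData N N₀ Γ)

open Matrix

lemma card_inner_le (n : ℕ) [Fintype (D.Inner n)] : Fintype.card (D.Inner n) ≤ N ^ n * N₀ := by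
  classical
  refine le_trans ?_ (D.card_vert_le n)
  exact Fintype.card_le_of_injective _ Subtype.val_injective

open Classical in
/-- The eigenvalues of `H_n⁺`: they are bounded and they determine the Neumann determinants. -/
lemma exists_eigenvalues_plus : ∃ (C : ℝ) (e : ∀ n, D.Vert n → ℝ), (∀ n j, |e n j| ≤ C) ∧
    (∀ ω n, (D.hPlus ω n).charpoly.roots = Finset.univ.val.map (e n)) ∧
    (∀ n t, Module.finrank ℝ (LinearMap.ker (toLin' (D.baseA n + t • diagonal (D.baseB n)))) =
      Fintype.card {x // e n x = t}) ∧
    ∀ n (z : ℂ), (D.glueMat n (D.pencil z)).det =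
      (∏ x, (D.baseB n x : ℂ)) * ∏ x, (z - e n x) := by
  obtain ⟨C, -, hC⟩ := D.exists_formBound
  choose e h1 h2 h3 h4 h5 using fun n => exists_eigenvalues (D.baseA_isSymm n) (D.baseB_pos n)
  refine ⟨C, e, fun n => h4 n C (hC n), fun ω n => ?_, h3, fun n z => ?_⟩
  · rw [D.hPlus_eq]
    exact h1 n
  · rw [D.glueMat_pencil]
    exact h2 n z

open Classical in
/-- The eigenvalues of `H_n⁻`: they are bounded and they determine the Dirichlet determinants. -/
lemma exists_eigenvalues_minus : ∃ (C : ℝ) (e : ∀ n, D.Inner n → ℝ), (∀ n j, |e n j| ≤ C) ∧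
    (∀ ω n, (D.hMinus ω n).charpoly.roots = Finset.univ.val.map (e n)) ∧
    (∀ n t, Module.finrank ℝ (LinearMap.ker (toLin'
      ((D.baseA n).submatrix (Subtype.val : D.Inner n → _) Subtype.val +
        t • diagonal (D.baseB n ∘ Subtype.val)))) = Fintype.card {x // e n x = t}) ∧
    (∀ n (z : ℂ), ((D.glueMat n (D.pencil z)).submatrix (Subtype.val : D.Inner n → _)
      Subtype.val).det = (∏ x : D.Inner n, (D.baseB n x.1 : ℂ)) * ∏ x, (z - e n x)) ∧
    ∀ n (t : ℝ) (H : Matrix (D.Inner n) (D.Inner n) ℂ), ∃ r : ℂ → ℂ, Continuous r ∧ ∀ s : ℂ,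
      ((D.glueMat n (D.pencil t)).submatrix (Subtype.val : D.Inner n → _) Subtype.val +
        s • H).det = s ^ Fintype.card {x // e n x = t} * r s := by
  obtain ⟨C, -, hC⟩ := D.exists_formBound
  choose e h1 h2 h3 h4 h5 using fun n => exists_eigenvalues
    (A := (D.baseA n).submatrix (Subtype.val : D.Inner n → _) Subtype.val)
    ((D.baseA_isSymm n).submatrix _) (b := D.baseB n ∘ Subtype.val) fun x => D.baseB_pos n x.1
  have h6 : ∀ n (z : ℂ), (D.glueMat n (D.pencil z)).submatrix (Subtype.val : D.Inner n → _)
      Subtype.val = ((D.baseA n).submatrix (Subtype.val : D.Inner n → _) Subtype.val).map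
        (fun r : ℝ => (r : ℂ)) + z • diagonal fun x : D.Inner n => (D.baseB n x.1 : ℂ) := by
    intro n z
    ext x y
    rw [D.glueMat_pencil]
    by_cases h : x = y
    · subst h
      simp
    · have : x.1 ≠ y.1 := fun h' => h (Subtype.ext h')
      simp [h, this]
  refine ⟨C, e, fun n => h4 n C ((hC n).submatrix Subtype.val_injective), fun ω n => ?_, h3,
    fun n z => ?_, fun n t H => ?_⟩
  · rw [D.hMinus_eq]
    exact h1 n
  · rw [h6]
    exact h2 n z
  · rw [h6]
    exact h5 n t H

lemma log_mul_norm_prod {ι : Type} [Fintype ι] {a : ℝ} (ha : 0 < a) {b e : ι → ℝ}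
    (hb : ∀ x, 0 < b x) {z : ℂ} (hz : z.im ≠ 0) :
    Real.log (a * ‖(∏ x, (b x : ℂ)) * ∏ x, (z - e x)‖) =
      (Real.log a + ∑ x, Real.log (b x)) + ∑ x, Real.log ‖z - e x‖ := by
  have h1 : ∀ x, ‖z - e x‖ ≠ 0 := fun x h => by
    have := congrArg Complex.im (norm_eq_zero.1 h)
    simp [hz] at this
  have h2 : ∀ x, ‖(b x : ℂ)‖ = b x := fun x => by
    rw [Complex.norm_real, Real.norm_of_nonneg (hb x).le]
  rw [norm_mul, norm_prod, norm_prod, Finset.prod_congr rfl fun x _ => h2 x,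
    Real.log_mul ha.ne', Real.log_mul, Real.log_prod, Real.log_prod]
  · ring
  · exact fun x _ => h1 x
  · exact fun x _ => (hb x).ne'
  · exact Finset.prod_ne_zero_iff.2 fun x _ => (hb x).ne'
  · exact Finset.prod_ne_zero_iff.2 fun x _ => h1 x
  · exact mul_ne_zero (Finset.prod_ne_zero_iff.2 fun x _ => (hb x).ne')
      (Finset.prod_ne_zero_iff.2 fun x _ => h1 x)

/-- The density of states exists for both boundary conditions and all blow-ups, and is the Laplacian
of the Green function along the curve `φ`. -/
theorem exists_densityOfStates : ∃ μ : FiniteMeasure ℝ,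
    (∀ ω : ℕ → Fin N, D.IsDensityOfStates ω μ) ∧
      IsLaplacianOver2Pi (fun z => D.green (D.phi z))
        ((μ : Measure ℝ).map (fun t : ℝ => (t : ℂ))) := by
  classical
  have hN : (0 : ℝ) < N := by linarith [D.one_lt_cast]
  have hN' : (0 : ℝ≥0) < N := by exact_mod_cast hN
  obtain ⟨C₁, e₁, hC₁, hr₁, -, hd₁⟩ := D.exists_eigenvalues_plus
  obtain ⟨C₂, e₂, hC₂, hr₂, -, hd₂, -⟩ := D.exists_eigenvalues_minus
  set C := max C₁ C₂ with hC
  set g : ℂ → ℝ := fun z => (D.green (D.phi z)).toReal with hg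
  have hgz : ∀ z : ℂ, z.im ≠ 0 → D.green (D.phi z) = (g z : EReal) ∧
      Tendsto (fun n => ((N : ℝ) ^ n)⁻¹ * ((Real.log (D.gaussConst n) +
        ∑ x, Real.log (D.baseB n x)) + ∑ x, Real.log ‖z - e₁ n x‖)) atTop (𝓝 (g z)) ∧
      Tendsto (fun n => ((N : ℝ) ^ n)⁻¹ * ((Real.log (D.gaussConst n) +
        ∑ x : D.Inner n, Real.log (D.baseB n x.1)) + ∑ x, Real.log ‖z - e₂ n x‖)) atTop
        (𝓝 (g z)) := by
    intro z hz
    obtain ⟨θ, δ, hθ, hδ, hcoer⟩ := D.exists_coer_pencil hz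
    obtain ⟨a, h1, h2, h3⟩ := D.exists_tendsto_log_det hθ hδ hcoer
    have hga : g z = a := by
      simp only [hg, phi, h1, EReal.toReal_coe]
    rw [hga]
    refine ⟨h1, h3.congr fun n => ?_, h2.congr fun n => ?_⟩
    · rw [hd₁, log_mul_norm_prod (D.gaussConst_pos n) (D.baseB_pos n) hz]
    · have h4 : ‖D.kappa n (D.pencil z)‖ = D.gaussConst n *
          ‖(∏ x : D.Inner n, (D.baseB n x.1 : ℂ)) * ∏ x, (z - e₂ n x)‖ := by
        rw [← hd₂, kappa, norm_mul, Complex.norm_real,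
          Real.norm_of_nonneg (D.gaussConst_pos n).le]
      rw [h4, log_mul_norm_prod (D.gaussConst_pos n) (fun x : D.Inner n => D.baseB_pos n x.1) hz]
  have hL : ∀ n : ℕ, (0 : ℝ) < (N : ℝ) ^ n := fun n => by positivity
  obtain ⟨hloc, ht₁⟩ := tendsto_sum_of_tendsto_log e₁ (C := C) (K := N₀) hL
    (fun n j => (hC₁ n j).trans (le_max_left _ _))
    (fun n => by rw [mul_comm]; exact_mod_cast D.card_vert_le n) _ fun z hz => (hgz z hz).2.1
  obtain ⟨-, ht₂⟩ := tendsto_sum_of_tendsto_log e₂ (C := C) (K := N₀) hL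
    (fun n j => (hC₂ n j).trans (le_max_right _ _))
    (fun n => by rw [mul_comm]; exact_mod_cast D.card_inner_le n) _ fun z hz => (hgz z hz).2.2
  set σ₁ : ℕ → FiniteMeasure ℝ := fun n => ((N : ℝ≥0) ^ n)⁻¹ • ∑ j, diracAt (e₁ n j) with hσ₁
  set σ₂ : ℕ → FiniteMeasure ℝ := fun n => ((N : ℝ≥0) ^ n)⁻¹ • ∑ j, diracAt (e₂ n j) with hσ₂
  have hm : ∀ {n m : ℕ}, m ≤ N ^ n * N₀ → ((N : ℝ≥0) ^ n)⁻¹ * m ≤ N₀ := by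
    intro n m h
    rw [inv_mul_le_iff₀ (by positivity)]
    exact_mod_cast h
  have hm₁ : ∀ n, (σ₁ n).mass ≤ N₀ := fun n => by
    rw [hσ₁]
    simp only
    rw [mass_smul_sum_diracAt]
    exact hm (D.card_vert_le n)
  have hm₂ : ∀ n, (σ₂ n).mass ≤ N₀ := fun n => by
    rw [hσ₂]
    simp only
    rw [mass_smul_sum_diracAt]
    exact hm (D.card_inner_le n)
  have hs₁ : ∀ n, σ₁ n (Set.Icc (-C) C)ᶜ = 0 := fun n =>
    smul_sum_diracAt_apply _ _ (fun j => not_not.2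
      (abs_le.1 ((hC₁ n j).trans (le_max_left _ _)))) measurableSet_Icc.compl
  have hs₂ : ∀ n, σ₂ n (Set.Icc (-C) C)ᶜ = 0 := fun n =>
    smul_sum_diracAt_apply _ _ (fun j => not_not.2
      (abs_le.1 ((hC₂ n j).trans (le_max_right _ _)))) measurableSet_Icc.compl
  have hi₁ : ∀ n (ψ : ℂ → ℝ), ∫ t : ℝ, ψ t ∂(σ₁ n : Measure ℝ) =
      ((N : ℝ) ^ n)⁻¹ * ∑ j, ψ (e₁ n j) := fun n ψ => by
    rw [hσ₁, integral_smul_sum_diracAt _ _ fun t : ℝ => ψ t]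
    push_cast
    rfl
  have hi₂ : ∀ n (ψ : ℂ → ℝ), ∫ t : ℝ, ψ t ∂(σ₂ n : Measure ℝ) =
      ((N : ℝ) ^ n)⁻¹ * ∑ j, ψ (e₂ n j) := fun n ψ => by
    rw [hσ₂, integral_smul_sum_diracAt _ _ fun t : ℝ => ψ t]
    push_cast
    rfl
  obtain ⟨μ, hμm, hμs, hμ⟩ := exists_finiteMeasure_of_tendsto hm₁ hs₁
    (Λ := fun ψ => (2 * Real.pi)⁻¹ * ∫ z, g z * Laplacian.laplacian ψ z)
    fun ψ h1 h2 => (ht₁ ψ h1 h2).congr fun n => (hi₁ n ψ).symm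
  refine ⟨μ, fun ω => ⟨?_, ?_⟩, ?_, hloc, fun ψ h1 h2 => ?_⟩
  · have h3 := tendsto_of_tendsto_integral_test hm₁ hs₁ hμm hμs fun ψ h1 h2 => by
      rw [hμ ψ h1 h2]
      exact (ht₁ ψ h1 h2).congr fun n => (hi₁ n ψ).symm
    refine h3.congr fun n => ?_
    rw [nuPlus, sum_map_diracAt (e₁ n)]
    rw [← hr₁ ω n]
  · have h3 := tendsto_of_tendsto_integral_test hm₂ hs₂ hμm hμs fun ψ h1 h2 => by
      rw [hμ ψ h1 h2]
      exact (ht₂ ψ h1 h2).congr fun n => (hi₂ n ψ).symm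
    refine h3.congr fun n => ?_
    rw [nuMinus, sum_map_diracAt (e₂ n)]
    rw [← hr₂ ω n]
  · filter_upwards [ae_im_ne_zero] with z hz
    rw [(hgz z hz).1]
    exact ⟨EReal.coe_ne_bot _, EReal.coe_ne_top _⟩
  · rw [integral_map Complex.continuous_ofReal.aemeasurable h1.continuous.aestronglyMeasurable]
    exact hμ ψ h1 h2

end LatticeData

/-! ### Taylor expansions along open sets of directions -/

section Taylor

variable {E F : Type*} [NormedAddCommGroup E] [NormedSpace ℂ E] [NormedAddCommGroup F]
  [NormedSpace ℂ F]

lemma eq_zero_of_isBigO_sum_pow {p : ℕ} {c : ℕ → F}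
    (h : (fun t : ℝ => ∑ k ∈ Finset.range p, (t : ℂ) ^ k • c k) =O[𝓝[>] 0] fun t => t ^ p) :
    ∀ k < p, c k = 0 := by
  intro k
  induction k using Nat.strong_induction_on with
  | _ k ih =>
    intro hk
    have h1 : Tendsto (fun t : ℝ => ∑ j ∈ Finset.Ico k p, (t : ℂ) ^ (j - k) • c j) (𝓝[>] 0)
        (𝓝 (c k)) := by
      have h2 : Continuous fun t : ℝ => ∑ j ∈ Finset.Ico k p, (t : ℂ) ^ (j - k) • c j := by fun_prop
      have h3 := (h2.tendsto 0).mono_left (nhdsWithin_le_nhds (s := Set.Ioi 0))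
      rwa [Finset.sum_eq_single_of_mem k (Finset.left_mem_Ico.2 hk) (fun j hj hjk => by
        have : j - k ≠ 0 := by have := (Finset.mem_Ico.1 hj).1; omega
        simp [this]), Nat.sub_self, pow_zero, one_smul] at h3
    obtain ⟨C, hC⟩ := h.bound
    have h2 : Tendsto (fun t : ℝ => C * t ^ (p - k)) (𝓝[>] 0) (𝓝 0) := by
      have h2 : Continuous fun t : ℝ => C * t ^ (p - k) := by fun_prop
      have h3 := (h2.tendsto 0).mono_left (nhdsWithin_le_nhds (s := Set.Ioi 0))
      rwa [zero_pow (by omega), mul_zero] at h3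
    refine tendsto_nhds_unique h1 (squeeze_zero_norm' ?_ h2)
    filter_upwards [hC, self_mem_nhdsWithin] with t ht ht0
    have ht0 : 0 < t := ht0
    have h3 : ∑ j ∈ Finset.range p, (t : ℂ) ^ j • c j =
        (t : ℂ) ^ k • ∑ j ∈ Finset.Ico k p, (t : ℂ) ^ (j - k) • c j := by
      rw [Finset.smul_sum, ← Finset.sum_range_add_sum_Ico _ hk.le,
        Finset.sum_eq_zero fun j hj => by
          have := Finset.mem_range.1 hj
          rw [ih j this (this.trans hk), smul_zero], zero_add]
      refine Finset.sum_congr rfl fun j hj => ?_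
      rw [smul_smul, ← pow_add, Nat.add_sub_cancel' (Finset.mem_Ico.1 hj).1]
    rw [h3, norm_smul, norm_pow, Complex.norm_real, Real.norm_of_nonneg ht0.le, norm_pow,
      Real.norm_of_nonneg ht0.le, show t ^ p = t ^ k * t ^ (p - k) by
        rw [← pow_add, Nat.add_sub_cancel' hk.le], mul_left_comm] at ht
    exact le_of_mul_le_mul_left ht (by positivity)

/-- A holomorphic function which vanishes to order `p` at `x` along an open set of real directions
vanishes to order `p` at `x`: its homogeneous Taylor polynomials of degree less than `p` vanish on
an open set. -/
lemma isBigO_of_isBigO_lines {f : E → F} {x h₀ : E} {p : ℕ} (hf : AnalyticAt ℂ f x)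
    (h : ∀ᶠ H in 𝓝 h₀, (fun t : ℝ => f (x + (t : ℂ) • H)) =O[𝓝[>] 0] fun t => t ^ p) :
    f =O[𝓝 x] fun y => ‖y - x‖ ^ p := by
  obtain ⟨P, hP⟩ := hf
  have hO := hP.isBigO_sub_partialSum_pow p
  have h1 : ∀ k < p, ∀ H, P k (fun _ => H) = 0 := by
    intro k hk
    have ha : AnalyticOnNhd ℂ (fun H : E => P k fun _ => H) Set.univ := by
      intro H _
      have h2 := ((P k).cpolynomialAt (x := fun _ => H)).analyticAt
      exact h2.comp (f := fun H : E => fun _ : Fin k => H)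
        ((ContinuousLinearMap.pi fun _ : Fin k => ContinuousLinearMap.id ℂ E).analyticAt H)
    have h0 : (fun H : E => P k fun _ => H) =ᶠ[𝓝 h₀] 0 := by
      filter_upwards [h] with H hH
      have h2 : Tendsto (fun t : ℝ => (t : ℂ) • H) (𝓝[>] 0) (𝓝 0) := by
        have h2 : Continuous fun t : ℝ => (t : ℂ) • H := by fun_prop
        have h3 := (h2.tendsto 0).mono_left (nhdsWithin_le_nhds (s := Set.Ioi 0))
        simpa using h3
      have h3 : (fun t : ℝ => f (x + (t : ℂ) • H) - P.partialSum p ((t : ℂ) • H)) =O[𝓝[>] 0]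
          fun t : ℝ => t ^ p := by
        refine (hO.comp_tendsto h2).trans (Asymptotics.IsBigO.of_bound (‖H‖ ^ p) ?_)
        filter_upwards [self_mem_nhdsWithin] with t ht
        simp only [Function.comp_apply, norm_smul, norm_pow, norm_norm, mul_pow, norm_mul,
          Complex.norm_real]
        rw [mul_comm]
      have h4 := hH.sub h3
      simp only [sub_sub_cancel] at h4
      refine eq_zero_of_isBigO_sum_pow (c := fun k => P k fun _ => H) ?_ k hk
      refine h4.congr_left fun t => ?_
      rw [FormalMultilinearSeries.partialSum]
      refine Finset.sum_congr rfl fun j _ => ?_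
      have := (P j).map_smul_univ (fun _ => (t : ℂ)) fun _ => H
      simpa using this
    exact fun H => ha.eqOn_zero_of_preconnected_of_eventuallyEq_zero isPreconnected_univ
      (Set.mem_univ h₀) h0 (Set.mem_univ H)
  have h2 : (fun y : E => f (x + y)) =O[𝓝 0] fun y => ‖y‖ ^ p := by
    refine hO.congr_left fun y => ?_
    rw [FormalMultilinearSeries.partialSum, Finset.sum_eq_zero, sub_zero]
    exact fun k hk => h1 k (Finset.mem_range.1 hk) y
  have h3 : Tendsto (fun y => y - x) (𝓝 x) (𝓝 0) := by
    have : Continuous fun y : E => y - x := by fun_prop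
    simpa using this.tendsto x
  refine (h2.comp_tendsto h3).congr_left fun y => ?_
  simp

end Taylor

/-! ### The projective space near the points `π(exp (η̄Qη))` -/

section Chart

section Projective

variable {E : Type} [NormedAddCommGroup E] [NormedSpace ℂ E]

/-- Open cones of `E` define open subsets of the projective space. -/
lemma isOpen_setOf_rep_mem {W : Set E} (hW : IsOpen W)
    (h : ∀ (c : ℂ) v, c ≠ 0 → (c • v ∈ W ↔ v ∈ W)) :
    IsOpen {y : Projectivization ℂ E | y.rep ∈ W} := by
  refine isOpen_coinduced.2 ?_
  convert hW.preimage (continuous_subtype_val (p := fun v : E => v ≠ 0)) using 1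
  ext v
  obtain ⟨a, ha⟩ := Projectivization.exists_smul_eq_mk_rep ℂ v.1 v.2
  rw [Set.mem_preimage, Set.mem_ofPred_eq, ← ha]
  exact h _ _ a.ne_zero

lemma continuous_projMk :
    Continuous fun v : {v : E // v ≠ 0} => Projectivization.mk ℂ v.1 v.2 :=
  continuous_coinduced_rng

end Projective

variable {V : Type} [Fintype V]

/-- The matrix `Q` of a multiple `v` of `exp (η̄Qη)`, read on the coefficients of `v`. -/
def chartMat (v : Bal V) : Matrix V V ℂ := (coeffOne V v)⁻¹ • coeffPair V v

omit [Fintype V] in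
lemma chartMat_smul {c : ℂ} (hc : c ≠ 0) (v : Bal V) : chartMat (c • v) = chartMat v := by
  rw [chartMat, chartMat, map_smul, map_smul, smul_eq_mul, mul_inv, smul_smul, mul_comm c⁻¹,
    mul_assoc, inv_mul_cancel₀ hc, mul_one]

lemma chartMat_grassExp (Q : Matrix V V ℂ) : chartMat (grassExp Q) = Q := by
  rw [chartMat, coeffOne_grassExp, coeffPair_grassExp, inv_one, one_smul]

lemma analyticAt_coeffOne (v : Bal V) : AnalyticAt ℂ (coeffOne V) v :=
  analyticAt_of_linear (coeffOne V).toLinearMap v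

lemma analyticAt_inv_coeffOne_smul {v : Bal V} (hv : coeffOne V v ≠ 0) :
    AnalyticAt ℂ (fun v : Bal V => (coeffOne V v)⁻¹ • v) v :=
  ((analyticAt_coeffOne v).inv hv).smul analyticAt_id

lemma analyticAt_grassExp_coeffPair (v : Bal V) :
    AnalyticAt ℂ (fun v : Bal V => grassExp (coeffPair V v)) v :=
  analyticAt_grassExp_comp (f := quadFormL ∘ₗ coeffPair V) (analyticAt_of_linear _ _) fun _ => rfl

lemma analyticAt_grassExp_chartMat {v : Bal V} (hv : coeffOne V v ≠ 0) :
    AnalyticAt ℂ (fun v : Bal V => grassExp (chartMat v)) v := by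
  have h := (analyticAt_grassExp_coeffPair _).comp (analyticAt_inv_coeffOne_smul hv)
  refine h.congr (Eventually.of_forall fun w => ?_)
  simp only [Function.comp_apply, map_smul, chartMat]

/-- The section of the projection `π` over the points `π(exp (η̄Qη))`. -/
def gaussSection (y : Projectivization ℂ (Bal V)) : Bal V := grassExp (chartMat y.rep)

lemma gaussSection_ne_zero (y : Projectivization ℂ (Bal V)) : gaussSection y ≠ 0 :=
  grassExp_ne_zero _

lemma gaussSection_mk (v : Bal V) (hv : v ≠ 0) :
    gaussSection (Projectivization.mk ℂ v hv) = grassExp (chartMat v) := by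
  obtain ⟨a, ha⟩ := Projectivization.exists_smul_eq_mk_rep ℂ v hv
  rw [gaussSection, ← ha]
  congr 1
  exact chartMat_smul a.ne_zero v

/-- The point `π(exp (η̄Qη))`. -/
def gaussPt (Q : Matrix V V ℂ) : Projectivization ℂ (Bal V) :=
  Projectivization.mk ℂ (grassExp Q) (grassExp_ne_zero Q)

lemma exists_gaussPt_rep (Q : Matrix V V ℂ) : ∃ a : ℂ, a ≠ 0 ∧ (gaussPt Q).rep = a • grassExp Q := by
  obtain ⟨a, ha⟩ := Projectivization.exists_smul_eq_mk_rep ℂ (grassExp Q) (grassExp_ne_zero Q)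
  exact ⟨a, a.ne_zero, ha.symm⟩

lemma coeffOne_gaussPt_rep (Q : Matrix V V ℂ) : coeffOne V (gaussPt Q).rep ≠ 0 := by
  obtain ⟨a, ha, h⟩ := exists_gaussPt_rep Q
  rw [h, map_smul, coeffOne_grassExp, smul_eq_mul, mul_one]
  exact ha

lemma inv_coeffOne_smul_gaussPt_rep (Q : Matrix V V ℂ) :
    (coeffOne V (gaussPt Q).rep)⁻¹ • (gaussPt Q).rep = grassExp Q := by
  obtain ⟨a, ha, h⟩ := exists_gaussPt_rep Q
  rw [h, map_smul, coeffOne_grassExp, smul_eq_mul, mul_one, smul_smul, inv_mul_cancel₀ ha,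
    one_smul]

lemma projPull_gaussSection {W : Type} [NormedAddCommGroup W] [NormedSpace ℂ W] (T : Bal V → W)
    (Q : Matrix V V ℂ) : projPull (fun y => T (gaussSection y)) =ᶠ[𝓝 (gaussPt Q).rep]
      fun v => T (grassExp (chartMat v)) := by
  have h : ∀ᶠ v in 𝓝 (gaussPt Q).rep, v ≠ 0 :=
    isOpen_ne.mem_nhds (Projectivization.rep_nonzero _)
  filter_upwards [h] with v hv
  rw [projPull, dif_pos hv, gaussSection_mk]

/-- Over the closure of a set of points `π(exp (η̄Qη))`, and where the coefficient of `1` does not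
vanish, `gaussSection` is a section of `π`. -/
lemma gaussSection_of_mem_closure {s : Set (Matrix V V ℂ)} {y : Projectivization ℂ (Bal V)}
    (hy : y ∈ closure (gaussPt '' s)) (h0 : coeffOne V y.rep ≠ 0) :
    Projectivization.mk ℂ (gaussSection y) (gaussSection_ne_zero y) = y := by
  set Δ : Bal V → Bal V := fun v => grassExp (chartMat v) - (coeffOne V v)⁻¹ • v with hΔ
  have hΔs : ∀ (c : ℂ) v, c ≠ 0 → Δ (c • v) = Δ v := by
    intro c v hc
    simp only [hΔ]
    rw [chartMat_smul hc, map_smul, smul_smul, smul_eq_mul, mul_inv, mul_comm c⁻¹, mul_assoc,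
      inv_mul_cancel₀ hc, mul_one]
  have hopen : IsOpen {v : Bal V | coeffOne V v ≠ 0 ∧ Δ v ≠ 0} := by
    rw [isOpen_iff_mem_nhds]
    rintro v ⟨h1, h2⟩
    have h3 : ContinuousAt Δ v := ((analyticAt_grassExp_chartMat h1).sub
      (((analyticAt_coeffOne v).inv h1).smul analyticAt_id)).continuousAt
    exact ((analyticAt_coeffOne v).continuousAt.eventually_ne h1).and (h3.eventually_ne h2)
  have hO := isOpen_setOf_rep_mem hopen fun c v hc => by
    simp only [Set.mem_ofPred_eq, hΔs c v hc, map_smul, smul_eq_mul, ne_eq, mul_eq_zero, hc,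
      false_or]
  -- `Δ` is invariant under scaling, continuous where `coeffOne` does not vanish, and `0` at the
  -- points `π(exp (η̄Qη))`, hence on the closure
  have h1 : Δ y.rep = 0 := by
    by_contra h1
    obtain ⟨x, hx, Q, -, rfl⟩ := mem_closure_iff.1 hy _ hO ⟨h0, h1⟩
    refine hx.2 ?_
    obtain ⟨a, ha, h⟩ := exists_gaussPt_rep Q
    rw [h, hΔs _ _ ha]
    simp [hΔ, chartMat_grassExp, coeffOne_grassExp]
  have h2 : gaussSection y = (coeffOne V y.rep)⁻¹ • y.rep := sub_eq_zero.1 h1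
  refine Eq.trans ?_ y.mk_rep
  exact (Projectivization.mk_eq_mk_iff' ℂ _ _ _ _).2 ⟨(coeffOne V y.rep)⁻¹, h2.symm⟩

lemma isLocalSection_gaussSection {X : Set (Projectivization ℂ (Bal V))}
    {s : Set (Matrix V V ℂ)} (hX : X = closure (gaussPt '' s)) (Q : Matrix V V ℂ) :
    IsLocalSection X gaussSection (gaussPt Q) := by
  refine ⟨⟨gaussSection, ?_, EventuallyEq.rfl⟩, ?_⟩
  · have h := projPull_gaussSection (fun v : Bal V => v) Q
    exact (analyticAt_grassExp_chartMat (coeffOne_gaussPt_rep Q)).congr h.symm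
  · have hopen : IsOpen {v : Bal V | coeffOne V v ≠ 0} := by
      rw [isOpen_iff_mem_nhds]
      exact fun v h1 => (analyticAt_coeffOne v).continuousAt.eventually_ne h1
    have hO := isOpen_setOf_rep_mem hopen fun c v hc => by
      simp only [Set.mem_ofPred_eq, map_smul, smul_eq_mul, ne_eq, mul_eq_zero, hc, false_or]
    filter_upwards [nhdsWithin_le_nhds (hO.mem_nhds (coeffOne_gaussPt_rep Q)),
      self_mem_nhdsWithin] with y hy1 hy2
    exact ⟨gaussSection_ne_zero y, gaussSection_of_mem_closure (hX ▸ hy2) hy1⟩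

/-- The order of vanishing of a function of the form `T ∘ gaussSection` at `π(exp (η̄Qη))` can be
computed in the affine chart. -/
lemma vanishesToOrder_gaussSection {W : Type} [NormedAddCommGroup W] [NormedSpace ℂ W]
    {X : Set (Projectivization ℂ (Bal V))} {T : Bal V → W} (hT : ∀ v, AnalyticAt ℂ T v)
    {Q : Matrix V V ℂ} {p : ℕ}
    (h : (fun w : Bal V => T (grassExp (coeffPair V w))) =O[𝓝 (grassExp Q)]
      fun w => ‖w - grassExp Q‖ ^ p) :
    VanishesToOrder X (fun y => T (gaussSection y)) (gaussPt Q) p := by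
  have h0 := coeffOne_gaussPt_rep Q
  refine ⟨_, ?_, EventuallyEq.rfl, ?_⟩
  · exact ((hT _).comp (analyticAt_grassExp_chartMat h0)).congr (projPull_gaussSection T Q).symm
  · refine (projPull_gaussSection T Q).trans_isBigO ?_
    have h1 := analyticAt_inv_coeffOne_smul h0
    have h2 := h1.continuousAt.tendsto
    rw [inv_coeffOne_smul_gaussPt_rep] at h2
    have h3 := h1.differentiableAt.isBigO_sub
    rw [inv_coeffOne_smul_gaussPt_rep] at h3
    have h4 := (h.comp_tendsto h2).trans (h3.norm_norm.pow p)
    refine h4.congr_left fun v => ?_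
    simp only [Function.comp_apply, map_smul, chartMat]

end Chart

namespace LatticeData

variable {N N₀ : ℕ} {Γ : Type*} [Group Γ] (D : LatticeData N N₀ Γ)

open Matrix

/-! ### Lower bounds for the order of vanishing along the curve `φ` -/

lemma lagG_eq : D.lagG = closure (gaussPt '' D.symG) := by
  rw [lagG]
  congr 1
  ext p
  constructor
  · rintro ⟨Q, hQ, rfl⟩
    exact ⟨Q, hQ, rfl⟩
  · rintro ⟨Q, hQ, rfl⟩
    exact ⟨Q, hQ, rfl⟩

lemma actF_injective (g : Γ) : Function.Injective (D.actF g) := by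
  intro x y h
  have h1 : D.act g (Fin.castLE D.le x) = D.act g (Fin.castLE D.le y) :=
    Fin.ext (Fin.mk.inj_iff.1 h)
  exact Fin.castLE_injective D.le ((D.act g).injective h1)

lemma pencil_mem_symG (z : ℂ) : D.pencil z ∈ D.symG := by
  constructor
  · have h1 : (D.opA.map (fun r : ℝ => (r : ℂ)))ᵀ = D.opA.map (fun r : ℝ => (r : ℂ)) := by
      rw [← transpose_map, D.opA_isSymm.eq]
    rw [IsSymm, pencil, transpose_add, transpose_smul, diagonal_transpose, h1]
  · intro g x y
    -- the diagonal entries are sums over `F`, which `g` permutes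
    have hA : D.opA (D.actF g x) (D.actF g y) = D.opA x y := by
      simp only [opA, of_apply, (D.actF_injective g).eq_iff]
      by_cases h : x = y
      · rw [if_pos h, if_pos h]
        have hb : Function.Bijective (D.actF g) := (D.actF_injective g).bijective_of_finite
        refine (Finset.sum_bij (fun z _ => D.actF g z) (fun z hz => ?_)
          (fun a _ b _ h => D.actF_injective g h) (fun z hz => ?_) fun z hz => ?_).symm
        · simp only [Finset.mem_erase, Finset.mem_univ, and_true] at hz ⊢
          exact fun h' => hz (D.actF_injective g h')
        · obtain ⟨w, rfl⟩ := hb.2 z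
          simp only [Finset.mem_erase, Finset.mem_univ, and_true] at hz
          exact ⟨w, by simpa using fun h' => hz (by rw [h']), rfl⟩
        · simp only [Finset.mem_erase, Finset.mem_univ, and_true] at hz
          exact (D.cond_inv g x z (Ne.symm hz)).symm
      · rw [if_neg h, if_neg h]
        exact congrArg _ (D.cond_inv g x y h)
    have hm : D.mass (D.actF g x) = D.mass x := D.mass_inv g x
    simp only [pencil, Matrix.add_apply, map_apply, Matrix.smul_apply, diagonal_apply, hA, hm,
      (D.actF_injective g).eq_iff]

lemma projPhi_mem_lagG (z : ℂ) : D.projPhi z ∈ D.lagG :=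
  subset_closure ⟨D.pencil z, D.pencil_mem_symG z, rfl⟩

lemma analyticAt_phi (z : ℂ) : AnalyticAt ℂ D.phi z := by
  have h : AnalyticAt ℂ (fun z : ℂ => quadFormL (D.opA.map (fun r : ℝ => (r : ℂ))) +
      z • quadFormL (diagonal fun x => (D.mass x : ℂ))) z :=
    analyticAt_const.add (analyticAt_id.smul analyticAt_const)
  refine analyticAt_grassExp_comp h fun w => ?_
  rw [← map_smul, ← map_add]
  rfl

lemma continuous_phi : Continuous D.phi :=
  continuous_iff_continuousAt.2 fun z => (D.analyticAt_phi z).continuousAt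

lemma continuous_projPhi : Continuous D.projPhi :=
  continuous_projMk.comp (D.continuous_phi.subtype_mk fun _ => grassExp_ne_zero _)

lemma glueMat_add_smul (n : ℕ) (Q H : Matrix (Fin N₀) (Fin N₀) ℂ) (s : ℂ) :
    D.glueMat n (Q + s • H) = D.glueMat n Q + s • D.glueMat n H := by
  classical
  refine Matrix.toLin'.injective (LinearMap.ext fun f => ?_)
  rw [toLin'_apply, toLin'_apply, add_mulVec, smul_mulVec, glueMat_mulVec, glueMat_mulVec,
    glueMat_mulVec, Finset.smul_sum, ← Finset.sum_add_distrib]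
  refine Finset.sum_congr rfl fun i _ => ?_
  rw [add_mulVec, smul_mulVec, map_add, map_smul, smul_add, smul_comm s]

open Classical in
/-- At the points `A + t₀ I_b + t H`, for `t₀` real, `H` coercive and `t → 0`, the iterate of `R` is
`O(t ^ p)`: the Dirichlet determinant vanishes to the order of the multiplicity `p + N₀` of the
eigenvalue `t₀`, while the Schur complement is `O(t⁻¹)`, so that its Grassmann exponential is
`O(t ^ (-N₀))`. -/
lemma isBigO_iterate_renorm_line {n p : ℕ} {t₀ : ℝ}
    (hdet : ∀ H : Matrix (D.Inner n) (D.Inner n) ℂ, ∃ r : ℂ → ℂ, Continuous r ∧ ∀ s : ℂ,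
      ((D.glueMat n (D.pencil t₀)).submatrix (Subtype.val : D.Inner n → _) Subtype.val +
        s • H).det = s ^ (p + N₀) * r s)
    {δ : ℝ} (hδ : 0 < δ) {H : Matrix (Fin N₀) (Fin N₀) ℂ} (hH : Coer (-Complex.I) δ H) :
    (fun t : ℝ => D.renorm^[n] (grassExp (D.pencil t₀ + (t : ℂ) • H))) =O[𝓝[>] 0]
      fun t => t ^ p := by
  obtain ⟨m, hm0, -, hmw⟩ := D.exists_minWt
  obtain ⟨r, hr, hdet⟩ := hdet ((D.glueMat n H).submatrix Subtype.val Subtype.val)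
  obtain ⟨C, hC0, hC⟩ := exists_norm_grassExp_le (Fin N₀)
  set K : ℝ := (∑ i, D.wt i) ^ n * ∑ u, ∑ v, (‖D.pencil t₀ u v‖ + ‖H u v‖) with hK
  have hW : 0 ≤ ∑ i, D.wt i := Finset.sum_nonneg fun i _ => (D.wt_pos i).le
  have hK0 : 0 ≤ K := mul_nonneg (pow_nonneg hW n) (by positivity)
  set L : ℝ := K ^ 2 * Fintype.card (D.Vert n) / (δ * m ^ n) with hL
  have hL0 : 0 ≤ L := by positivity
  obtain ⟨M, hM⟩ : ∃ M, ∀ᶠ t : ℝ in 𝓝[>] 0, ‖r t‖ ≤ M := by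
    have h1 : Tendsto (fun t : ℝ => ‖r t‖) (𝓝[>] 0) (𝓝 ‖r (0 : ℝ)‖) :=
      ((hr.comp Complex.continuous_ofReal).norm.tendsto 0).mono_left nhdsWithin_le_nhds
    exact ⟨‖r (0 : ℝ)‖ + 1, (h1.eventually_lt_const (by linarith)).mono fun t ht => ht.le⟩
  refine Asymptotics.IsBigO.of_bound (D.gaussConst n * M * (C * (1 + L) ^ N₀)) ?_
  have ht1 : ∀ᶠ t : ℝ in 𝓝[>] 0, t < 1 := nhdsWithin_le_nhds (gt_mem_nhds one_pos)
  filter_upwards [hM, self_mem_nhdsWithin, ht1] with t ht ht0 ht1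
  have ht0 : 0 < t := ht0
  have hcoer : Coer (-Complex.I) (δ * t) (D.pencil t₀ + (t : ℂ) • H) := by
    intro f
    have h1 := hH f
    have h2 := D.im_dotProduct_pencil_mulVec t₀ f
    rw [Complex.ofReal_im, zero_mul] at h2
    rw [neg_mul, Complex.neg_re, Complex.I_mul_re] at h1 ⊢
    rw [add_mulVec, dotProduct_add, smul_mulVec, dotProduct_smul, Complex.add_im, h2, smul_eq_mul,
      Complex.im_ofReal_mul]
    nlinarith
  obtain ⟨S, hS1, hS2⟩ := D.exists_iterate_renorm_grassExp (mul_pos hδ ht0) hcoer n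
  have hent : ∀ x y, ‖D.glueMat n (D.pencil t₀ + (t : ℂ) • H) x y‖ ≤ K := by
    intro x y
    refine (D.norm_glueMat_le n _ x y).trans (mul_le_mul_of_nonneg_left ?_ (pow_nonneg hW n))
    refine Finset.sum_le_sum fun u _ => Finset.sum_le_sum fun v _ => ?_
    rw [Matrix.add_apply, Matrix.smul_apply]
    refine (norm_add_le _ _).trans (add_le_add le_rfl ?_)
    rw [norm_smul, Complex.norm_real, Real.norm_of_nonneg ht0.le]
    exact mul_le_of_le_one_left (norm_nonneg _) ht1.le
  have hS3 : ∀ a b, ‖S a b‖ ≤ L / t := by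
    intro a b
    refine (hS2.norm_entry_le (by simp) (by positivity) hK0 (D.bdryPt_injective n)
      (D.Coer_glueMat (mul_pos hδ ht0).le hm0.le hmw hcoer n) hent a b).trans (le_of_eq ?_)
    rw [hL, div_div]
    congr 1
    ring
  have hS4 : ‖grassExp S‖ ≤ C * ((1 + L) / t) ^ N₀ := by
    refine (hC S (L / t) (by positivity) hS3).trans ?_
    rw [Fintype.card_fin]
    refine mul_le_mul_of_nonneg_left (pow_le_pow_left₀ (by positivity) ?_ _) hC0.le
    rw [add_div]
    have : 1 ≤ 1 / t := (one_le_div ht0).2 ht1.le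
    linarith
  have hkap : ‖D.kappa n (D.pencil t₀ + (t : ℂ) • H)‖ ≤ D.gaussConst n * (t ^ (p + N₀) * M) := by
    rw [kappa, norm_mul, Complex.norm_real, Real.norm_of_nonneg (D.gaussConst_pos n).le,
      glueMat_add_smul]
    refine mul_le_mul_of_nonneg_left ?_ (D.gaussConst_pos n).le
    have h1 := hdet t
    have h2 : ((D.glueMat n (D.pencil t₀) + (t : ℂ) • D.glueMat n H).submatrix
        (Subtype.val : D.Inner n → _) Subtype.val).det = (t : ℂ) ^ (p + N₀) * r t := by
      rw [← h1]
      congr 1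
    rw [h2, norm_mul, norm_pow, Complex.norm_real, Real.norm_of_nonneg ht0.le]
    exact mul_le_mul_of_nonneg_left ht (by positivity)
  rw [hS1, norm_smul, norm_pow, Real.norm_of_nonneg ht0.le]
  have hM0 : 0 ≤ M := (norm_nonneg _).trans ht
  have hg := (D.gaussConst_pos n).le
  refine (mul_le_mul hkap hS4 (norm_nonneg _) (by positivity)).trans (le_of_eq ?_)
  rw [div_pow, pow_add]
  field_simp

/-- The matrices close to `i` are coercive. -/
lemma eventually_coer_coeffPair : ∀ᶠ w in 𝓝 (grassExp (Complex.I • (1 : Matrix (Fin N₀) (Fin N₀) ℂ))),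
    Coer (-Complex.I) (1 / 2) (coeffPair (Fin N₀) w) := by
  set w₀ := grassExp (Complex.I • (1 : Matrix (Fin N₀) (Fin N₀) ℂ)) with hw₀
  set η : ℝ := 1 / (2 * (N₀ + 1)) with hη
  have hη0 : 0 < η := by positivity
  have h1 : ∀ᶠ w in 𝓝 w₀, ∀ x y, ‖coeffPair (Fin N₀) w x y -
      (Complex.I • (1 : Matrix (Fin N₀) (Fin N₀) ℂ)) x y‖ < η := by
    refine eventually_all.2 fun x => eventually_all.2 fun y => ?_
    let L : Bal (Fin N₀) →ₗ[ℂ] ℂ :=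
      (LinearMap.proj y ∘ₗ LinearMap.proj x) ∘ₗ (coeffPair (Fin N₀) : _ →ₗ[ℂ] (Fin N₀ → Fin N₀ → ℂ))
    have hL : ContinuousAt (fun w => L w) w₀ := (analyticAt_of_linear L w₀).continuousAt
    have h2 := Metric.continuousAt_iff'.1 hL η hη0
    filter_upwards [h2] with w hw
    rw [dist_eq_norm] at hw
    have h3 : L w₀ = (Complex.I • (1 : Matrix (Fin N₀) (Fin N₀) ℂ)) x y := by
      change coeffPair (Fin N₀) w₀ x y = _
      rw [hw₀, coeffPair_grassExp]
    rw [h3] at hw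
    exact hw
  filter_upwards [h1] with w hw
  intro f
  set s := ∑ x, ‖f x‖ ^ 2 with hs
  have hs0 : 0 ≤ s := by positivity
  have h2 : coeffPair (Fin N₀) w = Complex.I • (1 : Matrix (Fin N₀) (Fin N₀) ℂ) +
      (coeffPair (Fin N₀) w - Complex.I • (1 : Matrix (Fin N₀) (Fin N₀) ℂ)) := by abel
  set T := coeffPair (Fin N₀) w - Complex.I • (1 : Matrix (Fin N₀) (Fin N₀) ℂ) with hT
  have h3 : ‖star f ⬝ᵥ T *ᵥ f‖ ≤ 1 / 2 * s := by
    have h4 : ∀ x y, ‖f x‖ * ‖f y‖ ≤ (‖f x‖ ^ 2 + ‖f y‖ ^ 2) / 2 := fun x y => by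
      nlinarith [sq_nonneg (‖f x‖ - ‖f y‖)]
    calc ‖star f ⬝ᵥ T *ᵥ f‖ ≤ ∑ x, ∑ y, η * ((‖f x‖ ^ 2 + ‖f y‖ ^ 2) / 2) := by
          rw [dotProduct]
          refine (norm_sum_le _ _).trans (Finset.sum_le_sum fun x _ => ?_)
          rw [mulVec, dotProduct, Finset.mul_sum]
          refine (norm_sum_le _ _).trans (Finset.sum_le_sum fun y _ => ?_)
          rw [norm_mul, norm_mul, Pi.star_apply, norm_star, mul_left_comm]
          exact mul_le_mul (hw x y).le (h4 x y) (by positivity) hη0.le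
      _ = η * (N₀ * s) := by
          simp_rw [← Finset.mul_sum, add_div, Finset.sum_add_distrib, ← Finset.sum_div]
          rw [← hs]
          simp only [Finset.sum_const, Finset.card_univ, Fintype.card_fin, nsmul_eq_mul,
            ← Finset.mul_sum]
          rw [← hs]
          ring
      _ ≤ 1 / 2 * s := by
          rw [hη, ← mul_assoc]
          refine mul_le_mul_of_nonneg_right ?_ hs0
          rw [div_mul_eq_mul_div, div_le_div_iff₀ (by positivity) (by norm_num)]
          have : (0 : ℝ) ≤ N₀ := N₀.cast_nonneg
          linarith
  have h5 : star f ⬝ᵥ f = (s : ℂ) := by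
    rw [dotProduct, hs]
    push_cast
    exact Finset.sum_congr rfl fun x _ => Complex.conj_mul' _
  have h6 := (Complex.abs_im_le_norm (star f ⬝ᵥ T *ᵥ f)).trans h3
  rw [h2, add_mulVec, dotProduct_add, smul_mulVec, one_mulVec, dotProduct_smul, h5, neg_mul,
    Complex.neg_re, Complex.I_mul_re, Complex.add_im, smul_eq_mul, Complex.I_mul_im,
    Complex.ofReal_re]
  have := (abs_le.1 h6).1
  linarith

open Classical in
/-- A Dirichlet eigenvalue of multiplicity `p + N₀` gives order of vanishing at least `p`: the
iterate of `R` is read on all of `𝒜` through the matrix of the coefficients of degree `2`, and the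
directions near `exp (i η̄η)` are coercive. -/
lemma le_rho {n p : ℕ} {t₀ : ℝ}
    (hdet : ∀ H : Matrix (D.Inner n) (D.Inner n) ℂ, ∃ r : ℂ → ℂ, Continuous r ∧ ∀ s : ℂ,
      ((D.glueMat n (D.pencil t₀)).submatrix (Subtype.val : D.Inner n → _) Subtype.val +
        s • H).det = s ^ (p + N₀) * r s) :
    (p : ℕ∞) ≤ D.rho n (D.projPhi t₀) := by
  have h1 : (fun w : Bal (Fin N₀) => D.renorm^[n] (grassExp (coeffPair (Fin N₀) w)))
      =O[𝓝 (grassExp (D.pencil t₀))] fun w => ‖w - grassExp (D.pencil t₀)‖ ^ p := by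
    refine isBigO_of_isBigO_lines ((D.analyticAt_iterate_renorm n _).comp
      (analyticAt_grassExp_coeffPair _))
      (h₀ := grassExp (Complex.I • (1 : Matrix (Fin N₀) (Fin N₀) ℂ))) ?_
    filter_upwards [eventually_coer_coeffPair] with H hH
    refine (D.isBigO_iterate_renorm_line hdet (by norm_num) hH).congr_left fun t => ?_
    rw [map_add, map_smul, coeffPair_grassExp]
  have h2 : VanishesToOrder D.lagG (fun y => D.renorm^[n] (gaussSection y)) (D.projPhi t₀) p :=
    vanishesToOrder_gaussSection (fun v => D.analyticAt_iterate_renorm n v) h1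
  have h3 : IsLocalSection D.lagG gaussSection (D.projPhi t₀) :=
    isLocalSection_gaussSection D.lagG_eq (D.pencil t₀)
  rw [rho]
  refine le_trans ?_ (le_iSup₂ (f := fun s (_ : IsLocalSection D.lagG s (D.projPhi t₀)) =>
    vanishingOrder D.lagG (fun y => D.renorm^[n] (s y)) (D.projPhi t₀)) gaussSection h3)
  exact le_iSup₂ (f := fun (p : ℕ) (_ : VanishesToOrder D.lagG
    (fun y => D.renorm^[n] (gaussSection y)) (D.projPhi t₀) p) => (p : ℕ∞)) p h2

end LatticeData

namespace LatticeData

variable {N N₀ : ℕ} {Γ : Type*} [Group Γ] (D : LatticeData N N₀ Γ)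

open Matrix

/-! ### Upper bounds for the order of vanishing -/

/-- The order of vanishing of `Rⁿ ∘ s` bounds the decay of `Rⁿ` along the curve `φ`, followed from
`φ(z)` in the imaginary direction; `c` is the coefficient of `1` of the section `s`. -/
lemma exists_isBigO_of_vanishesToOrder {n p : ℕ} {z : ℂ}
    {s : Projectivization ℂ (Bal (Fin N₀)) → Bal (Fin N₀)}
    (hs : IsLocalSection D.lagG s (D.projPhi z))
    (hp : VanishesToOrder D.lagG (fun y => D.renorm^[n] (s y)) (D.projPhi z) p) :
    ∃ (c : ℝ → ℂ) (c₀ : ℂ), c₀ ≠ 0 ∧ Tendsto c (𝓝[>] 0) (𝓝 c₀) ∧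
      (fun τ : ℝ => c τ ^ N ^ n • D.renorm^[n] (D.phi (z + Complex.I * τ))) =O[𝓝[>] 0]
        fun τ => τ ^ p := by
  obtain ⟨⟨Fs, hFs, hFseq⟩, hsec⟩ := hs
  obtain ⟨F, hF, hFeq, hO⟩ := hp
  obtain ⟨a, ha, hrep⟩ := exists_gaussPt_rep (D.pencil z)
  have hrep : (D.projPhi z).rep = a • D.phi z := hrep
  set ζ : ℝ → ℂ := fun τ => z + Complex.I * τ with hζ
  have hζc : Continuous ζ := by fun_prop
  have hζ0 : ζ 0 = z := by simp [hζ]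
  have hζt : Tendsto ζ (𝓝[>] 0) (𝓝 z) := by
    have := (hζc.tendsto 0).mono_left (nhdsWithin_le_nhds (s := Set.Ioi 0))
    rwa [hζ0] at this
  set v : ℝ → Bal (Fin N₀) := fun τ => a • D.phi (ζ τ) with hv
  have hvt : Tendsto v (𝓝[>] 0) (𝓝 (D.projPhi z).rep) := by
    rw [hrep]
    exact ((D.continuous_phi.tendsto z).comp hζt).const_smul a
  have hvn : ∀ τ, v τ ≠ 0 := fun τ => smul_ne_zero ha (grassExp_ne_zero _)
  have hmk : ∀ τ, Projectivization.mk ℂ (v τ) (hvn τ) = D.projPhi (ζ τ) := fun τ =>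
    (Projectivization.mk_eq_mk_iff' ℂ _ _ _ _).2 ⟨a, rfl⟩
  have hpull : ∀ (T : Projectivization ℂ (Bal (Fin N₀)) → Bal (Fin N₀)) τ,
      projPull T (v τ) = T (D.projPhi (ζ τ)) := fun T τ => by
    rw [projPull, dif_pos (hvn τ), hmk]
  have hy : Tendsto (fun τ => D.projPhi (ζ τ)) (𝓝[>] 0) (𝓝[D.lagG] (D.projPhi z)) :=
    tendsto_nhdsWithin_iff.2 ⟨(D.continuous_projPhi.tendsto z).comp hζt,
      Eventually.of_forall fun τ => D.projPhi_mem_lagG _⟩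
  have hsphi : ∀ {w : ℂ}, (∃ h : s (D.projPhi w) ≠ 0,
      Projectivization.mk ℂ (s (D.projPhi w)) h = D.projPhi w) →
      s (D.projPhi w) = coeffOne _ (s (D.projPhi w)) • D.phi w := by
    rintro w ⟨h, h1⟩
    obtain ⟨k, hk⟩ := (Projectivization.mk_eq_mk_iff' ℂ _ _ _ _).1 h1
    rw [← hk, map_smul, phi, coeffOne_grassExp, smul_eq_mul, mul_one]
  have hx := hsec.self_of_nhdsWithin (D.projPhi_mem_lagG z)
  refine ⟨fun τ => coeffOne _ (s (D.projPhi (ζ τ))), coeffOne _ (s (D.projPhi z)), ?_, ?_, ?_⟩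
  · intro h0
    have := hsphi hx
    rw [h0, zero_smul] at this
    exact hx.1 this
  · have h1 : Tendsto (fun τ => coeffOne _ (projPull Fs (v τ))) (𝓝[>] 0)
        (𝓝 (coeffOne _ (projPull Fs (D.projPhi z).rep))) :=
      ((analyticAt_coeffOne _).continuousAt.tendsto.comp hFs.continuousAt.tendsto).comp hvt
    have h2 : projPull Fs (D.projPhi z).rep = s (D.projPhi z) := by
      rw [projPull, dif_pos (Projectivization.rep_nonzero _), Projectivization.mk_rep]
      exact hFseq.self_of_nhdsWithin (D.projPhi_mem_lagG z)
    rw [h2] at h1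
    refine h1.congr' ?_
    filter_upwards [hy.eventually hFseq] with τ hτ
    rw [hpull, hτ]
  · have h1 : (fun τ => v τ - (D.projPhi z).rep) =O[𝓝[>] 0] fun τ : ℝ => τ := by
      have h2 := ((D.analyticAt_phi z).differentiableAt.isBigO_sub).comp_tendsto hζt
      have h3 := h2.const_smul_left a
      refine (h3.congr_left fun τ => ?_).trans
        (Asymptotics.IsBigO.of_bound 1 (Eventually.of_forall fun τ => ?_))
      · simp only [hrep, hv, Function.comp_apply, Pi.smul_apply, smul_sub]
      · simp [hζ]
    have h2 := (hO.comp_tendsto hvt).trans (h1.norm_left.pow p)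
    refine h2.congr' ?_ EventuallyEq.rfl
    filter_upwards [hy.eventually hFeq, hy.eventually hsec] with τ h3 h4
    simp only [Function.comp_apply, hpull, h3]
    rw [hsphi h4, iterate_renorm_smul, map_smul, phi, coeffOne_grassExp, smul_eq_mul, mul_one]

lemma le_of_isBigO_pow_mul {m p : ℕ} {u : ℝ → ℂ} {u₀ : ℂ} (hu₀ : u₀ ≠ 0)
    (hu : Tendsto u (𝓝[>] 0) (𝓝 u₀))
    (h : (fun τ : ℝ => (τ : ℂ) ^ m * u τ) =O[𝓝[>] 0] fun τ => τ ^ p) : p ≤ m := by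
  by_contra! hmp
  obtain ⟨C, hC⟩ := h.bound
  have h1 : Tendsto (fun τ : ℝ => C * τ ^ (p - m)) (𝓝[>] 0) (𝓝 0) := by
    have h2 : Continuous fun t : ℝ => C * t ^ (p - m) := by fun_prop
    have h3 := (h2.tendsto 0).mono_left (nhdsWithin_le_nhds (s := Set.Ioi 0))
    rwa [zero_pow (by omega), mul_zero] at h3
  refine hu₀ (tendsto_nhds_unique hu (squeeze_zero_norm' ?_ h1))
  filter_upwards [hC, self_mem_nhdsWithin] with t ht ht0
  have ht0 : 0 < t := ht0
  rw [norm_mul, norm_pow, Complex.norm_real, Real.norm_of_nonneg ht0.le, norm_pow,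
    Real.norm_of_nonneg ht0.le, show t ^ p = t ^ m * t ^ (p - m) by
      rw [← pow_add, Nat.add_sub_cancel' hmp.le], mul_left_comm] at ht
  exact le_of_mul_le_mul_left ht (by positivity)

open Classical in
/-- The order of vanishing at `π(φ(z))` is at most the multiplicity of `z` as a Dirichlet
eigenvalue: along the curve `φ`, the coefficient of `1` of the iterates of `R` is a multiple of the
characteristic polynomial of `H_n⁻`. -/
lemma rho_projPhi_le {n : ℕ} {e : D.Inner n → ℝ} {b : ℂ} (hb : b ≠ 0)
    (hdet : ∀ z : ℂ, ((D.glueMat n (D.pencil z)).submatrix (Subtype.val : D.Inner n → _)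
      Subtype.val).det = b * ∏ x, (z - e x)) (z : ℂ) :
    D.rho n (D.projPhi z) ≤ (Fintype.card {x // (e x : ℂ) = z} : ℕ) := by
  rw [rho]
  refine iSup_le fun s => iSup_le fun hs => iSup_le fun p => iSup_le fun hp => ?_
  obtain ⟨c, c₀, hc₀, hc, hO⟩ := D.exists_isBigO_of_vanishesToOrder hs hp
  -- the points `z + i τ` are not real for small `τ > 0`, so that `A + (z + i τ) I_b` is coercive
  set ζ : ℝ → ℂ := fun τ => z + Complex.I * τ with hζ
  have hζt : Tendsto ζ (𝓝[>] 0) (𝓝 z) := by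
    have hζc : Continuous ζ := by fun_prop
    have := (hζc.tendsto 0).mono_left (nhdsWithin_le_nhds (s := Set.Ioi 0))
    simpa [hζ] using this
  set m := Fintype.card {x // (e x : ℂ) = z} with hm
  have hprod : ∀ τ, ∏ x, (ζ τ - e x) =
      (τ : ℂ) ^ m * (Complex.I ^ m * ∏ x with (e x : ℂ) ≠ z, (ζ τ - e x)) := by
    intro τ
    rw [← Finset.prod_filter_mul_prod_filter_not Finset.univ fun x => (e x : ℂ) = z,
      Finset.prod_congr rfl (g := fun _ => Complex.I * τ) fun x hx => by
        rw [(Finset.mem_filter.1 hx).2]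
        simp [hζ], Finset.prod_const, ← Fintype.card_subtype, mul_pow]
    ring
  set u : ℝ → ℂ := fun τ => c τ ^ N ^ n * (D.gaussConst n * (b *
    (Complex.I ^ m * ∏ x with (e x : ℂ) ≠ z, (ζ τ - e x)))) with hu
  have hut : Tendsto u (𝓝[>] 0) (𝓝 (c₀ ^ N ^ n * (D.gaussConst n * (b *
      (Complex.I ^ m * ∏ x with (e x : ℂ) ≠ z, (z - e x)))))) :=
    (hc.pow _).mul (((tendsto_finsetProd _ fun x _ => hζt.sub_const _).const_mul _
      |>.const_mul _).const_mul _)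
  refine Nat.cast_le.2 (le_of_isBigO_pow_mul ?_ hut ?_)
  · refine mul_ne_zero (pow_ne_zero _ hc₀) (mul_ne_zero ?_ (mul_ne_zero hb (mul_ne_zero
      (pow_ne_zero _ Complex.I_ne_zero) (Finset.prod_ne_zero_iff.2 fun x hx => ?_))))
    · exact_mod_cast (D.gaussConst_pos n).ne'
    · exact sub_ne_zero.2 fun h => (Finset.mem_filter.1 hx).2 h.symm
  · obtain ⟨C, -, hC⟩ := exists_norm_linear_le (coeffOne (Fin N₀)).toLinearMap
    have him : ∀ᶠ τ : ℝ in 𝓝[>] 0, (ζ τ).im ≠ 0 := by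
      have h1 : ∀ τ, (ζ τ).im = z.im + τ := fun τ => by simp [hζ]
      simp only [h1]
      rcases eq_or_ne z.im 0 with h2 | h2
      · filter_upwards [self_mem_nhdsWithin] with τ hτ
        rw [h2, zero_add]
        exact (Set.mem_Ioi.1 hτ).ne'
      · have h3 : Continuous fun τ : ℝ => z.im + τ := by fun_prop
        exact nhdsWithin_le_nhds ((h3.tendsto 0).eventually_ne (by simpa using h2))
    refine Asymptotics.IsBigO.trans (Asymptotics.IsBigO.of_bound C ?_) hO
    filter_upwards [him] with τ hτ
    obtain ⟨θ, δ, -, hδ, hcoer⟩ := D.exists_coer_pencil hτ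
    obtain ⟨S, hS, -⟩ := D.exists_iterate_renorm_grassExp hδ hcoer n
    refine (le_of_eq ?_).trans (hC _)
    rw [AlgHom.toLinearMap_apply, map_smul, phi, hS, map_smul, coeffOne_grassExp, kappa, hdet,
      hprod, hu, smul_eq_mul, smul_eq_mul, mul_one]
    congr 1
    ring

end LatticeData

/-! ### Kernels with double boundary conditions -/

section VanishKer

open Matrix

variable {V : Type} [Fintype V] [DecidableEq V]

/-- The kernel of `M` on the functions vanishing on `S`. -/
def vanishKer (S : Set V) (M : Matrix V V ℝ) : Submodule ℝ (V → ℝ) :=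
  LinearMap.ker (toLin' M) ⊓ LinearMap.ker (LinearMap.funLeft ℝ ℝ (Subtype.val : S → V))

lemma mem_vanishKer {S : Set V} {M : Matrix V V ℝ} {f : V → ℝ} :
    f ∈ vanishKer S M ↔ M *ᵥ f = 0 ∧ ∀ x ∈ S, f x = 0 := by
  rw [vanishKer, Submodule.mem_inf, LinearMap.mem_ker, LinearMap.mem_ker, toLin'_apply]
  refine and_congr_right fun _ => ⟨fun h x hx => congrFun h ⟨x, hx⟩, fun h => ?_⟩
  ext x
  exact h x.1 x.2

variable (S : Set V) [Fintype {x // x ∉ S}] (M : Matrix V V ℝ)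

omit [DecidableEq V] in
lemma mulVec_extend (f : {x // x ∉ S} → ℝ) (x : {x // x ∉ S}) :
    (M *ᵥ Function.extend Subtype.val f 0) x.1 =
      (M.submatrix (Subtype.val : {x // x ∉ S} → V) Subtype.val *ᵥ f) x := by
  rw [mulVec, mulVec, dotProduct, dotProduct]
  symm
  refine Finset.sum_of_injOn Subtype.val Subtype.val_injective.injOn (by simp) ?_ ?_
  · intro y _ hy
    rw [Function.extend_apply' _ _ _ fun ⟨z, hz⟩ => hy ⟨z, by simp, hz⟩, Pi.zero_apply, mul_zero]
  · intro y _
    rw [Subtype.val_injective.extend_apply, submatrix_apply]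

/-- Functions of `vanishKer S M` restrict to the kernel of the block of `M` off `S`. -/
lemma finrank_vanishKer_le : Module.finrank ℝ (vanishKer S M) ≤ Module.finrank ℝ
    (LinearMap.ker (toLin' (M.submatrix (Subtype.val : {x // x ∉ S} → V)
      (Subtype.val : {x // x ∉ S} → V)))) := by
  have hext : ∀ f ∈ vanishKer S M,
      Function.extend Subtype.val (f ∘ (Subtype.val : {x // x ∉ S} → V)) 0 = f := by
    intro f hf
    ext x
    by_cases hx : x ∈ S
    · rw [Function.extend_apply' _ _ _ fun ⟨y, hy⟩ => y.2 (hy ▸ hx), (mem_vanishKer.1 hf).2 x hx]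
      rfl
    · exact Subtype.val_injective.extend_apply _ _ ⟨x, hx⟩
  have h : ∀ f ∈ vanishKer S M, LinearMap.funLeft ℝ ℝ (Subtype.val : {x // x ∉ S} → V) f ∈
      LinearMap.ker (toLin' (M.submatrix (Subtype.val : {x // x ∉ S} → V)
        (Subtype.val : {x // x ∉ S} → V))) := by
    intro f hf
    rw [LinearMap.mem_ker, toLin'_apply]
    ext x
    have h1 := mulVec_extend S M (f ∘ Subtype.val) x
    rw [hext f hf, (mem_vanishKer.1 hf).1] at h1
    exact h1.symm
  refine LinearMap.finrank_le_finrank_of_injective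
    (f := (LinearMap.funLeft ℝ ℝ (Subtype.val : {x // x ∉ S} → V)).restrict h) ?_
  intro f g hfg
  have h1 : f.1 ∘ (Subtype.val : {x // x ∉ S} → V) = g.1 ∘ Subtype.val := congrArg Subtype.val hfg
  exact Subtype.ext (by rw [← hext f.1 f.2, ← hext g.1 g.2, h1])

/-- Dirichlet eigenfunctions are determined, up to those that are also Neumann eigenfunctions, by
their normal derivatives on the boundary. -/
lemma finrank_ker_submatrix_le : Module.finrank ℝ
    (LinearMap.ker (toLin' (M.submatrix (Subtype.val : {x // x ∉ S} → V)
      (Subtype.val : {x // x ∉ S} → V)))) ≤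
      Module.finrank ℝ (vanishKer S M) + S.ncard := by
  classical
  set K := LinearMap.ker (toLin' (M.submatrix (Subtype.val : {x // x ∉ S} → V)
        (Subtype.val : {x // x ∉ S} → V)))
    with hK
  set T := Function.ExtendByZero.linearMap ℝ (Subtype.val : {x // x ∉ S} → V) with hT
  set φ : K →ₗ[ℝ] (S → ℝ) := LinearMap.funLeft ℝ ℝ (Subtype.val : S → V) ∘ₗ toLin' M ∘ₗ T ∘ₗ
    K.subtype with hφ
  have hT1 : ∀ (f : {x // x ∉ S} → ℝ) x, T f x.1 = f x := fun f x =>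
    Subtype.val_injective.extend_apply _ _ x
  have h1 := φ.finrank_range_add_finrank_ker
  have h2 : Module.finrank ℝ (LinearMap.range φ) ≤ S.ncard := by
    refine (Submodule.finrank_le _).trans ?_
    rw [Module.finrank_fintype_fun_eq_card, ← Nat.card_eq_fintype_card, Nat.card_coe_set_eq]
  have hmem : ∀ f ∈ LinearMap.ker φ, (T ∘ₗ K.subtype) f ∈ vanishKer S M := by
    intro f hf
    refine mem_vanishKer.2 ⟨?_, fun x hx => ?_⟩
    · ext x
      by_cases hx : x ∈ S
      · exact congrFun (LinearMap.mem_ker.1 hf) ⟨x, hx⟩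
      · exact (mulVec_extend S M f.1 ⟨x, hx⟩).trans (congrFun (LinearMap.mem_ker.1 f.2) ⟨x, hx⟩)
    · exact Function.extend_apply' _ _ _ fun ⟨y, hy⟩ => y.2 (hy ▸ hx)
  have h3 : Module.finrank ℝ (LinearMap.ker φ) ≤ Module.finrank ℝ (vanishKer S M) := by
    refine LinearMap.finrank_le_finrank_of_injective (f := (T ∘ₗ K.subtype).restrict hmem) ?_
    intro f g hfg
    have h4 : T f.1.1 = T g.1.1 := congrArg Subtype.val hfg
    refine Subtype.ext (Subtype.ext (funext fun x => ?_))
    rw [← hT1 f.1.1, h4, hT1]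
  omega

end VanishKer

/-! ### The Neumann–Dirichlet eigenspaces -/

namespace LatticeData

variable {N N₀ : ℕ} {Γ : Type*} [Group Γ] (D : LatticeData N N₀ Γ)

open Matrix

open Classical in
/-- The space of Neumann–Dirichlet eigenfunctions, which does not depend on the blow-up. -/
def ndKer (n : ℕ) (t : ℝ) : Submodule ℝ (D.Vert n → ℝ) :=
  vanishKer (D.bdry n) (D.baseA n + t • diagonal (D.baseB n))

lemma ndSpace_eq (ω : ℕ → Fin N) (n : ℕ) (t : ℝ) : D.ndSpace ω n t = D.ndKer n t := by
  classical
  have hs := (D.blowupScale_pos ω n).ne'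
  ext f
  rw [ndKer, mem_vanishKer, and_comm]
  change _ ∧ _ ↔ _
  refine and_congr_right fun _ => ?_
  have h1 : ∀ x, ((D.baseA n + t • diagonal (D.baseB n)) *ᵥ f) x =
      (D.baseA n *ᵥ f) x + t * (D.baseB n x * f x) := fun x => by
    rw [add_mulVec, smul_mulVec, Pi.add_apply, Pi.smul_apply, mulVec_diagonal, smul_eq_mul]
  have h2 : ∀ g : D.Vert n → ℝ, (∑ x, (D.opAn ω n *ᵥ f) x * g x =
      -t * ∑ x, f x * g x * D.massN ω n x) ↔
      ∑ x, ((D.baseA n + t • diagonal (D.baseB n)) *ᵥ f) x * g x = 0 := by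
    intro g
    have h3 : ∑ x, (D.opAn ω n *ᵥ f) x * g x + t * ∑ x, f x * g x * D.massN ω n x =
        D.blowupScale ω n * ∑ x, ((D.baseA n + t • diagonal (D.baseB n)) *ᵥ f) x * g x := by
      rw [Finset.mul_sum, Finset.mul_sum, ← Finset.sum_add_distrib]
      refine Finset.sum_congr rfl fun x _ => ?_
      rw [h1, opAn_eq, massN_eq, smul_mulVec, Pi.smul_apply, smul_eq_mul]
      ring
    rw [← mul_eq_zero_iff_left hs, ← h3]
    constructor <;> intro h <;> linarith
  simp only [h2]
  constructor
  · intro h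
    ext x
    have h4 := h (Pi.single x 1)
    rwa [Finset.sum_eq_single x (fun y _ hy => by rw [Pi.single_eq_of_ne hy, mul_zero]) (by simp),
      Pi.single_eq_same, mul_one] at h4
  · intro h g
    simp [h]

lemma mem_ndKer_iff {n : ℕ} {t : ℝ} {f : D.Vert n → ℝ} : f ∈ D.ndKer n t ↔
    D.glueMat n (D.pencil t) *ᵥ (fun x => (f x : ℂ)) = 0 ∧ ∀ x ∈ D.bdry n, f x = 0 := by
  classical
  rw [ndKer, mem_vanishKer]
  refine and_congr_left fun _ => ?_
  have h1 : ∀ x, (D.glueMat n (D.pencil t) *ᵥ (fun x => (f x : ℂ))) x =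
      (((D.baseA n + t • diagonal (D.baseB n)) *ᵥ f) x : ℝ) := by
    intro x
    rw [glueMat_pencil, mulVec, mulVec, dotProduct, dotProduct]
    push_cast
    refine Finset.sum_congr rfl fun y _ => ?_
    by_cases h : x = y <;> simp [h]
  constructor
  · intro h
    ext x
    rw [h1, h]
    simp
  · intro h
    ext x
    have := h1 x
    rw [h, Pi.zero_apply] at this
    exact_mod_cast this.symm

/-- Neumann–Dirichlet eigenfunctions on the `N` cells can be glued. -/
lemma mul_finrank_ndKer_le (n : ℕ) (t : ℝ) :
    N * Module.finrank ℝ (D.ndKer n t) ≤ Module.finrank ℝ (D.ndKer (n + 1) t) := by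
  choose i w hiw using fun v : D.Vert (n + 1) => D.exists_subcell v
  let L : (Fin N → D.ndKer n t) →ₗ[ℝ] (D.Vert (n + 1) → ℝ) :=
    { toFun := fun F v => (F (i v)).1 (w v)
      map_add' := fun F G => rfl
      map_smul' := fun c F => rfl }
  have hL : ∀ F j u, L F (D.subcell j u) = (F j).1 u := by
    intro F j u
    change (F (i _)).1 (w _) = _
    rcases D.subcell_eq_subcell (hiw (D.subcell j u)) with ⟨h1, h2⟩ | ⟨x, y, h1, h2, -⟩
    · rw [h1, h2]
    · rw [h1, h2, (D.mem_ndKer_iff.1 (F _).2).2 _ ⟨x, rfl⟩,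
        (D.mem_ndKer_iff.1 (F j).2).2 _ ⟨y, rfl⟩]
  have hmem : ∀ F, L F ∈ D.ndKer (n + 1) t := by
    intro F
    refine D.mem_ndKer_iff.2 ⟨?_, ?_⟩
    · rw [glueMat_succ_mulVec]
      refine Finset.sum_eq_zero fun j _ => ?_
      have h1 : (fun x => (L F x : ℂ)) ∘ D.subcell j = fun u => (((F j).1 u : ℝ) : ℂ) := by
        ext u
        rw [Function.comp_apply, hL]
      rw [h1, (D.mem_ndKer_iff.1 (F j).2).1, map_zero, smul_zero]
    · rintro _ ⟨x, rfl⟩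
      rw [bdryPt_succ, hL]
      exact (D.mem_ndKer_iff.1 (F _).2).2 _ ⟨x, rfl⟩
  have h1 := LinearMap.finrank_le_finrank_of_injective (f := L.codRestrict _ hmem) (by
    intro F G h
    refine funext fun j => Subtype.ext (funext fun u => ?_)
    rw [← hL F j u, ← hL G j u]
    exact congrFun (congrArg Subtype.val h) _)
  rwa [Module.finrank_pi_fintype, Finset.sum_const, Finset.card_univ, Fintype.card_fin,
    smul_eq_mul] at h1

end LatticeData

namespace LatticeData

variable {N N₀ : ℕ} {Γ : Type*} [Group Γ] (D : LatticeData N N₀ Γ)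

open Matrix

/-! ### The density of Neumann–Dirichlet eigenvalues -/

/-- The number of Neumann–Dirichlet eigenfunctions for the value `t`, per cell. -/
def ndFreq (n : ℕ) (t : ℝ) : ℝ≥0∞ :=
  (Module.finrank ℝ (D.ndKer n t) : ℝ≥0∞) / (N : ℝ≥0∞) ^ n

lemma ncard_bdry (n : ℕ) : (D.bdry n).ncard = N₀ := by
  rw [bdry, ← Set.image_univ, Set.ncard_image_of_injective _ (D.bdryPt_injective n),
    Set.ncard_univ, Nat.card_eq_fintype_card, Fintype.card_fin]

/-- The multiplicities of the Neumann–Dirichlet eigenvalues and the orders of vanishing along `φ`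
are both equal, up to `N₀`, to the multiplicities of the Dirichlet eigenvalues. -/
lemma exists_multiplicity_bounds :
    (∀ n t, (Module.finrank ℝ (D.ndKer n t) : ℕ∞) ≤ D.rho n (D.projPhi t) + N₀) ∧
    (∀ n (t : ℝ), D.rho n (D.projPhi t) ≤ (Module.finrank ℝ (D.ndKer n t) + N₀ : ℕ)) ∧
    (∀ n (z : ℂ), z.im ≠ 0 → D.rho n (D.projPhi z) = 0) ∧
    ∀ n (s : Finset ℝ), ∑ t ∈ s, Module.finrank ℝ (D.ndKer n t) ≤ N ^ n * N₀ := by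
  classical
  obtain ⟨C, e, -, -, hker, hdet, hpert⟩ := D.exists_eigenvalues_minus
  have hsub : ∀ n (t : ℝ), (D.baseA n + t • diagonal (D.baseB n)).submatrix
      (Subtype.val : D.Inner n → _) (Subtype.val : D.Inner n → _) =
      (D.baseA n).submatrix (Subtype.val : D.Inner n → _) Subtype.val +
        t • diagonal (D.baseB n ∘ Subtype.val) := by
    intro n t
    ext x y
    by_cases h : x = y
    · simp [h]
    · have : x.1 ≠ y.1 := fun h' => h (Subtype.ext h')
      simp [h, this]
  have h1 : ∀ n t, Module.finrank ℝ (D.ndKer n t) ≤ Fintype.card {x // e n x = t} := by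
    intro n t
    rw [← hker n t, ← hsub, ndKer]
    convert finrank_vanishKer_le (D.bdry n) (D.baseA n + t • diagonal (D.baseB n))
  have h2 : ∀ n t, Fintype.card {x // e n x = t} ≤ Module.finrank ℝ (D.ndKer n t) + N₀ := by
    intro n t
    have h3 := finrank_ker_submatrix_le (D.bdry n) (D.baseA n + t • diagonal (D.baseB n))
    rw [ncard_bdry] at h3
    rw [← hker n t, ← hsub, ndKer]
    convert h3
  have hrho : ∀ n (z : ℂ), D.rho n (D.projPhi z) ≤ (Fintype.card {x // (e n x : ℂ) = z} : ℕ) :=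
    fun n => D.rho_projPhi_le (Finset.prod_ne_zero_iff.2 fun x _ => by
      exact_mod_cast (D.baseB_pos n x.1).ne') (hdet n)
  refine ⟨fun n t => ?_, fun n t => ?_, fun n z hz => ?_, fun n s => ?_⟩
  · rcases le_total (Fintype.card {x // e n x = t}) N₀ with h | h
    · exact le_add_left (by exact_mod_cast (h1 n t).trans h)
    · obtain ⟨p, hp⟩ := Nat.exists_eq_add_of_le' h
      have h3 := D.le_rho (n := n) (p := p) (t₀ := t) fun H => by rw [← hp]; exact hpert n t H
      calc (Module.finrank ℝ (D.ndKer n t) : ℕ∞) ≤ (p + N₀ : ℕ) := by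
            exact_mod_cast hp ▸ h1 n t
        _ ≤ _ := by push_cast; gcongr
  · refine (hrho n t).trans ?_
    have : Fintype.card {x // (e n x : ℂ) = t} = Fintype.card {x // e n x = t} :=
      Fintype.card_congr (Equiv.subtypeEquivRight fun x => Complex.ofReal_inj)
    rw [this]
    exact_mod_cast h2 n t
  · refine le_antisymm ((hrho n z).trans ?_) zero_le
    have : IsEmpty {x // (e n x : ℂ) = z} := ⟨fun x => hz (by rw [← x.2, Complex.ofReal_im])⟩
    rw [Fintype.card_eq_zero]
    simp
  · refine (Finset.sum_le_sum fun t _ => h1 n t).trans ?_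
    refine le_trans ?_ (D.card_inner_le n)
    rw [Finset.sum_congr rfl fun t _ => Fintype.card_subtype fun x => e n x = t,
      ← Finset.card_biUnion fun a _ b _ hab => Finset.disjoint_filter.2
        fun x _ h h' => hab (h.symm.trans h')]
    exact Finset.card_le_univ _

lemma ndFreq_mono (t : ℝ) : Monotone fun n => D.ndFreq n t := by
  refine monotone_nat_of_le_succ fun n => ?_
  have h : (N : ℝ≥0∞) * (Module.finrank ℝ (D.ndKer n t) : ℝ≥0∞) ≤
      (Module.finrank ℝ (D.ndKer (n + 1) t) : ℝ≥0∞) := by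
    exact_mod_cast D.mul_finrank_ndKer_le n t
  have hN : (N : ℝ≥0∞) ≠ 0 := by have := D.two_le; simp; omega
  rw [ndFreq, ndFreq, pow_succ']
  calc (Module.finrank ℝ (D.ndKer n t) : ℝ≥0∞) / (N : ℝ≥0∞) ^ n
      = (N * (Module.finrank ℝ (D.ndKer n t) : ℝ≥0∞)) / (N * (N : ℝ≥0∞) ^ n) :=
        (ENNReal.mul_div_mul_left _ _ hN (by simp)).symm
    _ ≤ _ := by gcongr

/-- The bounded differences between multiplicities and orders of vanishing disappear in the limit. -/
lemma tendsto_ndFreq (t : ℝ) :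
    Tendsto (fun n => D.ndFreq n t) atTop (𝓝 (D.rhoInf (D.projPhi t))) := by
  obtain ⟨h1, h2, -, -⟩ := D.exists_multiplicity_bounds
  have h3 := tendsto_atTop_iSup (D.ndFreq_mono t)
  set s := ⨆ n, D.ndFreq n t
  have h4 := D.tendsto_rhoSeq (D.projPhi t)
  have h5 : Tendsto (fun n : ℕ => (N₀ : ℝ≥0∞) / (N : ℝ≥0∞) ^ n) atTop (𝓝 0) := by
    have hN : (1 : ℝ≥0∞) < N := by exact_mod_cast D.two_le
    have h6 := ENNReal.Tendsto.const_mul (ENNReal.tendsto_pow_atTop_nhds_zero_of_lt_one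
      (ENNReal.inv_lt_one.2 hN)) (Or.inr (ENNReal.natCast_ne_top N₀))
    rw [mul_zero] at h6
    refine h6.congr fun n => ?_
    rw [ENNReal.div_eq_inv_mul, mul_comm, ENNReal.inv_pow]
  have h6 : D.rhoInf (D.projPhi t) ≤ s := by
    have h7 := h3.add h5
    rw [add_zero] at h7
    refine le_of_tendsto_of_tendsto' h4 h7 fun n => ?_
    rw [rhoSeq, ndFreq, ← ENNReal.add_div]
    gcongr
    exact_mod_cast ENat.toENNReal_le.2 (h2 n t)
  have h8 : s ≤ D.rhoInf (D.projPhi t) := by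
    have h7 := h4.add h5
    rw [add_zero] at h7
    refine le_of_tendsto_of_tendsto' h3 h7 fun n => ?_
    rw [rhoSeq, ndFreq, ← ENNReal.add_div]
    gcongr
    exact_mod_cast ENat.toENNReal_le.2 (h1 n t)
  rwa [le_antisymm h6 h8]

lemma ndFreq_le (n : ℕ) (t : ℝ) : D.ndFreq n t ≤ D.rhoInf (D.projPhi t) :=
  (D.ndFreq_mono t).ge_of_tendsto (D.tendsto_ndFreq t) n

lemma rhoInf_of_im_ne_zero {z : ℂ} (hz : z.im ≠ 0) : D.rhoInf (D.projPhi z) = 0 := by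
  obtain ⟨-, -, h, -⟩ := D.exists_multiplicity_bounds
  refine tendsto_nhds_unique (D.tendsto_rhoSeq _) (tendsto_const_nhds.congr fun n => ?_)
  rw [rhoSeq, h n z hz]
  simp

/-- There are at most `N ^ n * N₀` eigenfunctions on `F_n`. -/
lemma tsum_rhoInf_le : ∑' t : ℝ, D.rhoInf (D.projPhi t) ≤ N₀ := by
  obtain ⟨-, -, -, h⟩ := D.exists_multiplicity_bounds
  rw [ENNReal.tsum_eq_iSup_sum]
  refine iSup_le fun s => ?_
  refine le_of_tendsto' (tendsto_finsetSum s fun t _ => D.tendsto_ndFreq t) fun n => ?_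
  simp only [ndFreq, ENNReal.div_eq_inv_mul, ← Finset.mul_sum]
  rw [← ENNReal.div_eq_inv_mul]
  refine ENNReal.div_le_of_le_mul ?_
  rw [mul_comm]
  exact_mod_cast h n s

lemma rhoInf_ne_top (t : ℝ) : D.rhoInf (D.projPhi t) ≠ ⊤ :=
  ((ENNReal.le_tsum t).trans D.tsum_rhoInf_le |>.trans_lt (ENNReal.natCast_lt_top _)).ne

/-- The measure `∑ ρ_∞(π(φ(t))) δ_t` on the real line. -/
def ndMeasure : FiniteMeasure ℝ :=
  ⟨Measure.sum fun t : ℝ => D.rhoInf (D.projPhi t) • Measure.dirac t, ⟨by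
    rw [Measure.sum_apply _ MeasurableSet.univ]
    simp only [Measure.smul_apply, measure_univ, smul_eq_mul, mul_one]
    exact D.tsum_rhoInf_le.trans_lt (ENNReal.natCast_lt_top _)⟩⟩

lemma toMeasure_ndMeasure : (D.ndMeasure : Measure ℝ) =
    Measure.sum fun t : ℝ => D.rhoInf (D.projPhi t) • Measure.dirac t := rfl

lemma map_ndMeasure : (D.ndMeasure : Measure ℝ).map (fun t : ℝ => (t : ℂ)) =
    Measure.sum fun z : ℂ => D.rhoInf (D.projPhi z) • Measure.dirac z := by
  ext s hs
  have hm : Measurable fun t : ℝ => (t : ℂ) := Complex.continuous_ofReal.measurable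
  rw [Measure.map_apply hm hs, toMeasure_ndMeasure, Measure.sum_apply _ (hm hs),
    Measure.sum_apply _ hs]
  rw [← Complex.ofReal_injective.tsum_eq
    (f := fun z : ℂ => (D.rhoInf (D.projPhi z) • Measure.dirac z) s)]
  · refine tsum_congr fun t => ?_
    rw [Measure.smul_apply, Measure.smul_apply, Measure.dirac_apply' _ hs,
      Measure.dirac_apply' _ (hm hs)]
    rfl
  · intro z hz
    by_contra h
    refine hz ?_
    have : z.im ≠ 0 := fun h' => h ⟨z.re, Complex.ext rfl (by simp [h'])⟩
    simp [D.rhoInf_of_im_ne_zero this]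

lemma integral_ndMeasure (f : BoundedContinuousFunction ℝ ℝ) :
    ∫ t, f t ∂(D.ndMeasure : Measure ℝ) = ∑' t : ℝ, (D.rhoInf (D.projPhi t)).toReal * f t := by
  have hf : Integrable f (D.ndMeasure : Measure ℝ) := f.integrable _
  rw [toMeasure_ndMeasure] at hf ⊢
  rw [integral_sum_measure hf]
  simp [integral_smul_measure]

lemma integral_nuND (ω : ℕ → Fin N) (n : ℕ) (f : BoundedContinuousFunction ℝ ℝ) :
    ∫ t, f t ∂((((N : ℝ≥0) ^ n)⁻¹ • D.nuND ω n : FiniteMeasure ℝ) : Measure ℝ) =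
      ∑' t : ℝ, (D.ndFreq n t).toReal * f t := by
  classical
  obtain ⟨-, e, -, hroots, hker, -⟩ := D.exists_eigenvalues_plus
  have h0 : ∀ t ∉ (D.hPlus ω n).charpoly.roots.toFinset, (D.ndFreq n t).toReal * f t = 0 := by
    intro t ht
    have h1 : Module.finrank ℝ (D.ndKer n t) = 0 := by
      have h2 : Module.finrank ℝ (D.ndKer n t) ≤ Module.finrank ℝ
          (LinearMap.ker (toLin' (D.baseA n + t • diagonal (D.baseB n)))) := by
        rw [ndKer, vanishKer]
        convert Submodule.finrank_mono (inf_le_left (a := LinearMap.ker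
          (toLin' (D.baseA n + t • diagonal (D.baseB n)))))
      have h3 : IsEmpty {x // e n x = t} := by
        refine ⟨fun x => ht ?_⟩
        rw [hroots, Multiset.mem_toFinset, Multiset.mem_map]
        exact ⟨x.1, Finset.mem_univ _, x.2⟩
      rw [hker, Fintype.card_eq_zero] at h2
      exact Nat.le_zero.1 h2
    rw [ndFreq, h1]
    simp
  rw [tsum_eq_sum fun t ht => h0 t ht, nuND, FiniteMeasure.toMeasure_smul,
    integral_smul_nnreal_measure, FiniteMeasure.toMeasure_sum, integral_finsetSum_measure]
  · rw [NNReal.smul_def, smul_eq_mul, Finset.mul_sum]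
    refine Finset.sum_congr (by congr!) fun t _ => ?_
    rw [FiniteMeasure.toMeasure_smul, integral_smul_nnreal_measure, ndSpace_eq]
    change _ * (_ • ∫ t, f t ∂(Measure.dirac t)) = _
    rw [integral_dirac, ndFreq, NNReal.smul_def, smul_eq_mul, ENNReal.toReal_div,
      ENNReal.toReal_natCast, ENNReal.toReal_pow, ENNReal.toReal_natCast]
    push_cast
    ring
  · intro t _
    exact f.integrable _

/-- The multiplicities per cell increase to their limits, which are summable, so that the measures
converge by dominated convergence. -/
theorem isDensityOfND_ndMeasure (ω : ℕ → Fin N) : D.IsDensityOfND ω D.ndMeasure := by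
  rw [IsDensityOfND, FiniteMeasure.tendsto_iff_forall_integral_tendsto]
  intro f
  simp_rw [integral_nuND, integral_ndMeasure]
  have hs : Summable fun t : ℝ => (D.rhoInf (D.projPhi t)).toReal :=
    ENNReal.summable_toReal (D.tsum_rhoInf_le.trans_lt (ENNReal.natCast_lt_top _)).ne
  refine tendsto_tsum_of_dominated_convergence (hs.mul_right ‖f‖) (fun t => ?_)
    (Eventually.of_forall fun n t => ?_)
  · exact ((ENNReal.tendsto_toReal (D.rhoInf_ne_top t)).comp (D.tendsto_ndFreq t)).mul_const _
  · rw [norm_mul, Real.norm_of_nonneg ENNReal.toReal_nonneg]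
    exact mul_le_mul (ENNReal.toReal_mono (D.rhoInf_ne_top t) (D.ndFreq_le n t))
      (f.norm_coe_le_norm t) (norm_nonneg _) ENNReal.toReal_nonneg

end LatticeData

end

theorem theorem3p1 {N N₀ : ℕ} {Γ : Type*} [Group Γ] [Finite Γ] (D : LatticeData N N₀ Γ) :
    (∀ x, Tendsto (fun n => D.greenSeq n x) atTop (𝓝 (D.green x)) ∧ D.green x ≠ ⊤) ∧
    (∀ x ∈ D.lagG, Tendsto (fun n => D.rhoSeq n x) atTop (𝓝 (D.rhoInf x))) ∧
    (∃ μ : FiniteMeasure ℝ, (∀ ω : ℕ → Fin N, D.IsDensityOfStates ω μ) ∧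
      IsLaplacianOver2Pi (fun z => D.green (D.phi z))
        ((μ : Measure ℝ).map (fun t : ℝ => (t : ℂ)))) ∧
    (∃ μND : FiniteMeasure ℝ, (∀ ω : ℕ → Fin N, D.IsDensityOfND ω μND) ∧
      (μND : Measure ℝ).map (fun t : ℝ => (t : ℂ)) =
        Measure.sum fun z : ℂ => D.rhoInf (D.projPhi z) • Measure.dirac z) :=
  ⟨D.tendsto_greenSeq, fun x _ => D.tendsto_rhoSeq x, D.exists_densityOfStates,
    D.ndMeasure, D.isDensityOfND_ndMeasure, D.map_ndMeasure⟩
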